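/- **Theorem 1.** For $n\ge 0$ let $\lfloor n/2\rfloor$ denote the integer part of $n/2$, and let $$L=\bigcup_{n}\{\,b_{0^n}@\cdots @b_{1^n}\#x\#y\#\ \mid\ b_i\in\{0,1\}^{\lfloor n/2\rfloor}\text{ for all } i\in\{0,1\}^n,\ x,y\in\{0,1\}^n,\ b_x=b_y\,\},$$ a language over the alphabet $\{0,1,@,\#\}$, where the blocks $b_i$ are listed in the lexicographic order of the strings $i\in\{0,1\}^n$. A (deterministic) Kolmogorov–Uspensky machine has a finite set of control states, a finite set of colours and a radius $r$. Its storage is a finite undirected simple graph with a distinguished active vertex; every edge carries a colour at each of its two ends, and the edges at one vertex have distinct colours at that vertex, so the degree is bounded by the number of colours. It starts with a single vertex. According to its control state, the machine in one step either reads the next input symbol (or learns that the input is exhausted) and changes its state, or performs a local transformation, or else it has halted, accepting or rejecting. A local transformation is determined by the control state and the isomorphism type of the vicinity of radius $r$ of the active vertex; it creates a fixed number of new vertices, adds and removes edges among the new vertices and those of the vicinity, and selects a new active vertex and a new control state. There is a Kolmogorov–Uspensky machine that accepts $L$ in real time: it accepts exactly the words of $L$, and there is a constant $c$ such that on every input word,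 at every moment of the computation, at most $c$ steps pass until the machine reads the next input symbol or has halted. -/

import Mathlib

/-! ### Storage: finite undirected simple graphs of bounded degree with local edge colours -/

/-- The storage of a Kolmogorov–Uspensky machine: a finite undirected simple graph.
The vertices created so far are `0, …, size - 1`.  Every edge carries at each of its two ends a
colour from `Δ`, and the edges at one vertex have pairwise distinct colours there, so every degree
is at most the number of colours.  `nbr u a` is the other end of the edge
that has colour `a` at `u`, if there is such an edge. -/
structure KUGraph (Δ : Type) where
  size : ℕ
  nbr : ℕ → Δ → Option ℕ
  /-- only created vertices carry edges -/
  lt_size : ∀ {u a v}, nbr u a = some v → u < size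
  /-- edges are undirected -/
  symm : ∀ {u a v}, nbr u a = some v → ∃ b, nbr v b = some u
  /-- there are no parallel edges -/
  inj : ∀ {u a b v}, nbr u a = some v → nbr u b = some v → a = b
  /-- there are no loops -/
  irrefl : ∀ {u a}, nbr u a ≠ some u

namespace KUGraph

variable {Δ : Type}

/-- The graph with one vertex and no edge. -/
def single (Δ : Type) : KUGraph Δ where
  size := 1
  nbr := fun _ _ => none
  lt_size := by simp
  symm := by simp
  inj := by simp
  irrefl := by simp

/-- Add `k` new isolated vertices `size, …, size + k - 1`. -/
def grow (G : KUGraph Δ) (k : ℕ) : KUGraph Δ where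
  size := G.size + k
  nbr := G.nbr
  lt_size := fun h => Nat.lt_add_right k (G.lt_size h)
  symm := G.symm
  inj := G.inj
  irrefl := G.irrefl

/-- The vertex reached from `u` by following the edges with the colours of the given word. -/
def walk (G : KUGraph Δ) : ℕ → List Δ → Option ℕ
  | u, [] => some u
  | u, a :: w => (G.nbr u a).bind fun v => G.walk v w

/-- When the edge `{u, v}` with colour `a` at `u` and colour `b` at `v` can be added: the ends are
distinct existing vertices, not adjacent, and the two colours are still free there. -/
def CanJoin (G : KUGraph Δ) (u : ℕ) (a : Δ) (v : ℕ) (b : Δ) : Prop :=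
  u < G.size ∧ v < G.size ∧ u ≠ v ∧ (∀ c, G.nbr u c ≠ some v) ∧ G.nbr u a = none ∧ G.nbr v b = none

open Classical in
/-- Add the edge `{u, v}` with colour `a` at `u` and `b` at `v`; no effect if this is
impossible. -/
noncomputable def join (G : KUGraph Δ) (u : ℕ) (a : Δ) (v : ℕ) (b : Δ) : KUGraph Δ :=
  if h : G.CanJoin u a v b then
    { size := G.size
      nbr := fun x c =>
        if x = u ∧ c = a then some v else if x = v ∧ c = b then some u else G.nbr x c
      lt_size := by
        obtain ⟨hu, hv, -⟩ := h
        intro x c y hxy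
        split_ifs at hxy with h1 h2
        · exact h1.1 ▸ hu
        · exact h2.1 ▸ hv
        · exact G.lt_size hxy
      symm := by
        obtain ⟨hu, hv, huv, hadj, hua, hvb⟩ := h
        intro x c y hxy
        split_ifs at hxy with h1 h2
        · obtain ⟨rfl, rfl⟩ := h1
          cases hxy
          exact ⟨b, by simp [huv.symm]⟩
        · obtain ⟨rfl, rfl⟩ := h2
          cases hxy
          exact ⟨a, by simp⟩
        · obtain ⟨d, hd⟩ := G.symm hxy
          refine ⟨d, ?_⟩
          have e1 : ¬ (y = u ∧ d = a) := by
            rintro ⟨rfl, rfl⟩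
            simp [hua] at hd
          have e2 : ¬ (y = v ∧ d = b) := by
            rintro ⟨rfl, rfl⟩
            simp [hvb] at hd
          simp [e1, e2, hd]
      inj := by
        obtain ⟨hu, hv, huv, hadj, hua, hvb⟩ := h
        have hadj' : ∀ c, G.nbr v c ≠ some u := by
          intro c hc
          obtain ⟨d, hd⟩ := G.symm hc
          exact hadj d hd
        intro x c d y hc hd
        split_ifs at hc hd with h1 h2 h3 h4 h5 h6 h7 h8
        all_goals first
          | exact G.inj hc hd
          | (simp only [Option.some.injEq] at hc hd
             subst_vars
             simp_all)
      irrefl := by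
        obtain ⟨hu, hv, huv, hadj, hua, hvb⟩ := h
        intro x c hxy
        split_ifs at hxy with h1 h2
        · simp only [Option.some.injEq] at hxy
          exact huv (h1.1.symm.trans hxy.symm)
        · simp only [Option.some.injEq] at hxy
          exact huv (hxy.trans h2.1)
        · exact G.irrefl hxy }
  else G

open Classical in
/-- Remove the edge between `u` and `v`; no effect if they are not adjacent. -/
noncomputable def remove (G : KUGraph Δ) (u v : ℕ) : KUGraph Δ where
  size := G.size
  nbr := fun x c =>
    if (x = u ∧ G.nbr x c = some v) ∨ (x = v ∧ G.nbr x c = some u) then none else G.nbr x c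
  lt_size := by
    intro x c y h
    split_ifs at h with h1
    exact G.lt_size h
  symm := by
    intro x c y h
    split_ifs at h with h1
    obtain ⟨d, hd⟩ := G.symm h
    refine ⟨d, ?_⟩
    rw [if_neg, hd]
    rintro (⟨rfl, h2⟩ | ⟨rfl, h2⟩)
    · rw [hd] at h2
      cases h2
      exact h1 (Or.inr ⟨rfl, h⟩)
    · rw [hd] at h2
      cases h2
      exact h1 (Or.inl ⟨rfl, h⟩)
  inj := by
    intro x c d y hc hd
    split_ifs at hc with h1
    split_ifs at hd with h2
    exact G.inj hc hd
  irrefl := by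
    intro x c h
    split_ifs at h with h1
    exact G.irrefl h

/-- Remove the edge that has colour `a` at `u`, if there is one. -/
noncomputable def cut (G : KUGraph Δ) (u : ℕ) (a : Δ) : KUGraph Δ :=
  match G.nbr u a with
  | none => G
  | some v => G.remove u v

end KUGraph

/-! ### Kolmogorov–Uspensky machines -/

namespace KUM

/-- Words of at most `r` colours; they address the vertices at distance at most `r` from the active
vertex. -/
abbrev Word (Δ : Type) (r : ℕ) : Type := {w : List Δ // w.length ≤ r}

/-- What a machine can see: the isomorphism type of the vicinity of the active vertex, given by the
pairs of words that lead from the active vertex to one and the same vertex (the pair `(w, w)`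
belongs to it when the word `w` leads to a vertex at all). -/
abbrev View (Δ : Type) (r : ℕ) : Type := Set (Word Δ r × Word Δ r)

/-- The vicinity of the vertex `v` in `G`. -/
def view {Δ : Type} (r : ℕ) (G : KUGraph Δ) (v : ℕ) : View Δ r :=
  {p | ∃ x, G.walk v p.1.1 = some x ∧ G.walk v p.2.1 = some x}

/-- A vertex named in a local transformation that creates `k` new vertices: a vertex
of the old vicinity, or one of the new vertices. -/
inductive Ref (Δ : Type) (r k : ℕ) where
  | old (w : Word Δ r)
  | fresh (i : Fin k)

/-- Elementary modifications of the graph: add an edge with given colours at its two ends, or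
remove the edge that has a given colour at a given vertex. -/
inductive Edit (Δ : Type) (r k : ℕ) where
  | join (u : Ref Δ r k) (a : Δ) (v : Ref Δ r k) (b : Δ)
  | cut (u : Ref Δ r k) (a : Δ)

/-- A local transformation: create `fresh` new vertices, carry out the edits in the listed order,
make the vertex `active` the active one, and go to the control state `next`. -/
structure Action (Q Δ : Type) (r : ℕ) where
  next : Q
  fresh : ℕ
  edits : List (Edit Δ r fresh)
  active : Ref Δ r fresh

/-- Instructions.  `read` asks for the next input symbol and gets `none` at the end of the input;
`transform` replaces the vicinity of the active vertex as its isomorphism type dictates. -/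
inductive Instr (Γ Q Δ : Type) (r : ℕ) where
  | accept
  | reject
  | read (next : Option Γ → Q)
  | transform (act : View Δ r → Action Q Δ r)

end KUM

/-- A (deterministic) Kolmogorov–Uspensky machine with input alphabet `Γ`: finitely many control
states and colours, a fixed radius of the vicinity of the active vertex, and a program. -/
structure KUM (Γ : Type) where
  Q : Type
  Δ : Type
  finiteQ : Finite Q
  finiteΔ : Finite Δ
  radius : ℕ
  start : Q
  program : Q → KUM.Instr Γ Q Δ radius

namespace KUM

variable {Γ : Type} (M : KUM Γ)

/-- Configurations: control state, storage graph, active vertex, input not yet read. -/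
structure Config where
  state : M.Q
  graph : KUGraph M.Δ
  active : ℕ
  input : List Γ

/-- The machine starts with one vertex. -/
def init (w : List Γ) : M.Config := ⟨M.start, KUGraph.single M.Δ, 0, w⟩

/-- The vertex meant by a name, relative to the graph `G` and its active vertex `v` before the
transformation. -/
def Ref.resolve {Δ : Type} {r k : ℕ} (G : KUGraph Δ) (v : ℕ) : Ref Δ r k → Option ℕ
  | .old w => G.walk v w.1
  | .fresh i => some (G.size + i)

/-- Carry out one edit on `H`, where `G` and `v` are the graph and the active vertex before the
transformation.  An edit that names a vertex which does not exist has no effect. -/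
noncomputable def Edit.apply {Δ : Type} {r k : ℕ} (G : KUGraph Δ) (v : ℕ) (H : KUGraph Δ) :
    Edit Δ r k → KUGraph Δ
  | .join x a y b =>
    match x.resolve G v, y.resolve G v with
    | some x', some y' => H.join x' a y' b
    | _, _ => H
  | .cut x a =>
    match x.resolve G v with
    | some x' => H.cut x' a
    | none => H

/-- The graph after a local transformation of `G` at the active vertex `v`. -/
noncomputable def Action.graph {Q Δ : Type} {r : ℕ} (A : Action Q Δ r) (G : KUGraph Δ) (v : ℕ) :
    KUGraph Δ :=
  A.edits.foldl (fun H e => e.apply G v H) (G.grow A.fresh)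

/-- One step of computation; halting configurations do not change. -/
noncomputable def step (C : M.Config) : M.Config :=
  match M.program C.state with
  | .accept => C
  | .reject => C
  | .read next => { C with state := next C.input.head?, input := C.input.tail }
  | .transform act =>
    let A := act (view M.radius C.graph C.active)
    { state := A.next
      graph := A.graph C.graph C.active
      active := (A.active.resolve C.graph C.active).getD C.active
      input := C.input }

/-- The configuration after `t` steps on input `w`. -/
noncomputable def run (w : List Γ) (t : ℕ) : M.Config := M.step^[t] (M.init w)

/-- The machine has halted, accepting. -/
def Config.Accepting {M : KUM Γ} (C : M.Config) : Prop := M.program C.state = .accept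

/-- The machine has halted. -/
def Config.Halted {M : KUM Γ} (C : M.Config) : Prop :=
  M.program C.state = .accept ∨ M.program C.state = .reject

/-- The next step of the machine reads a symbol of the input. -/
def Config.ReadsSymbol {M : KUM Γ} (C : M.Config) : Prop :=
  (∃ next, M.program C.state = .read next) ∧ C.input ≠ []

/-- `M` accepts the language `L`: it accepts exactly the words of `L`. -/
def AcceptsLanguage (L : Language Γ) : Prop :=
  ∀ w : List Γ, (∃ t, (M.run w t).Accepting) ↔ w ∈ L

/-- `M` works in real time: there is a constant `c` such that, on every input and from
every moment on, the machine needs at most `c` steps until it reads the next symbol of the input or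
has halted.  (The attempt to read at the end of the input does not count as reading a symbol, so `M`
halts at most `c` steps after having read the last symbol.) -/
def RealTime : Prop :=
  ∃ c : ℕ, ∀ (w : List Γ) (t : ℕ), ∃ s ≤ c,
    (M.run w (t + s)).ReadsSymbol ∨ (M.run w (t + s)).Halted

end KUM

/-! ### The language -/

namespace Shvachko

/-- The alphabet: the bits `0` (`false`) and `1` (`true`), the separator `@`, and `#`. -/
inductive Symb where
  | bit (b : Bool)
  | sep
  | hash

/-- The binary strings of length `n` in lexicographic order, from `0ⁿ` to `1ⁿ`. -/
def bitStrings : ℕ → List (List Bool)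
  | 0 => [[]]
  | n + 1 => (bitStrings n).map (false :: ·) ++ (bitStrings n).map (true :: ·)

/-- A binary string as a word over the alphabet. -/
def word (s : List Bool) : List Symb := s.map Symb.bit

/-- The word `b_{0ⁿ}@…@b_{1ⁿ}#x#y#`. -/
def encode (n : ℕ) (b : List Bool → List Bool) (x y : List Bool) : List Symb :=
  [Symb.sep].intercalate ((bitStrings n).map fun i => word (b i)) ++ [Symb.hash] ++
    word x ++ [Symb.hash] ++ word y ++ [Symb.hash]

/-- Shvachko's language. -/
def L : Language Symb :=
  {w | ∃ (n : ℕ) (b : List Bool → List Bool) (x y : List Bool),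
    (∀ i : List Bool, i.length = n → (b i).length = n / 2) ∧
    x.length = n ∧ y.length = n ∧ b x = b y ∧ w = encode n b x y}

end Shvachko

/-!
The machine stores the blocks in trees, where pointers replace addresses.  Let `K` be the length
of the blocks, so that indices have `n = 2K` or `n = 2K + 1` digits; in the first case they are given
a leading `0`.

*Storage.*  While the blocks are read, a binary tree over the indices is built, in two storeys.  The
leaves of a tree of depth `K + 1` are the groups `p`, the first digits of the indices; each of them
carries a tree of depth `K` over the last digits `q`.  A block of length `K` leaves time for one step
of each walk per digit, which suffices: in the course of a block, one walk goes from the root of its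
group to its leaf `q`, and in the course of the first block of a group, another one goes from the root to
the leaf `p`.  The digits of the index need not be known.  When a leaf is finished, the next one in
the lexicographic order is to the right of the last branching to the left; the edge to the right
is created there at once, and the next walk goes to the right where an edge to the right exists, to
the left elsewhere (`Frame.group_true_mem_iff`, `index_true_mem_iff`).  The machine does not know `K`
either: the first block is kept as a measure of the length of the others.  The number of
blocks is right if there is no branching to the left on the way to the last leaf, or only one at the root
(`aboveZero_high_eq_none`, `aboveZero_high_eq_nil`).

*Comparison.*  Each leaf leads to the list of the digits of its block, so that the index `x` leads to
the list of `b_x`.  Besides, each group `p` has a trie whose paths are the sequences of the pairs of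
a digit of `q` and the corresponding digit of the block.  When `y` is read, its first `K + 1`
digits lead to its group; then the pairs formed by the remaining digits of `y` and the digits of `b_x`
are followed in the trie, and the path exists exactly if `b_y = b_x`
(`Table.stored_trie_iff`).

*Machine.*  The algorithm is written for registers that point at nodes of a growing
forest.  A Kolmogorov–Uspensky machine of radius 3 carries out each operation in one step: its active
vertex stays the same and is adjacent to one vertex for each register, which is adjacent to
the node where the register points (`Rep`, `Sim.exec`).  As the programs between two requests
for a symbol are finite trees of operations, and finitely many, real time is automatic
(`Algorithm.realTime`).  Programs are verified by weakest preconditions, in which the nodes have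
names that the machine does not see; `Decides` says which of the remaining inputs are accepted, and
`decides_block`, `decides_left` and `decides_right` establish this by induction on the
remaining input.  For the first block, `decides_block` takes the value of `K` from the part of
the input that has not yet been read.
-/

/-! ### Adding and removing edges, and the evaluation of names -/

namespace KUGraph

variable {Δ : Type}

theorem join_size (G : KUGraph Δ) (u : ℕ) (a : Δ) (v : ℕ) (b : Δ) :
    (G.join u a v b).size = G.size := by
  unfold join
  split_ifs <;> rfl

theorem cut_size (G : KUGraph Δ) (u : ℕ) (a : Δ) : (G.cut u a).size = G.size := by
  unfold cut
  split <;> rfl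

theorem join_nbr {G : KUGraph Δ} {u : ℕ} {a : Δ} {v : ℕ} {b : Δ} (h : G.CanJoin u a v b)
    (x : ℕ) (c : Δ) (y : ℕ) :
    (G.join u a v b).nbr x c = some y ↔
      (x = u ∧ c = a ∧ y = v) ∨ (x = v ∧ c = b ∧ y = u) ∨ G.nbr x c = some y := by
  obtain ⟨-, -, huv, -, hua, hvb⟩ := id h
  unfold join
  rw [dif_pos h]
  dsimp only
  split_ifs with h1 h2
  · obtain ⟨rfl, rfl⟩ := h1
    simp [hua, huv, eq_comm]
  · obtain ⟨rfl, rfl⟩ := h2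
    simp [hvb, huv.symm, eq_comm]
  · constructor
    · exact fun h => Or.inr (Or.inr h)
    · rintro (⟨rfl, rfl, -⟩ | ⟨rfl, rfl, -⟩ | h)
      · exact absurd ⟨rfl, rfl⟩ h1
      · exact absurd ⟨rfl, rfl⟩ h2
      · exact h

theorem cut_nbr {G : KUGraph Δ} {u : ℕ} {a : Δ} {v : ℕ} (h : G.nbr u a = some v)
    (x : ℕ) (c : Δ) (y : ℕ) :
    (G.cut u a).nbr x c = some y ↔
      G.nbr x c = some y ∧ ¬(x = u ∧ y = v) ∧ ¬(x = v ∧ y = u) := by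
  unfold cut
  rw [h]
  unfold remove
  dsimp only
  split_ifs with h1
  · simp only [false_iff]
    rintro ⟨h2, h3, h4⟩
    rw [h2] at h1
    simp only [Option.some.injEq] at h1
    tauto
  · constructor
    · intro h2
      rw [h2] at h1
      simp only [Option.some.injEq] at h1
      tauto
    · exact fun h2 => h2.1

theorem grow_zero (G : KUGraph Δ) : G.grow 0 = G := rfl

end KUGraph

/-! ### Forest programs -/

/-- Names for the nodes of a growing forest.  `child a f` is the name of the node to which an edge
labelled `f` from the node named `a` may lead; so every node but a root has a single possible
parent. -/
structure Naming (V F : Type) where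
  child : V → F → Option V
  inj : ∀ {a f b g w}, child a f = some w → child b g = some w → a = b ∧ f = g
  rank : V → ℕ
  rank_child : ∀ {a f w}, child a f = some w → rank w = rank a + 1

namespace Forest

/-- The memory of a forest program: `N` registers, each of which points at a node, the set `edges`
of the nodes that are linked to their parent, and the set `alive` of the nodes created so far. -/
structure Mem (V : Type) (N : ℕ) where
  reg : Fin N → V
  edges : Set V
  alive : Set V

/-- Programs that run between two requests for an input symbol.  `new r` points `r` at a new root,
`move r s` points `r` where `s` points, `down r f` moves `r` along its edge `f` and creates that
edge and its end if they are missing, `link r f s` makes the root at `s` the child of the node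
at `r`, and `test r f` branches on the existence of the edge `f` at `r`. -/
inductive Prog (N : ℕ) (F S : Type) where
  | acc
  | rej
  | read (s : S)
  | new (r : Fin N) (k : Prog N F S)
  | move (r s : Fin N) (k : Prog N F S)
  | down (r : Fin N) (f : F) (k : Prog N F S)
  | link (r : Fin N) (f : F) (s : Fin N) (k : Prog N F S)
  | test (r : Fin N) (f : F) (yes no : Prog N F S)

/-- The result of a program: a verdict, or a control state in which the next symbol is read. -/
inductive Outcome (V : Type) (N : ℕ) (S : Type) where
  | acc
  | rej
  | read (s : S) (m : Mem V N)

variable {V F S : Type} {N : ℕ}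

/-- The node at `r` has an edge labelled `f`. -/
def Mem.Has (ν : Naming V F) (m : Mem V N) (r : Fin N) (f : F) : Prop :=
  ∃ w, ν.child (m.reg r) f = some w ∧ w ∈ m.edges

/-- Make `r` point at the node named `a`. -/
def Mem.point (m : Mem V N) (r : Fin N) (a : V) : Mem V N :=
  { m with reg := Function.update m.reg r a }

/-- Create a node named `a`. -/
def Mem.create (m : Mem V N) (a : V) : Mem V N := { m with alive := insert a m.alive }

/-- Add the edge to the node named `a`. -/
def Mem.addEdge (m : Mem V N) (a : V) : Mem V N :=
  { m with edges := insert a m.edges }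

/-- The weakest precondition of a program.  The machine does not see the names of the nodes: the
name of a new root is chosen freely among the unused ones. -/
def wp (ν : Naming V F) : Prog N F S → Mem V N → (Outcome V N S → Prop) → Prop
  | .acc, _, post => post .acc
  | .rej, _, post => post .rej
  | .read s, m, post => post (.read s m)
  | .new r k, m, post => ∃ a, a ∉ m.alive ∧ wp ν k ((m.create a).point r a) post
  | .move r s k, m, post => wp ν k (m.point r (m.reg s)) post
  | .down r f k, m, post => ∃ w, ν.child (m.reg r) f = some w ∧ (w ∈ m.alive → w ∈ m.edges) ∧
      wp ν k (((m.create w).addEdge w).point r w) post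
  | .link r f s k, m, post => ν.child (m.reg r) f = some (m.reg s) ∧ m.reg s ∉ m.edges ∧
      wp ν k (m.addEdge (m.reg s)) post
  | .test r f yes no, m, post => (m.Has ν r f → wp ν yes m post) ∧ (¬ m.Has ν r f → wp ν no m post)

/-- The colours of the storage graph: `reg r` joins the active vertex to the vertex of the
register `r`, and is also the colour of the pointer of that register at its target; `ptr` is the
colour of the pointer at its source; `fld f` and `up` are the colours of an edge of the
forest at the parent and at the child. -/
inductive Col (N : ℕ) (F : Type) where
  | reg (r : Fin N)
  | fld (f : F)
  | ptr
  | up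

instance [Finite F] : Finite (Col N F) :=
  Finite.of_surjective
    (fun x : Fin N ⊕ (F ⊕ Bool) => match x with
      | .inl r => Col.reg r
      | .inr (.inl f) => Col.fld f
      | .inr (.inr false) => Col.ptr
      | .inr (.inr true) => Col.up)
    (by
      rintro (r | f | _ | _)
      · exact ⟨.inl r, rfl⟩
      · exact ⟨.inr (.inl f), rfl⟩
      · exact ⟨.inr (.inr false), rfl⟩
      · exact ⟨.inr (.inr true), rfl⟩)

/-! ### Representation of the memory by a storage graph -/

/-- The coloured edges of the graph that represents a memory; the active vertex is `0`, the vertex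
of the register `r` is `ρ r`, and the node named `a` is the vertex `φ a`. -/
inductive Edge (ν : Naming V F) (m : Mem V N) (φ : V → ℕ) (ρ : Fin N → ℕ) :
    ℕ → Col N F → ℕ → Prop where
  | toReg (r) : Edge ν m φ ρ 0 (.reg r) (ρ r)
  | ofReg (r) : Edge ν m φ ρ (ρ r) .up 0
  | toTarget (r) : Edge ν m φ ρ (ρ r) .ptr (φ (m.reg r))
  | ofTarget (r) : Edge ν m φ ρ (φ (m.reg r)) (.reg r) (ρ r)
  | toChild {a f w} (h : ν.child a f = some w) (hw : w ∈ m.edges) :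
      Edge ν m φ ρ (φ a) (.fld f) (φ w)
  | ofChild {a f w} (h : ν.child a f = some w) (hw : w ∈ m.edges) :
      Edge ν m φ ρ (φ w) .up (φ a)

/-- The graph `G` represents the memory `m`. -/
structure Rep (ν : Naming V F) (m : Mem V N) (φ : V → ℕ) (ρ : Fin N → ℕ)
    (G : KUGraph (Col N F)) : Prop where
  pos : 0 < G.size
  ρ_lt : ∀ r, ρ r < G.size
  ρ_ne : ∀ r, ρ r ≠ 0
  ρ_inj : ∀ {r s}, ρ r = ρ s → r = s
  φ_lt : ∀ {a}, a ∈ m.alive → φ a < G.size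
  φ_ne : ∀ {a}, a ∈ m.alive → φ a ≠ 0
  φ_ρ : ∀ {a}, a ∈ m.alive → ∀ r, φ a ≠ ρ r
  φ_inj : ∀ {a b}, a ∈ m.alive → b ∈ m.alive → φ a = φ b → a = b
  reg_alive : ∀ r, m.reg r ∈ m.alive
  edge_alive : ∀ {a}, a ∈ m.edges → a ∈ m.alive
  parent_alive : ∀ {a f w}, ν.child a f = some w → w ∈ m.edges → a ∈ m.alive
  nbr : ∀ u c x, G.nbr u c = some x ↔ Edge ν m φ ρ u c x

namespace Rep

variable {ν : Naming V F} {m : Mem V N} {φ : V → ℕ} {ρ : Fin N → ℕ} {G : KUGraph (Col N F)}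

theorem nbr_reg (h : Rep ν m φ ρ G) (r : Fin N) : G.nbr 0 (.reg r) = some (ρ r) :=
  (h.nbr _ _ _).2 (.toReg r)

theorem nbr_ptr (h : Rep ν m φ ρ G) (r : Fin N) : G.nbr (ρ r) .ptr = some (φ (m.reg r)) :=
  (h.nbr _ _ _).2 (.toTarget r)

/-- A new node is represented by the vertex that a local transformation creates. -/
theorem create [DecidableEq V] (h : Rep ν m φ ρ G) {a : V} (ha : a ∉ m.alive) :
    Rep ν (m.create a) (Function.update φ a G.size) ρ (G.grow 1) := by
  have hφ : ∀ {b}, b ∈ m.alive → Function.update φ a G.size b = φ b := by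
    intro b hb
    rw [Function.update_of_ne]
    rintro rfl
    exact ha hb
  have hE : ∀ u c x, Edge ν (m.create a) (Function.update φ a G.size) ρ u c x ↔
      Edge ν m φ ρ u c x := by
    intro u c x
    constructor
    · rintro (r | r | r | r | ⟨h1, h2⟩ | ⟨h1, h2⟩)
      · exact .toReg r
      · exact .ofReg r
      · rw [show (m.create a).reg r = m.reg r from rfl, hφ (h.reg_alive r)]
        exact .toTarget r
      · rw [show (m.create a).reg r = m.reg r from rfl, hφ (h.reg_alive r)]
        exact .ofTarget r
      · rw [hφ (h.parent_alive h1 h2), hφ (h.edge_alive h2)]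
        exact .toChild h1 h2
      · rw [hφ (h.parent_alive h1 h2), hφ (h.edge_alive h2)]
        exact .ofChild h1 h2
    · rintro (r | r | r | r | ⟨h1, h2⟩ | ⟨h1, h2⟩)
      · exact .toReg r
      · exact .ofReg r
      · rw [← hφ (h.reg_alive r)]
        exact Edge.toTarget (m := m.create a) r
      · rw [← hφ (h.reg_alive r)]
        exact Edge.ofTarget (m := m.create a) r
      · rw [← hφ (h.parent_alive h1 h2), ← hφ (h.edge_alive h2)]
        exact Edge.toChild (m := m.create a) h1 h2
      · rw [← hφ (h.parent_alive h1 h2), ← hφ (h.edge_alive h2)]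
        exact Edge.ofChild (m := m.create a) h1 h2
  exact
    { pos := Nat.lt_add_right 1 h.pos
      ρ_lt := fun r => Nat.lt_add_right 1 (h.ρ_lt r)
      ρ_ne := h.ρ_ne
      ρ_inj := h.ρ_inj
      φ_lt := by
        rintro b (rfl | hb)
        · simp [KUGraph.grow]
        · rw [hφ hb]
          exact Nat.lt_add_right 1 (h.φ_lt hb)
      φ_ne := by
        rintro b (rfl | hb)
        · simpa using h.pos.ne'
        · rw [hφ hb]
          exact h.φ_ne hb
      φ_ρ := by
        rintro b (rfl | hb) r
        · simpa using (h.ρ_lt r).ne'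
        · rw [hφ hb]
          exact h.φ_ρ hb r
      φ_inj := by
        rintro b c (rfl | hb) (rfl | hc) hbc
        · rfl
        · rw [hφ hc, Function.update_self] at hbc
          exact absurd (h.φ_lt hc) (by omega)
        · rw [hφ hb, Function.update_self] at hbc
          exact absurd (h.φ_lt hb) (by omega)
        · rw [hφ hb, hφ hc] at hbc
          exact h.φ_inj hb hc hbc
      reg_alive := fun r => Or.inr (h.reg_alive r)
      edge_alive := fun hb => Or.inr (h.edge_alive hb)
      parent_alive := fun h1 h2 => Or.inr (h.parent_alive h1 h2)
      nbr := fun u c x => (h.nbr u c x).trans (hE u c x).symm }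

/-- An edge can be added to the storage graph because the forest has no cycle and the new child no
other parent. -/
theorem addEdge (h : Rep ν m φ ρ G) {a w : V} {f : F} (hc : ν.child a f = some w)
    (ha : a ∈ m.alive) (hw : w ∈ m.alive) (hn : w ∉ m.edges) :
    Rep ν (m.addEdge w) φ ρ (G.join (φ a) (.fld f) (φ w) .up) := by
  have hne : a ≠ w := by
    rintro rfl
    have := ν.rank_child hc
    omega
  have hcan : G.CanJoin (φ a) (.fld f) (φ w) .up := by
    refine ⟨h.φ_lt ha, h.φ_lt hw, fun e => hne (h.φ_inj ha hw e), ?_, ?_, ?_⟩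
    · intro c hcx
      rw [h.nbr] at hcx
      generalize hu : φ a = u at hcx
      generalize hv : φ w = v at hcx
      rcases hcx with r | r | r | r | ⟨h1, h2⟩ | ⟨h1, h2⟩
      · exact h.φ_ne ha hu
      · exact h.φ_ne hw hv
      · exact h.φ_ρ ha _ hu
      · exact h.φ_ρ hw _ hv
      · obtain rfl := h.φ_inj hw (h.edge_alive h2) hv
        exact hn h2
      · obtain rfl := h.φ_inj ha (h.edge_alive h2) hu
        obtain rfl := h.φ_inj hw (h.parent_alive h1 h2) hv
        have := ν.rank_child h1
        have := ν.rank_child hc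
        omega
    · cases hcx : G.nbr (φ a) (.fld f) with
      | none => rfl
      | some x =>
        rw [h.nbr] at hcx
        generalize hu : φ a = u at hcx
        rcases hcx with r | r | r | r | ⟨h1, h2⟩ | ⟨h1, h2⟩
        obtain rfl := h.φ_inj ha (h.parent_alive h1 h2) hu
        obtain rfl := Option.some.inj (hc.symm.trans h1)
        exact absurd h2 hn
    · cases hcx : G.nbr (φ w) .up with
      | none => rfl
      | some x =>
        rw [h.nbr] at hcx
        generalize hv : φ w = v at hcx
        rcases hcx with r | r | r | r | ⟨h1, h2⟩ | ⟨h1, h2⟩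
        · exact absurd hv (h.φ_ρ hw _)
        · obtain rfl := h.φ_inj hw (h.edge_alive h2) hv
          exact absurd h2 hn
  have hE : ∀ u c x, Edge ν (m.addEdge w) φ ρ u c x ↔
      (u = φ a ∧ c = .fld f ∧ x = φ w) ∨ (u = φ w ∧ c = .up ∧ x = φ a) ∨ Edge ν m φ ρ u c x := by
    intro u c x
    constructor
    · rintro (r | r | r | r | ⟨h1, rfl | h2⟩ | ⟨h1, rfl | h2⟩)
      · exact Or.inr (Or.inr (.toReg r))
      · exact Or.inr (Or.inr (.ofReg r))
      · exact Or.inr (Or.inr (.toTarget r))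
      · exact Or.inr (Or.inr (.ofTarget r))
      · obtain ⟨rfl, rfl⟩ := ν.inj hc h1
        exact Or.inl ⟨rfl, rfl, rfl⟩
      · exact Or.inr (Or.inr (.toChild h1 h2))
      · obtain ⟨rfl, rfl⟩ := ν.inj hc h1
        exact Or.inr (Or.inl ⟨rfl, rfl, rfl⟩)
      · exact Or.inr (Or.inr (.ofChild h1 h2))
    · rintro (⟨rfl, rfl, rfl⟩ | ⟨rfl, rfl, rfl⟩ | (r | r | r | r | ⟨h1, h2⟩ | ⟨h1, h2⟩))
      · exact .toChild hc (Or.inl rfl)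
      · exact .ofChild hc (Or.inl rfl)
      · exact .toReg r
      · exact .ofReg r
      · exact Edge.toTarget (m := m.addEdge w) r
      · exact Edge.ofTarget (m := m.addEdge w) r
      · exact Edge.toChild (m := m.addEdge w) h1 (Or.inr h2)
      · exact Edge.ofChild (m := m.addEdge w) h1 (Or.inr h2)
  exact
    { pos := by rw [KUGraph.join_size]; exact h.pos
      ρ_lt := by rw [KUGraph.join_size]; exact h.ρ_lt
      ρ_ne := h.ρ_ne
      ρ_inj := h.ρ_inj
      φ_lt := by rw [KUGraph.join_size]; exact h.φ_lt
      φ_ne := h.φ_ne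
      φ_ρ := h.φ_ρ
      φ_inj := h.φ_inj
      reg_alive := h.reg_alive
      edge_alive := by
        rintro b (rfl | hb)
        · exact hw
        · exact h.edge_alive hb
      parent_alive := by
        rintro b g x h1 (rfl | h2)
        · obtain ⟨rfl, -⟩ := ν.inj hc h1
          exact ha
        · exact h.parent_alive h1 h2
      nbr := fun u c x => by rw [KUGraph.join_nbr hcan, hE, h.nbr] }

/-- A register is redirected by cutting its pointer and joining it to the new target. -/
theorem point (h : Rep ν m φ ρ G) {a : V} (ha : a ∈ m.alive) (r : Fin N) :
    Rep ν (m.point r a) φ ρ ((G.cut (ρ r) .ptr).join (ρ r) .ptr (φ a) (.reg r)) := by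
  have hcut : ∀ u c x, (G.cut (ρ r) .ptr).nbr u c = some x ↔ Edge ν m φ ρ u c x ∧
      ¬(u = ρ r ∧ x = φ (m.reg r)) ∧ ¬(u = φ (m.reg r) ∧ x = ρ r) := by
    intro u c x
    rw [KUGraph.cut_nbr (h.nbr_ptr r), h.nbr]
  have hcan : (G.cut (ρ r) .ptr).CanJoin (ρ r) .ptr (φ a) (.reg r) := by
    refine ⟨?_, ?_, (h.φ_ρ ha r).symm, ?_, ?_, ?_⟩
    · rw [KUGraph.cut_size]; exact h.ρ_lt r
    · rw [KUGraph.cut_size]; exact h.φ_lt ha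
    · intro c hcx
      rw [hcut] at hcx
      obtain ⟨hcx, hx, -⟩ := hcx
      generalize hu : ρ r = u at hcx
      generalize hv : φ a = v at hcx
      rcases hcx with s | s | s | s | ⟨h1, h2⟩ | ⟨h1, h2⟩
      · exact h.ρ_ne _ hu
      · exact h.φ_ne ha hv
      · obtain rfl := h.ρ_inj hu
        exact hx ⟨rfl, hv⟩
      · exact h.φ_ρ (h.reg_alive s) _ hu.symm
      · exact h.φ_ρ (h.parent_alive h1 h2) _ hu.symm
      · exact h.φ_ρ (h.edge_alive h2) _ hu.symm
    · cases hcx : (G.cut (ρ r) .ptr).nbr (ρ r) .ptr with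
      | none => rfl
      | some x =>
        rw [hcut] at hcx
        obtain ⟨hcx, hx, -⟩ := hcx
        generalize hu : ρ r = u at hcx
        rcases hcx with s | s | s | s | ⟨h1, h2⟩ | ⟨h1, h2⟩
        obtain rfl := h.ρ_inj hu
        exact absurd ⟨rfl, rfl⟩ hx
    · cases hcx : (G.cut (ρ r) .ptr).nbr (φ a) (.reg r) with
      | none => rfl
      | some x =>
        rw [hcut] at hcx
        obtain ⟨hcx, -, hx⟩ := hcx
        generalize hu : φ a = u at hcx
        rcases hcx with s | s | s | s | ⟨h1, h2⟩ | ⟨h1, h2⟩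
        · exact absurd hu (h.φ_ne ha)
        · exact absurd ⟨hu, rfl⟩ hx
  have hreg : (m.point r a).reg r = a := Function.update_self ..
  have hreg' : ∀ {s}, s ≠ r → (m.point r a).reg s = m.reg s := fun hs => Function.update_of_ne hs ..
  have hE : ∀ u c x, Edge ν (m.point r a) φ ρ u c x ↔
      (u = ρ r ∧ c = .ptr ∧ x = φ a) ∨ (u = φ a ∧ c = .reg r ∧ x = ρ r) ∨
        (Edge ν m φ ρ u c x ∧ ¬(u = ρ r ∧ x = φ (m.reg r)) ∧ ¬(u = φ (m.reg r) ∧ x = ρ r)) := by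
    intro u c x
    constructor
    · rintro (s | s | s | s | ⟨h1, h2⟩ | ⟨h1, h2⟩)
      · exact Or.inr (Or.inr ⟨.toReg s, fun e => h.ρ_ne r e.1.symm,
          fun e => h.φ_ne (h.reg_alive r) e.1.symm⟩)
      · exact Or.inr (Or.inr ⟨.ofReg s, fun e => h.φ_ne (h.reg_alive r) e.2.symm,
          fun e => h.ρ_ne r e.2.symm⟩)
      · by_cases hs : s = r
        · subst hs
          rw [hreg]
          exact Or.inl ⟨rfl, rfl, rfl⟩
        · rw [hreg' hs]
          exact Or.inr (Or.inr ⟨.toTarget s, fun e => hs (h.ρ_inj e.1),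
            fun e => h.φ_ρ (h.reg_alive s) _ e.2⟩)
      · by_cases hs : s = r
        · subst hs
          rw [hreg]
          exact Or.inr (Or.inl ⟨rfl, rfl, rfl⟩)
        · rw [hreg' hs]
          exact Or.inr (Or.inr ⟨.ofTarget s, fun e => h.φ_ρ (h.reg_alive s) _ e.1,
            fun e => hs (h.ρ_inj e.2)⟩)
      · exact Or.inr (Or.inr ⟨.toChild h1 h2, fun e => h.φ_ρ (h.parent_alive h1 h2) _ e.1,
          fun e => h.φ_ρ (h.edge_alive h2) _ e.2⟩)
      · exact Or.inr (Or.inr ⟨.ofChild h1 h2, fun e => h.φ_ρ (h.edge_alive h2) _ e.1,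
          fun e => h.φ_ρ (h.parent_alive h1 h2) _ e.2⟩)
    · rintro (⟨rfl, rfl, rfl⟩ | ⟨rfl, rfl, rfl⟩ | ⟨s | s | s | s | ⟨h1, h2⟩ | ⟨h1, h2⟩, hx, hy⟩)
      · have := Edge.toTarget (ν := ν) (m := m.point r a) (φ := φ) (ρ := ρ) r
        rwa [hreg] at this
      · have := Edge.ofTarget (ν := ν) (m := m.point r a) (φ := φ) (ρ := ρ) r
        rwa [hreg] at this
      · exact .toReg s
      · exact .ofReg s
      · have hs : s ≠ r := by
          rintro rfl
          exact hx ⟨rfl, rfl⟩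
        rw [← hreg' hs]
        exact .toTarget s
      · have hs : s ≠ r := by
          rintro rfl
          exact hy ⟨rfl, rfl⟩
        rw [← hreg' hs]
        exact .ofTarget s
      · exact .toChild (m := m.point r a) h1 h2
      · exact .ofChild (m := m.point r a) h1 h2
  exact
    { pos := by rw [KUGraph.join_size, KUGraph.cut_size]; exact h.pos
      ρ_lt := by rw [KUGraph.join_size, KUGraph.cut_size]; exact h.ρ_lt
      ρ_ne := h.ρ_ne
      ρ_inj := h.ρ_inj
      φ_lt := by rw [KUGraph.join_size, KUGraph.cut_size]; exact h.φ_lt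
      φ_ne := h.φ_ne
      φ_ρ := h.φ_ρ
      φ_inj := h.φ_inj
      reg_alive := by
        intro s
        by_cases hs : s = r
        · subst hs
          rw [hreg]
          exact ha
        · rw [hreg' hs]
          exact h.reg_alive s
      edge_alive := h.edge_alive
      parent_alive := h.parent_alive
      nbr := fun u c x => by rw [KUGraph.join_nbr hcan, hE, hcut] }

end Rep

end Forest

/-! ### Compilation of forest programs to Kolmogorov–Uspensky machines -/

namespace Forest

open KUM

variable {Γ V F S : Type} {N : ℕ}

/-- The programs that may remain to be executed in the course of a program. -/
def Prog.subs : Prog N F S → Set (Prog N F S)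
  | .acc => {.acc}
  | .rej => {.rej}
  | .read s => {.read s}
  | .new r k => insert (.new r k) k.subs
  | .move r s k => insert (.move r s k) k.subs
  | .down r f k => insert (.down r f k) k.subs
  | .link r f s k => insert (.link r f s k) k.subs
  | .test r f yes no => insert (.test r f yes no) (yes.subs ∪ no.subs)

theorem Prog.self_mem_subs (p : Prog N F S) : p ∈ p.subs := by
  cases p <;> simp [Prog.subs]

theorem Prog.subs_finite (p : Prog N F S) : p.subs.Finite := by
  induction p with
  | acc | rej | read => exact Set.finite_singleton _
  | new _ _ ih | move _ _ _ ih | down _ _ _ ih | link _ _ _ _ ih => exact ih.insert _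
  | test _ _ _ _ ih₁ ih₂ => exact (ih₁.union ih₂).insert _

theorem Prog.subs_subset {p q : Prog N F S} (h : p ∈ q.subs) : p.subs ⊆ q.subs := by
  induction q with
  | acc | rej | read =>
    obtain rfl := h
    exact subset_rfl
  | new _ _ ih | move _ _ _ ih | down _ _ _ ih | link _ _ _ _ ih =>
    rcases h with rfl | h
    · exact subset_rfl
    · exact (ih h).trans (Set.subset_insert _ _)
  | test _ _ _ _ ih₁ ih₂ =>
    rcases h with rfl | h | h
    · exact subset_rfl
    · exact ((ih₁ h).trans Set.subset_union_left).trans (Set.subset_insert _ _)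
    · exact ((ih₂ h).trans Set.subset_union_right).trans (Set.subset_insert _ _)

/-- The number of steps before a program stops or reads. -/
def Prog.depth : Prog N F S → ℕ
  | .acc | .rej | .read _ => 0
  | .new _ k | .move _ _ k | .down _ _ k | .link _ _ _ k => k.depth + 1
  | .test _ _ yes no => max yes.depth no.depth + 1

/-- A real-time algorithm on a forest: the program run at the start, and the programs run when, in
a given control state, a given symbol, or the end of the input, has been read. -/
structure Algorithm (Γ F S : Type) (N : ℕ) where
  start : Prog N F S
  next : S → Option Γ → Prog N F S

/-- The address of the vertex of a register. -/
def regWord (r : Fin N) : Word (Col N F) 3 := ⟨[.reg r], by simp⟩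

/-- The address of the node at which a register points. -/
def targetWord (r : Fin N) : Word (Col N F) 3 := ⟨[.reg r, .ptr], by simp⟩

/-- The address of a child of the node at which a register points. -/
def childWord (r : Fin N) (f : F) : Word (Col N F) 3 := ⟨[.reg r, .ptr, .fld f], by simp⟩

/-- The address of the active vertex. -/
def hubWord : Word (Col N F) 3 := ⟨[], by simp⟩

/-- The edits that make a register point at a given node. -/
def pointEdits {k : ℕ} (r : Fin N) (x : Ref (Col N F) 3 k) : List (Edit (Col N F) 3 k) :=
  [.cut (.old (regWord r)) .ptr, .join (.old (regWord r)) .ptr x (.reg r)]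

/-- The edits that make all registers point at one new node. -/
def initEdits (N : ℕ) (F : Type) (l : List (Fin N)) : List (Edit (Col N F) 3 (N + 1)) :=
  l.flatMap fun r =>
    [.join (.old hubWord) (.reg r) (.fresh r.castSucc) .up,
      .join (.fresh r.castSucc) .ptr (.fresh (Fin.last N)) (.reg r)]

namespace Algorithm

variable (A : Algorithm Γ F S N)

/-- All programs that may remain to be executed in the course of an algorithm. -/
def progs : Set (Prog N F S) := A.start.subs ∪ ⋃ x : S × Option Γ, (A.next x.1 x.2).subs

theorem progs_finite [Finite S] [Finite Γ] : A.progs.Finite :=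
  A.start.subs_finite.union (Set.finite_iUnion fun _ => Prog.subs_finite _)

theorem start_mem : A.start ∈ A.progs := Or.inl A.start.self_mem_subs

theorem next_mem (s : S) (x : Option Γ) : A.next s x ∈ A.progs :=
  Or.inr (Set.mem_iUnion.2 ⟨(s, x), Prog.self_mem_subs _⟩)

variable {A} in
theorem subs_subset {p : Prog N F S} (h : p ∈ A.progs) : p.subs ⊆ A.progs := by
  rcases h with h | h
  · exact (Prog.subs_subset h).trans Set.subset_union_left
  · obtain ⟨x, hx⟩ := Set.mem_iUnion.1 h
    exact fun q hq => Or.inr (Set.mem_iUnion.2 ⟨x, Prog.subs_subset hx hq⟩)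

/-- The control states of the compiled machine: the program that remains to be executed, or `none`
before the very first step. -/
abbrev State : Type := Option A.progs

open Classical in
/-- The control state in which a program remains to be executed. -/
noncomputable def state (p : Prog N F S) : A.State := if h : p ∈ A.progs then some ⟨p, h⟩ else none

variable {A} in
theorem state_eq {p : Prog N F S} (h : p ∈ A.progs) : A.state p = some ⟨p, h⟩ := dif_pos h

open Classical in
/-- The instruction that carries out the beginning of a program. -/
noncomputable def instr : Prog N F S → Instr Γ A.State (Col N F) 3
  | .acc => .accept
  | .rej => .reject
  | .read s => .read fun x => A.state (A.next s x)
  | .new r k => .transform fun _ => ⟨A.state k, 1, pointEdits r (.fresh 0), .old hubWord⟩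
  | .move r s k => .transform fun _ =>
      ⟨A.state k, 0, pointEdits r (.old (targetWord s)), .old hubWord⟩
  | .down r f k => .transform fun v =>
      if (childWord r f, childWord r f) ∈ v then
        ⟨A.state k, 0, pointEdits r (.old (childWord r f)), .old hubWord⟩
      else
        ⟨A.state k, 1, .join (.old (targetWord r)) (.fld f) (.fresh 0) .up ::
          pointEdits r (.fresh 0), .old hubWord⟩
  | .link r f s k => .transform fun _ =>
      ⟨A.state k, 0, [.join (.old (targetWord r)) (.fld f) (.old (targetWord s)) .up],
        .old hubWord⟩
  | .test r f yes no => .transform fun v =>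
      ⟨A.state (if (childWord r f, childWord r f) ∈ v then yes else no), 0, [], .old hubWord⟩

/-- The Kolmogorov–Uspensky machine that executes an algorithm on a forest, one operation in each
step; its first step creates the registers. -/
noncomputable def machine [Finite F] [Finite S] [Finite Γ] : KUM Γ where
  Q := A.State
  Δ := Col N F
  finiteQ := by
    have := A.progs_finite.to_subtype
    infer_instance
  finiteΔ := inferInstance
  radius := 3
  start := none
  program
    | none => .transform fun _ =>
        ⟨A.state A.start, N + 1, initEdits N F (List.finRange N), .old hubWord⟩
    | some p => A.instr p.1

variable [Finite F] [Finite S] [Finite Γ]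

theorem machine_program {p : Prog N F S} (h : p ∈ A.progs) :
    A.machine.program (A.state p) = A.instr p := by
  rw [state_eq h]
  rfl

/-! ### Real time -/

/-- A step of the machine that neither reads nor halts shortens the program that remains. -/
theorem state_step_of_depth {p : Prog N F S} (h : p ∈ A.progs) {d : ℕ} (hd : p.depth = d + 1)
    (C : A.machine.Config) (hC : C.state = A.state p) :
    ∃ q ∈ A.progs, q.depth ≤ d ∧ (A.machine.step C).state = A.state q ∧
      (A.machine.step C).input = C.input := by
  have hp : A.machine.program C.state = A.instr p := by rw [hC, A.machine_program h]
  have hsub := subs_subset h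
  cases p with
  | acc | rej | read => simp [Prog.depth] at hd
  | new _ k | move _ _ k | link _ _ _ k =>
    refine ⟨k, hsub (Or.inr k.self_mem_subs), ?_, ?_, ?_⟩
    · simp only [Prog.depth] at hd
      omega
    · unfold KUM.step
      rw [hp]
      rfl
    · unfold KUM.step
      rw [hp]
      rfl
  | down _ _ k =>
    refine ⟨k, hsub (Or.inr k.self_mem_subs), ?_, ?_, ?_⟩
    · simp only [Prog.depth] at hd
      omega
    · unfold KUM.step
      rw [hp]
      dsimp only [instr]
      split_ifs <;> rfl
    · unfold KUM.step
      rw [hp]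
      rfl
  | test r f yes no =>
    simp only [Prog.depth] at hd
    by_cases hv : (childWord r f, childWord r f) ∈ view 3 C.graph C.active
    · refine ⟨yes, hsub (Or.inr (Or.inl yes.self_mem_subs)), by omega, ?_, ?_⟩
      · unfold KUM.step
        rw [hp]
        exact congrArg A.state (if_pos hv)
      · unfold KUM.step
        rw [hp]
        rfl
    · refine ⟨no, hsub (Or.inr (Or.inr no.self_mem_subs)), by omega, ?_, ?_⟩
      · unfold KUM.step
        rw [hp]
        exact congrArg A.state (if_neg hv)
      · unfold KUM.step
        rw [hp]
        rfl

/-- A program of depth `d` leads to a reading of a symbol or to a halt within `d + 1` steps; the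
additional step is the reading of the end of the input. -/
theorem reads_or_halts_of_depth (hend : ∀ s, A.next s none = .acc ∨ A.next s none = .rej)
    (d : ℕ) (p : Prog N F S) (h : p ∈ A.progs) (hd : p.depth ≤ d) (C : A.machine.Config)
    (hC : C.state = A.state p) :
    ∃ s ≤ d + 1, (A.machine.step^[s] C).ReadsSymbol ∨ (A.machine.step^[s] C).Halted := by
  induction d generalizing p C with
  | zero =>
    have hp : A.machine.program C.state = A.instr p := by rw [hC, A.machine_program h]
    cases p with
    | new | move | down | link | test => simp [Prog.depth] at hd
    | acc => exact ⟨0, by omega, Or.inr (Or.inl hp)⟩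
    | rej => exact ⟨0, by omega, Or.inr (Or.inr hp)⟩
    | read s =>
      by_cases hi : C.input = []
      · refine ⟨1, by omega, Or.inr ?_⟩
        have h1 : (A.machine.step C).state = A.state (A.next s none) := by
          unfold KUM.step
          rw [hp]
          simp only [instr, hi, List.head?_nil]
          rfl
        have h2 : A.machine.program (A.machine.step^[1] C).state = A.instr (A.next s none) := by
          rw [Function.iterate_one, h1, A.machine_program (A.next_mem s none)]
        rcases hend s with h3 | h3
        · exact Or.inl (h2.trans (by rw [h3]; rfl))
        · exact Or.inr (h2.trans (by rw [h3]; rfl))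
      · exact ⟨0, by omega, Or.inl ⟨⟨_, hp⟩, hi⟩⟩
  | succ d ih =>
    rcases Nat.lt_or_ge d p.depth with hlt | hle
    · obtain ⟨q, hq, hqd, hs, -⟩ := A.state_step_of_depth h (d := d) (by omega) C hC
      obtain ⟨s, hs', hr⟩ := ih q hq hqd _ hs
      exact ⟨s + 1, by omega, by rwa [Function.iterate_succ_apply]⟩
    · obtain ⟨s, hs, hr⟩ := ih p h hle C hC
      exact ⟨s, by omega, hr⟩

/-- The compiled machine works in real time, since every program of the algorithm is finite and
there are finitely many of them. -/
theorem realTime (hend : ∀ s, A.next s none = .acc ∨ A.next s none = .rej) :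
    A.machine.RealTime := by
  obtain ⟨D, hD⟩ := (A.progs_finite.image Prog.depth).bddAbove
  have hD' : ∀ p ∈ A.progs, p.depth ≤ D := fun p hp => hD (Set.mem_image_of_mem _ hp)
  have key : ∀ C : A.machine.Config, ∃ s ≤ D + 2,
      (A.machine.step^[s] C).ReadsSymbol ∨ (A.machine.step^[s] C).Halted := by
    intro C
    rcases hC : C.state with _ | ⟨p, hp⟩
    · have h1 : (A.machine.step C).state = A.state A.start := by
        unfold KUM.step
        rw [hC]
        rfl
      obtain ⟨s, hs, hr⟩ :=
        A.reads_or_halts_of_depth hend D _ A.start_mem (hD' _ A.start_mem) _ h1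
      exact ⟨s + 1, by omega, by rwa [Function.iterate_succ_apply]⟩
    · obtain ⟨s, hs, hr⟩ := A.reads_or_halts_of_depth hend D p hp (hD' p hp) C
        (by rw [hC, state_eq hp])
      exact ⟨s, by omega, hr⟩
  refine ⟨D + 2, fun w t => ?_⟩
  obtain ⟨s, hs, hr⟩ := key (A.machine.run w t)
  refine ⟨s, hs, ?_⟩
  rwa [KUM.run, Nat.add_comm t s, Function.iterate_add_apply]

end Algorithm

/-! ### Simulation -/

section walk

variable {ν : Naming V F} {m : Mem V N} {φ : V → ℕ} {ρ : Fin N → ℕ} {G : KUGraph (Col N F)}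

theorem Rep.walk_reg (h : Rep ν m φ ρ G) (r : Fin N) :
    G.walk 0 (regWord r : Word (Col N F) 3).1 = some (ρ r) := by
  simp [regWord, KUGraph.walk, h.nbr_reg]

theorem Rep.walk_target (h : Rep ν m φ ρ G) (r : Fin N) :
    G.walk 0 (targetWord r : Word (Col N F) 3).1 = some (φ (m.reg r)) := by
  simp [targetWord, KUGraph.walk, h.nbr_reg, h.nbr_ptr]

theorem Rep.walk_child_iff (h : Rep ν m φ ρ G) (r : Fin N) (f : F) (x : ℕ) :
    G.walk 0 (childWord r f : Word (Col N F) 3).1 = some x ↔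
      ∃ w, ν.child (m.reg r) f = some w ∧ w ∈ m.edges ∧ x = φ w := by
  have h1 : G.walk 0 (childWord r f : Word (Col N F) 3).1 = G.nbr (φ (m.reg r)) (.fld f) := by
    simp [childWord, KUGraph.walk, h.nbr_reg, h.nbr_ptr]
  rw [h1, h.nbr]
  constructor
  · intro hx
    generalize hu : φ (m.reg r) = u at hx
    rcases hx with s | s | s | s | ⟨h2, h3⟩ | ⟨h2, h3⟩
    obtain rfl := h.φ_inj (h.reg_alive r) (h.parent_alive h2 h3) hu
    exact ⟨_, h2, h3, rfl⟩
  · rintro ⟨w, h2, h3, rfl⟩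
    exact .toChild h2 h3

theorem Rep.mem_view_iff (h : Rep ν m φ ρ G) (r : Fin N) (f : F) :
    (childWord r f, childWord r f) ∈ view 3 G 0 ↔ m.Has ν r f := by
  constructor
  · rintro ⟨x, hx, -⟩
    obtain ⟨w, h1, h2, -⟩ := (h.walk_child_iff r f x).1 hx
    exact ⟨w, h1, h2⟩
  · rintro ⟨w, h1, h2⟩
    have := (h.walk_child_iff r f (φ w)).2 ⟨w, h1, h2, rfl⟩
    exact ⟨_, this, this⟩

/-- The edits of `pointEdits`, after other edits `l` that do not affect the registers. -/
theorem Rep.graph_pointEdits {k : ℕ} {Q : Type} {q : Q} {r : Fin N} {x : Ref (Col N F) 3 k}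
    {m' : Mem V N} {φ' : V → ℕ}
    (h : Rep ν m φ ρ G) {l : List (Edit (Col N F) 3 k)} {a : V}
    (hl : Rep ν m' φ' ρ (l.foldl (fun H e => e.apply G 0 H) (G.grow k)))
    (hx : x.resolve G 0 = some (φ' a)) (ha : a ∈ m'.alive) :
    Rep ν (m'.point r a) φ' ρ
      ((⟨q, k, l ++ pointEdits r x, .old hubWord⟩ : Action Q (Col N F) 3).graph G 0) := by
  have hr : (Ref.old (regWord r) : Ref (Col N F) 3 k).resolve G 0 = some (ρ r) := h.walk_reg r
  simpa only [Action.graph, List.foldl_append, pointEdits, List.foldl_cons, List.foldl_nil,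
    Edit.apply, hr, hx] using hl.point ha r

theorem Rep.graph_link {Q : Type} {q : Q} {r s : Fin N} {f : F} (h : Rep ν m φ ρ G)
    (hc : ν.child (m.reg r) f = some (m.reg s)) (hn : m.reg s ∉ m.edges) :
    Rep ν (m.addEdge (m.reg s)) φ ρ
      ((⟨q, 0, [.join (.old (targetWord r)) (.fld f) (.old (targetWord s)) .up], .old hubWord⟩ :
        Action Q (Col N F) 3).graph G 0) := by
  simpa [Action.graph, Edit.apply, Ref.resolve, h.walk_target, KUGraph.grow_zero] using
    h.addEdge hc (h.reg_alive r) (h.reg_alive s) hn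

end walk

/-- The first step makes the vertices `1, …, N` the registers, all of which point at the vertex
`N + 1`.  The statement is about a list of registers for the sake of induction. -/
theorem nbr_initEdits {l : List (Fin N)} (hl : l.Nodup) :
    let H := (initEdits N F l).foldl (fun H e => e.apply (KUGraph.single _) 0 H)
      ((KUGraph.single (Col N F)).grow (N + 1))
    H.size = N + 2 ∧ ∀ x c y, H.nbr x c = some y ↔ ∃ r ∈ l,
      (x = 0 ∧ c = .reg r ∧ y = 1 + r.1) ∨ (x = 1 + r.1 ∧ c = .up ∧ y = 0) ∨
        (x = 1 + r.1 ∧ c = .ptr ∧ y = 1 + N) ∨ (x = 1 + N ∧ c = .reg r ∧ y = 1 + r.1) := by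
  induction l using List.reverseRecOn with
  | nil =>
    refine ⟨?_, by simp [initEdits, KUGraph.grow, KUGraph.single]⟩
    simp only [initEdits, KUGraph.grow, KUGraph.single, List.flatMap_nil, List.foldl_nil]
    omega
  | append_singleton l r ih =>
    have hl' := List.nodup_append.1 hl
    have hr : ∀ s ∈ l, s.1 ≠ r.1 := fun s hs e => hl'.2.2 s hs r (by simp) (Fin.ext e)
    obtain ⟨hsize, hnbr⟩ := ih hl'.1
    have happ : initEdits N F (l ++ [r]) = initEdits N F l ++
        [.join (.old hubWord) (.reg r) (.fresh r.castSucc) .up,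
          .join (.fresh r.castSucc) .ptr (.fresh (Fin.last N)) (.reg r)] := by
      simp [initEdits]
    intro H
    have hH : H = (((initEdits N F l).foldl (fun H e => e.apply (KUGraph.single _) 0 H)
        ((KUGraph.single (Col N F)).grow (N + 1))).join 0 (.reg r) (1 + r.1) .up).join
          (1 + r.1) .ptr (1 + N) (.reg r) := by
      simp only [H, happ, List.foldl_append]
      rfl
    clear_value H
    subst hH
    generalize (initEdits N F l).foldl (fun H e => e.apply (KUGraph.single _) 0 H)
        ((KUGraph.single (Col N F)).grow (N + 1)) = H at hsize hnbr
    have hlt := r.2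
    have c1 : H.CanJoin 0 (.reg r) (1 + r.1) .up := by
      refine ⟨by omega, by omega, by omega, ?_, ?_, ?_⟩
      · intro c hc
        obtain ⟨s, hs, h⟩ := (hnbr _ _ _).1 hc
        have := hr s hs
        omega
      · refine Option.eq_none_iff_forall_ne_some.2 fun y hy => ?_
        obtain ⟨s, hs, h⟩ := (hnbr _ _ _).1 hy
        have := hr s hs
        simp only [Col.reg.injEq, Fin.ext_iff] at h
        omega
      · refine Option.eq_none_iff_forall_ne_some.2 fun y hy => ?_
        obtain ⟨s, hs, h⟩ := (hnbr _ _ _).1 hy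
        have := hr s hs
        simp only [reduceCtorEq] at h
        omega
    have n1 := KUGraph.join_nbr c1
    have c2 : (H.join 0 (.reg r) (1 + r.1) .up).CanJoin (1 + r.1) .ptr (1 + N) (.reg r) := by
      refine ⟨by rw [KUGraph.join_size]; omega, by rw [KUGraph.join_size]; omega, by omega,
        ?_, ?_, ?_⟩
      · intro c hc
        rw [n1, hnbr] at hc
        rcases hc with h | h | ⟨s, hs, h⟩
        · omega
        · omega
        · have := hr s hs
          omega
      · refine Option.eq_none_iff_forall_ne_some.2 fun y hy => ?_
        rw [n1, hnbr] at hy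
        simp only [reduceCtorEq, true_and, false_and, and_false, false_or, or_false] at hy
        obtain ⟨s, hs, h⟩ := hy
        have := hr s hs
        omega
      · refine Option.eq_none_iff_forall_ne_some.2 fun y hy => ?_
        rw [n1, hnbr] at hy
        simp only [reduceCtorEq, Col.reg.injEq, Fin.ext_iff] at hy
        rcases hy with h | h | ⟨s, hs, h⟩
        · omega
        · omega
        · have := hr s hs
          omega
    refine ⟨by rw [KUGraph.join_size, KUGraph.join_size, hsize], fun x c y => ?_⟩
    rw [KUGraph.join_nbr c2, n1, hnbr]
    constructor
    · rintro (h | h | h | h | ⟨s, hs, h⟩)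
      · exact ⟨r, by simp, Or.inr (Or.inr (Or.inl h))⟩
      · exact ⟨r, by simp, Or.inr (Or.inr (Or.inr h))⟩
      · exact ⟨r, by simp, Or.inl h⟩
      · exact ⟨r, by simp, Or.inr (Or.inl h)⟩
      · exact ⟨s, List.mem_append_left _ hs, h⟩
    · rintro ⟨s, hs, h⟩
      rcases List.mem_append.1 hs with hs | hs
      · exact Or.inr (Or.inr (Or.inr (Or.inr ⟨s, hs, h⟩)))
      · obtain rfl := List.mem_singleton.1 hs
        rcases h with h | h | h | h
        · exact Or.inr (Or.inr (Or.inl h))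
        · exact Or.inr (Or.inr (Or.inr (Or.inl h)))
        · exact Or.inl h
        · exact Or.inr (Or.inl h)

theorem rep_init (ν : Naming V F) (o : V) {Q : Type} (q : Q) :
    ∃ φ ρ, Rep ν (⟨fun _ => o, ∅, {o}⟩ : Mem V N) φ ρ
      ((⟨q, N + 1, initEdits N F (List.finRange N), .old hubWord⟩ :
        Action Q (Col N F) 3).graph (KUGraph.single _) 0) := by
  obtain ⟨hsize, hnbr⟩ := nbr_initEdits (F := F) (List.nodup_finRange N)
  refine ⟨fun _ => 1 + N, fun r => 1 + r.1, ?_⟩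
  exact
    { pos := by
        simp only [Action.graph, hsize]
        omega
      ρ_lt := fun r => by
        simp only [Action.graph, hsize]
        omega
      ρ_ne := fun r => by omega
      ρ_inj := fun h => Fin.ext (by omega)
      φ_lt := fun _ => by
        simp only [Action.graph, hsize]
        omega
      φ_ne := fun _ => by omega
      φ_ρ := fun _ r => by omega
      φ_inj := fun ha hb _ => ha.trans hb.symm
      reg_alive := fun _ => rfl
      edge_alive := fun h => h.elim
      parent_alive := fun _ h => h.elim
      nbr := fun u c x => by
        simp only [Action.graph]
        rw [hnbr]
        constructor
        · rintro ⟨r, -, ⟨rfl, rfl, rfl⟩ | ⟨rfl, rfl, rfl⟩ | ⟨rfl, rfl, rfl⟩ | ⟨rfl, rfl, rfl⟩⟩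
          · exact .toReg r
          · exact .ofReg r
          · exact .toTarget r
          · exact .ofTarget r
        · rintro (r | r | r | r | ⟨-, h⟩ | ⟨-, h⟩)
          · exact ⟨r, List.mem_finRange r, by simp⟩
          · exact ⟨r, List.mem_finRange r, by simp⟩
          · exact ⟨r, List.mem_finRange r, by simp⟩
          · exact ⟨r, List.mem_finRange r, by simp⟩
          · exact h.elim
          · exact h.elim }

namespace Algorithm

variable (A : Algorithm Γ F S N) [Finite F] [Finite S] [Finite Γ] (ν : Naming V F)

/-- In the configuration `C` the program `p` remains to be executed with the memory `m`. -/
structure Sim (p : Prog N F S) (m : Mem V N) (C : A.machine.Config) : Prop where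
  mem : p ∈ A.progs
  state : C.state = A.state p
  active : C.active = 0
  rep : ∃ φ ρ, Rep ν m φ ρ C.graph

/-- The machine will accept. -/
def EventuallyAccepts (C : A.machine.Config) : Prop := ∃ t, (A.machine.step^[t] C).Accepting

variable {A} in
theorem step_of_accepting {C : A.machine.Config} (h : C.Accepting) : A.machine.step C = C := by
  unfold KUM.step
  rw [show A.machine.program C.state = .accept from h]

theorem eventuallyAccepts_step (C : A.machine.Config) :
    A.EventuallyAccepts (A.machine.step C) ↔ A.EventuallyAccepts C := by
  constructor
  · rintro ⟨t, ht⟩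
    exact ⟨t + 1, by rwa [Function.iterate_succ_apply]⟩
  · rintro ⟨t, ht⟩
    cases t with
    | zero =>
      rw [Function.iterate_zero, id] at ht
      exact ⟨0, by rwa [step_of_accepting ht]⟩
    | succ t => exact ⟨t, by rwa [Function.iterate_succ_apply] at ht⟩

variable {A ν}

theorem Sim.program {p : Prog N F S} {m : Mem V N} {C : A.machine.Config} (h : A.Sim ν p m C) :
    A.machine.program C.state = A.instr p := by
  rw [h.state, A.machine_program h.mem]

theorem Sim.eventuallyAccepts_acc {m : Mem V N} {C : A.machine.Config}
    (h : A.Sim ν .acc m C) : A.EventuallyAccepts C :=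
  ⟨0, h.program⟩

theorem Sim.not_eventuallyAccepts_rej {m : Mem V N} {C : A.machine.Config}
    (h : A.Sim ν .rej m C) : ¬ A.EventuallyAccepts C := by
  have h1 : A.machine.step C = C := by
    unfold KUM.step
    rw [h.program]
    rfl
  rintro ⟨t, ht⟩
  rw [Function.iterate_fixed h1] at ht
  have := h.program.symm.trans ht
  cases this

/-- One operation of a program is carried out by one step of the machine. -/
theorem Sim.step_of_transform {p k : Prog N F S} {m m' : Mem V N} {C : A.machine.Config}
    (h : A.Sim ν p m C) {act : View (Col N F) 3 → Action A.State (Col N F) 3}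
    (hp : A.instr p = .transform act) (hk : k ∈ A.progs) {a : Action A.State (Col N F) 3}
    (ha : act (view 3 C.graph 0) = a) (hnext : a.next = A.state k)
    (hact : a.active = .old hubWord) (hrep : ∃ φ ρ, Rep ν m' φ ρ (a.graph C.graph 0)) :
    A.Sim ν k m' (A.machine.step C) ∧ (A.machine.step C).input = C.input := by
  have hs : A.machine.step C =
      { state := (act (view 3 C.graph C.active)).next
        graph := (act (view 3 C.graph C.active)).graph C.graph C.active
        active := ((act (view 3 C.graph C.active)).active.resolve C.graph C.active).getD C.active
        input := C.input } := by
    unfold KUM.step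
    rw [h.program, hp]
    rfl
  rw [h.active] at hs
  subst ha
  rw [hs]
  refine ⟨⟨hk, hnext, ?_, hrep⟩, rfl⟩
  dsimp only
  rw [hact]
  rfl

/-- Every program of the algorithm is simulated by the compiled machine. -/
theorem Sim.exec {p : Prog N F S} {m : Mem V N} {C : A.machine.Config} (h : A.Sim ν p m C)
    {post : Outcome V N S → Prop} (hwp : wp ν p m post) :
    (post .acc ∧ A.EventuallyAccepts C) ∨ (post .rej ∧ ¬ A.EventuallyAccepts C) ∨
      ∃ s m' C', post (.read s m') ∧ A.Sim ν (.read s) m' C' ∧ C'.input = C.input ∧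
        (A.EventuallyAccepts C' ↔ A.EventuallyAccepts C) := by
  classical
  induction p generalizing m C with
  | acc => exact Or.inl ⟨hwp, h.eventuallyAccepts_acc⟩
  | rej => exact Or.inr (Or.inl ⟨hwp, h.not_eventuallyAccepts_rej⟩)
  | read s => exact Or.inr (Or.inr ⟨s, m, C, hwp, h, rfl, Iff.rfl⟩)
  | new r k ih =>
    obtain ⟨a, ha, hwp⟩ := hwp
    obtain ⟨φ, ρ, hrep⟩ := h.rep
    obtain ⟨h1, h2⟩ := h.step_of_transform (m' := (m.create a).point r a) rfl
      (subs_subset h.mem (Or.inr k.self_mem_subs)) rfl rfl rfl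
      ⟨_, ρ, hrep.graph_pointEdits (l := []) (hrep.create ha) (by simp [Ref.resolve])
        (Or.inl rfl)⟩
    simpa only [h2, eventuallyAccepts_step] using ih h1 hwp
  | move r s k ih =>
    obtain ⟨φ, ρ, hrep⟩ := h.rep
    obtain ⟨h1, h2⟩ := h.step_of_transform (m' := m.point r (m.reg s)) rfl
      (subs_subset h.mem (Or.inr k.self_mem_subs)) rfl rfl rfl
      ⟨φ, ρ, hrep.graph_pointEdits (l := []) hrep (hrep.walk_target s) (hrep.reg_alive s)⟩
    simpa only [h2, eventuallyAccepts_step] using ih h1 hwp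
  | down r f k ih =>
    obtain ⟨w, hw, ha, hwp⟩ := hwp
    obtain ⟨φ, ρ, hrep⟩ := h.rep
    have hk := subs_subset h.mem (Or.inr k.self_mem_subs)
    obtain ⟨h1, h2⟩ : A.Sim ν k (((m.create w).addEdge w).point r w) (A.machine.step C) ∧
        (A.machine.step C).input = C.input := by
      by_cases hwe : w ∈ m.edges
      · have hv : (childWord r f, childWord r f) ∈ view 3 C.graph 0 :=
          (hrep.mem_view_iff r f).2 ⟨w, hw, hwe⟩
        refine h.step_of_transform rfl hk (if_pos hv) rfl rfl ⟨φ, ρ, ?_⟩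
        · have hm : (m.create w).addEdge w = m := by
            simp [Mem.create, Mem.addEdge, hwe, hrep.edge_alive hwe]
          rw [hm]
          exact hrep.graph_pointEdits (l := []) hrep
            ((hrep.walk_child_iff r f _).2 ⟨w, hw, hwe, rfl⟩) (hrep.edge_alive hwe)
      · have hv : (childWord r f, childWord r f) ∉ view 3 C.graph 0 := by
          intro hv
          obtain ⟨w', h1, h2⟩ := (hrep.mem_view_iff r f).1 hv
          rw [hw] at h1
          cases h1
          exact hwe h2
        have hwa : w ∉ m.alive := fun h => hwe (ha h)
        have hne : m.reg r ≠ w := by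
          rintro e
          exact hwa (e ▸ hrep.reg_alive r)
        refine h.step_of_transform rfl hk (if_neg hv) rfl rfl
          ⟨Function.update φ w C.graph.size, ρ, ?_⟩
        · have hg := (hrep.create hwa).addEdge hw (Or.inr (hrep.reg_alive r)) (Or.inl rfl) hwe
          rw [Function.update_of_ne hne, Function.update_self] at hg
          refine hrep.graph_pointEdits (l := [_]) (m' := (m.create w).addEdge w) ?_
            (by simp [Ref.resolve]) (Or.inl rfl)
          simpa [Edit.apply, Ref.resolve, hrep.walk_target] using hg
    simpa only [h2, eventuallyAccepts_step] using ih h1 hwp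
  | link r f s k ih =>
    obtain ⟨hc, hn, hwp⟩ := hwp
    obtain ⟨φ, ρ, hrep⟩ := h.rep
    obtain ⟨h1, h2⟩ := h.step_of_transform (m' := m.addEdge (m.reg s)) rfl
      (subs_subset h.mem (Or.inr k.self_mem_subs)) rfl rfl rfl ⟨φ, ρ, hrep.graph_link hc hn⟩
    simpa only [h2, eventuallyAccepts_step] using ih h1 hwp
  | test r f yes no ih₁ ih₂ =>
    obtain ⟨φ, ρ, hrep⟩ := h.rep
    have hview := hrep.mem_view_iff r f
    by_cases hh : m.Has ν r f
    · obtain ⟨h1, h2⟩ := h.step_of_transform (m' := m) rfl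
        (subs_subset h.mem (Or.inr (Or.inl yes.self_mem_subs)))
        rfl (congrArg A.state (if_pos (hview.2 hh))) rfl ⟨φ, ρ, hrep⟩
      simpa only [h2, eventuallyAccepts_step] using ih₁ h1 (hwp.1 hh)
    · obtain ⟨h1, h2⟩ := h.step_of_transform (m' := m) rfl
        (subs_subset h.mem (Or.inr (Or.inr no.self_mem_subs)))
        rfl (congrArg A.state (if_neg (mt hview.1 hh))) rfl ⟨φ, ρ, hrep⟩
      simpa only [h2, eventuallyAccepts_step] using ih₂ h1 (hwp.2 hh)

/-- `A` decides `P` if it reads the word `u` in the control state `s` with the memory `m`: the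
compiled machine accepts if and only if `P` holds. -/
def Decides (A : Algorithm Γ F S N) (ν : Naming V F) (s : S)
    (m : Mem V N) (u : List Γ) (P : Prop) : Prop :=
  ∀ C : A.machine.Config, A.Sim ν (.read s) m C → C.input = u → (A.EventuallyAccepts C ↔ P)

/-- The outcome `o` decides `P` if the word `u` remains to be read. -/
def Verdict (A : Algorithm Γ F S N) (ν : Naming V F) (u : List Γ)
    (P : Prop) : Outcome V N S → Prop
  | .acc => P
  | .rej => ¬ P
  | .read s m => A.Decides ν s m u P

theorem Sim.eventuallyAccepts_iff {p : Prog N F S} {m : Mem V N} {C : A.machine.Config}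
    (h : A.Sim ν p m C) {P : Prop} (hwp : wp ν p m (A.Verdict ν C.input P)) :
    A.EventuallyAccepts C ↔ P := by
  rcases h.exec hwp with ⟨h1, h2⟩ | ⟨h1, h2⟩ | ⟨s, m', C', h1, h2, h3, h4⟩
  · exact iff_of_true h2 h1
  · exact iff_of_false h2 h1
  · rw [← h4]
    exact h1 C' h2 h3

/-- The verification condition for the reading of one symbol. -/
theorem Decides.of_wp {s : S} {m : Mem V N} {u : List Γ} {P : Prop}
    (h : wp ν (A.next s u.head?) m (A.Verdict ν u.tail P)) : A.Decides ν s m u P := by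
  rintro C hC rfl
  have hs : A.machine.step C =
      { C with state := A.state (A.next s C.input.head?), input := C.input.tail } := by
    unfold KUM.step
    rw [hC.program]
    rfl
  have h1 : A.Sim ν (A.next s C.input.head?) m (A.machine.step C) := by
    rw [hs]
    exact ⟨A.next_mem s _, rfl, hC.active, hC.rep⟩
  rw [← eventuallyAccepts_step]
  refine h1.eventuallyAccepts_iff ?_
  rwa [hs]

variable (A) in
/-- A program that starts with all registers at one root decides the language of the machine. -/
theorem accepts_iff_of_wp_start {o : V} {P : Prop} {w : List Γ}
    (h : wp ν A.start ⟨fun _ => o, ∅, {o}⟩ (A.Verdict ν w P)) :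
    (∃ t, (A.machine.run w t).Accepting) ↔ P := by
  have h1 : A.Sim ν A.start ⟨fun _ => o, ∅, {o}⟩ (A.machine.step (A.machine.init w)) :=
    ⟨A.start_mem, rfl, rfl, rep_init ν o (A.state A.start)⟩
  have h2 := A.eventuallyAccepts_step (A.machine.init w)
  rw [h1.eventuallyAccepts_iff h] at h2
  exact h2.symm

end Algorithm

end Forest

/-! ### Binary representations, least significant digit first -/

namespace Shvachko

/-- The `d` last binary digits of `m`, least significant digit first. -/
def digits : ℕ → ℕ → List Bool
  | 0, _ => []
  | d + 1, m => decide (m % 2 = 1) :: digits d (m / 2)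

theorem length_digits (d m : ℕ) : (digits d m).length = d := by
  induction d generalizing m with
  | zero => rfl
  | succ d ih => simp [digits, ih]

theorem digits_add (a b m : ℕ) : digits (a + b) m = digits a m ++ digits b (m / 2 ^ a) := by
  induction a generalizing m with
  | zero => simp [digits]
  | succ a ih =>
    rw [show a + 1 + b = a + b + 1 by omega]
    simp only [digits, ih, List.cons_append, Nat.div_div_eq_div_mul, Nat.pow_succ']

theorem digits_injective {d i j : ℕ} (hi : i < 2 ^ d) (hj : j < 2 ^ d)
    (h : digits d i = digits d j) : i = j := by
  induction d generalizing i j with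
  | zero =>
    rw [Nat.pow_zero] at hi hj
    omega
  | succ d ih =>
    rw [Nat.pow_succ] at hi hj
    simp only [digits, List.cons.injEq, decide_eq_decide] at h
    have := ih (i := i / 2) (j := j / 2) (by omega) (by omega) h.2
    omega

theorem exists_digits_eq (l : List Bool) : ∃ i < 2 ^ l.length, digits l.length i = l := by
  induction l with
  | nil => exact ⟨0, by simp, rfl⟩
  | cons b l ih =>
    obtain ⟨i, hi, h⟩ := ih
    refine ⟨2 * i + b.toNat, ?_, ?_⟩
    · have := b.toNat_lt
      rw [List.length_cons, Nat.pow_succ]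
      omega
    · have h1 : (2 * i + b.toNat) / 2 = i := by
        have := b.toNat_lt
        omega
      have h2 : (2 * i + b.toNat) % 2 = b.toNat := by
        have := b.toNat_lt
        omega
      rw [List.length_cons, digits, h1, h, h2]
      cases b <;> rfl

theorem digits_eq_replicate {d m : ℕ} (h : m < 2 ^ d) (e : ℕ) :
    digits (d + e) m = digits d m ++ List.replicate e false := by
  have h0 : ∀ e, digits e 0 = List.replicate e false := by
    intro e
    induction e with
    | zero => rfl
    | succ e ih => simp [digits, ih, List.replicate_succ]
  rw [digits_add, Nat.div_eq_of_lt h, h0]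

/-- Strings of digits that end in the same way are ordered by the digit before. -/
theorem lt_of_suffix_digits {d i j : ℕ} (hi : i < 2 ^ d) (hj : j < 2 ^ d) {t : List Bool}
    (h1 : true :: t <:+ digits d i) (h0 : false :: t <:+ digits d j) : j < i := by
  induction d generalizing i j with
  | zero => simp [digits] at h1
  | succ d ih =>
    rw [Nat.pow_succ] at hi hj
    have hl1 := length_digits d (i / 2)
    have hl2 := length_digits d (j / 2)
    simp only [digits, List.suffix_cons_iff] at h1 h0
    rcases h1 with h1 | h1 <;> rcases h0 with h0 | h0
    · simp only [List.cons.injEq] at h1 h0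
      have := digits_injective (i := i / 2) (j := j / 2) (by omega) (by omega)
        (h1.2.symm.trans h0.2)
      have h3 := of_decide_eq_true h1.1.symm
      have h4 := of_decide_eq_false h0.1.symm
      omega
    · simp only [List.cons.injEq] at h1
      have := h0.length_le
      rw [List.length_cons, h1.2] at this
      omega
    · simp only [List.cons.injEq] at h0
      have := h1.length_le
      rw [List.length_cons, h0.2] at this
      omega
    · have := ih (i := i / 2) (j := j / 2) (by omega) (by omega) h1 h0
      omega

/-- The more significant digits before the least significant zero of a string of digits. -/
def aboveZero : List Bool → Option (List Bool)
  | [] => none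
  | true :: l => aboveZero l
  | false :: l => some l

theorem suffix_digits_succ {d m : ℕ} {u : List Bool} (h : aboveZero (digits d m) = some u) :
    true :: u <:+ digits d (m + 1) := by
  induction d generalizing m with
  | zero => simp [digits, aboveZero] at h
  | succ d ih =>
    rw [digits] at h ⊢
    rcases Nat.mod_two_eq_zero_or_one m with h2 | h2
    · rw [show (m + 1) % 2 = 1 by omega, show (m + 1) / 2 = m / 2 by omega]
      simp only [h2, zero_ne_one, decide_false, aboveZero, Option.some.injEq] at h
      simp [h]
    · rw [show (m + 1) / 2 = m / 2 + 1 by omega]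
      simp only [h2, decide_true, aboveZero] at h
      exact (ih h).trans (List.suffix_cons _ _)

theorem suffix_of_suffix_digits_succ {d m : ℕ} {t : List Bool}
    (h : true :: t <:+ digits d (m + 1)) :
    aboveZero (digits d m) = some t ∨ true :: t <:+ digits d m := by
  induction d generalizing m with
  | zero => simp [digits] at h
  | succ d ih =>
    rw [digits] at h ⊢
    rcases Nat.mod_two_eq_zero_or_one m with h2 | h2
    · rw [show (m + 1) % 2 = 1 by omega, show (m + 1) / 2 = m / 2 by omega] at h
      simp only [h2, zero_ne_one, decide_false, aboveZero, Option.some.injEq]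
      rcases List.suffix_cons_iff.1 h with h | h
      · simp only [decide_true, List.cons.injEq, true_and] at h
        exact Or.inl h.symm
      · exact Or.inr (h.trans (List.suffix_cons _ _))
    · rw [show (m + 1) / 2 = m / 2 + 1 by omega, show (m + 1) % 2 = 0 by omega] at h
      simp only [h2, decide_true, aboveZero]
      rcases List.suffix_cons_iff.1 h with h | h
      · simp at h
      · exact (ih h).imp_right fun h => h.trans (List.suffix_cons _ _)

theorem aboveZero_digits_eq_none {d m : ℕ} :
    aboveZero (digits d m) = none ↔ (m + 1) % 2 ^ d = 0 := by
  induction d generalizing m with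
  | zero => simp [digits, aboveZero, Nat.mod_one]
  | succ d ih =>
    rw [digits, Nat.pow_succ']
    rcases Nat.mod_two_eq_zero_or_one m with h2 | h2
    · simp only [h2, zero_ne_one, decide_false, aboveZero, reduceCtorEq, false_iff]
      rw [Nat.mod_mul]
      omega
    · simp only [h2, decide_true, aboveZero, ih]
      rw [Nat.mod_mul, show (m + 1) / 2 = m / 2 + 1 by omega]
      omega

theorem aboveZero_digits_eq_nil {d m : ℕ} (hm : m < 2 ^ (d + 1)) :
    aboveZero (digits (d + 1) m) = some [] ↔ m + 1 = 2 ^ d := by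
  induction d generalizing m with
  | zero =>
    rw [Nat.zero_add, Nat.pow_one] at hm
    interval_cases m <;> simp [digits, aboveZero]
  | succ d ih =>
    rw [Nat.pow_succ] at hm
    rw [digits, Nat.pow_succ]
    rcases Nat.mod_two_eq_zero_or_one m with h2 | h2
    · simp only [h2, zero_ne_one, decide_false, aboveZero, Option.some.injEq]
      refine iff_of_false (fun h => ?_) (by omega)
      have := length_digits (d + 1) (m / 2)
      rw [h] at this
      simp at this
    · simp only [h2, decide_true, aboveZero]
      rw [ih (by omega)]
      omega

/-- The string of digits has no digit `1` if the carry passes through all of it. -/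
theorem not_suffix_of_aboveZero_eq_none {d m : ℕ} (h : aboveZero (digits d m) = none)
    (t : List Bool) : ¬ true :: t <:+ digits d (m + 1) := by
  induction d generalizing m with
  | zero => simp [digits]
  | succ d ih =>
    rw [digits] at h ⊢
    rcases Nat.mod_two_eq_zero_or_one m with h2 | h2
    · simp [h2, aboveZero] at h
    · rw [show (m + 1) / 2 = m / 2 + 1 by omega, show (m + 1) % 2 = 0 by omega]
      simp only [h2, decide_true, aboveZero] at h
      rw [List.suffix_cons_iff]
      rintro (h' | h')
      · simp at h'
      · exact ih h h'

/-- Of the `2K + 1` digits of the number of a block, the `K + 1` more significant ones. -/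
def high (K i : ℕ) : List Bool := digits (K + 1) (i / 2 ^ K)

/-- Of the `2K + 1` digits of the number of a block, the `K` less significant ones. -/
def low (K i : ℕ) : List Bool := digits K i

theorem length_high (K i : ℕ) : (high K i).length = K + 1 := length_digits _ _

theorem length_low (K i : ℕ) : (low K i).length = K := length_digits _ _

theorem low_append_high (K i : ℕ) : low K i ++ high K i = digits (2 * K + 1) i := by
  rw [show 2 * K + 1 = K + (K + 1) by omega, digits_add]
  rfl

theorem div_lt_of_lt {K i : ℕ} (hi : i < 2 ^ (2 * K + 1)) : i / 2 ^ K < 2 ^ (K + 1) := by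
  rw [Nat.div_lt_iff_lt_mul (by positivity), ← Nat.pow_add]
  rwa [show K + 1 + K = 2 * K + 1 by omega]

theorem eq_of_high_eq_of_low_eq {K i j : ℕ} (hi : i < 2 ^ (2 * K + 1)) (hj : j < 2 ^ (2 * K + 1))
    (hp : high K i = high K j) (hq : low K i = low K j) : i = j :=
  digits_injective hi hj (by rw [← low_append_high, ← low_append_high, hp, hq])

theorem not_suffix_high {K i m : ℕ} (hi : i < m) (hm : m < 2 ^ (2 * K + 1)) {t : List Bool}
    (h1 : true :: t <:+ high K i) : ¬ false :: t <:+ high K m := by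
  intro h0
  have := lt_of_suffix_digits (div_lt_of_lt (hi.trans hm)) (div_lt_of_lt hm) h1 h0
  have := Nat.div_le_div_right (c := 2 ^ K) hi.le
  omega

theorem not_suffix_low {K i m : ℕ} (hi : i < m) (hm : m < 2 ^ (2 * K + 1)) {t : List Bool}
    (hp : high K i = high K m) (h1 : true :: t <:+ low K i) : ¬ false :: t <:+ low K m := by
  intro h0
  have key : ∀ (b : Bool) (j : ℕ), high K j = high K m → b :: t <:+ low K j →
      b :: (t ++ high K m) <:+ digits (2 * K + 1) j := by
    rintro b j hj ⟨s, hs⟩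
    exact ⟨s, by rw [← low_append_high, hj, ← hs]; simp⟩
  have := lt_of_suffix_digits (hi.trans hm) hm (key _ _ hp h1) (key _ _ rfl h0)
  omega

theorem div_succ_of_aboveZero {K m : ℕ} {u : List Bool} (h : aboveZero (low K m) = some u) :
    (m + 1) / 2 ^ K = m / 2 ^ K := by
  have h1 : ¬ (m + 1) % 2 ^ K = 0 := by
    rw [← aboveZero_digits_eq_none, ← low, h]
    simp
  rw [Nat.succ_div, if_neg (by rwa [Nat.dvd_iff_mod_eq_zero]), Nat.add_zero]

theorem div_succ_of_aboveZero_eq_none {K m : ℕ} (h : aboveZero (low K m) = none) :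
    (m + 1) / 2 ^ K = m / 2 ^ K + 1 := by
  rw [low, aboveZero_digits_eq_none] at h
  rw [Nat.succ_div, if_pos (by rwa [Nat.dvd_iff_mod_eq_zero])]

theorem high_succ {K m : ℕ} {u : List Bool} (h : aboveZero (low K m) = some u) :
    high K (m + 1) = high K m := by
  rw [high, div_succ_of_aboveZero h, high]

/-- All digits are `1` exactly for the last block. -/
theorem aboveZero_high_eq_none {K m : ℕ} (hm : m < 2 ^ (2 * K + 1))
    (h : aboveZero (low K m) = none) :
    aboveZero (high K m) = none ↔ m + 1 = 2 ^ (2 * K + 1) := by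
  have h1 := div_succ_of_aboveZero_eq_none h
  have h2 := div_lt_of_lt hm
  rw [low, aboveZero_digits_eq_none] at h
  rw [high, aboveZero_digits_eq_none, ← h1]
  obtain ⟨c, hc⟩ := Nat.dvd_of_mod_eq_zero h
  have hpos : 0 < 2 ^ K := by positivity
  have hd : (m + 1) / 2 ^ K = c := by rw [hc, Nat.mul_div_cancel_left _ hpos]
  rw [hd] at h1 ⊢
  rw [hc, show 2 * K + 1 = K + (K + 1) by omega, Nat.pow_add 2 K (K + 1),
    Nat.mul_right_inj hpos.ne', ← Nat.dvd_iff_mod_eq_zero]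
  constructor
  · intro h3
    have hc' : 0 < c := h1 ▸ Nat.succ_pos _
    exact le_antisymm (h1 ▸ h2) (Nat.le_of_dvd hc' h3)
  · rintro rfl
    exact dvd_rfl

/-- The only `0` is the most significant digit exactly for the last of the first half of the
blocks. -/
theorem aboveZero_high_eq_nil {K m : ℕ} (hm : m < 2 ^ (2 * K + 1))
    (h : aboveZero (low K m) = none) :
    aboveZero (high K m) = some [] ↔ m + 1 = 2 ^ (2 * K) := by
  have h1 := div_succ_of_aboveZero_eq_none h
  rw [low, aboveZero_digits_eq_none] at h
  rw [high, aboveZero_digits_eq_nil (div_lt_of_lt hm), ← h1]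
  obtain ⟨c, hc⟩ := Nat.dvd_of_mod_eq_zero h
  have hpos : 0 < 2 ^ K := by positivity
  rw [hc, Nat.mul_div_cancel_left _ hpos, two_mul, Nat.pow_add, Nat.mul_right_inj hpos.ne']

theorem high_succ_ne {K m i : ℕ} (hm : m + 1 < 2 ^ (2 * K + 1))
    (h : aboveZero (low K m) = none) (hi : i < m + 1) : high K i ≠ high K (m + 1) := by
  intro h'
  have := digits_injective (div_lt_of_lt (hi.trans hm)) (div_lt_of_lt hm) h'
  rw [div_succ_of_aboveZero_eq_none h] at this
  have := Nat.div_le_div_right (c := 2 ^ K) (Nat.lt_succ_iff.1 hi)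
  omega

end Shvachko

/-! ### The algorithm -/

namespace Shvachko

open Forest

/-- The nodes of the forest.  Strings of digits begin with the least significant one, so that the
children of a node arise by `List.cons`.  In the binary tree of the nodes `index t`, which has depth
`K + 1`, a leaf `index p` leads to the root `group p []` of a binary tree of depth `K`; its leaf
`group p q` leads to the list `cell p q v` in which the block of number `q ++ p` is spelled out.  The
tree of the nodes `trie p s` contains the blocks of the group `p`: its paths are the sequences of
pairs of a digit of `q` and the corresponding digit of the block of number `q ++ p`. -/
inductive Node where
  | index (t : List Bool)
  | group (p t : List Bool)
  | trie (p : List Bool) (s : List (Bool × Bool))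
  | cell (p q v : List Bool)

/-- The labels of the edges. -/
inductive Label where
  | bit (b : Bool)
  | pair (b v : Bool)
  | down
  | trie
  deriving Fintype

/-- The node to which an edge leads. -/
def Node.child : Node → Label → Option Node
  | .index t, .bit b => some (.index (b :: t))
  | .index t, .down => some (.group t [])
  | .group p t, .bit b => some (.group p (b :: t))
  | .group p t, .down => some (.cell p t [])
  | .group p [], .trie => some (.trie p [])
  | .trie p s, .pair b v => some (.trie p ((b, v) :: s))
  | .cell p q v, .bit b => some (.cell p q (b :: v))
  | _, _ => none

/-- The edge that leads to a node. -/
def Node.parent : Node → Option (Node × Label)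
  | .index [] => none
  | .index (b :: t) => some (.index t, .bit b)
  | .group p [] => some (.index p, .down)
  | .group p (b :: t) => some (.group p t, .bit b)
  | .trie p [] => some (.group p [], .trie)
  | .trie p (x :: s) => some (.trie p s, .pair x.1 x.2)
  | .cell p q [] => some (.group p q, .down)
  | .cell p q (b :: v) => some (.cell p q v, .bit b)

theorem Node.parent_child {a w : Node} {f : Label} (h : a.child f = some w) :
    w.parent = some (a, f) := by
  unfold Node.child at h
  split at h <;> cases h <;> rfl

/-- The distance from the root. -/
def Node.rank : Node → ℕ
  | .index t => t.length
  | .group p t => p.length + 1 + t.length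
  | .trie p s => p.length + 2 + s.length
  | .cell p q v => p.length + 1 + q.length + 1 + v.length

theorem Node.rank_child {a w : Node} {f : Label} (h : a.child f = some w) :
    w.rank = a.rank + 1 := by
  unfold Node.child at h
  split at h <;> cases h <;> simp [Node.rank] <;> omega

/-- The names of the nodes. -/
def naming : Naming Node Label where
  child := Node.child
  inj h₁ h₂ := by
    have := (Node.parent_child h₁).symm.trans (Node.parent_child h₂)
    simpa using this
  rank := Node.rank
  rank_child := Node.rank_child

/-- The control states in which a symbol is read.  In `block first fresh zero top`, a block is being
read; `first` tells that it is the first one, `fresh` that it is the first one of its group, `zero`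
that a digit `0` has been met in `q`, and `top` is `none` if no `0` has been met in `p`, else it tells
whether the last one is the most significant digit.  In `left past` and `right past`, the
first and the second index are being read, and `past` tells that the group has been reached. -/
inductive Ctrl where
  | block (first fresh zero : Bool) (top : Option Bool)
  | left (past : Bool)
  | right (past : Bool)
  | final
  deriving Fintype

/-- The root `index []`. -/
@[simp] abbrev rRoot : Fin 11 := 0
/-- The position in the tree of the group. -/
@[simp] abbrev rGroup : Fin 11 := 1
/-- The last branching to the left in the tree of the group. -/
@[simp] abbrev rGroupMark : Fin 11 := 2
/-- The position in the trie of the group. -/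
@[simp] abbrev rTrie : Fin 11 := 3
/-- The position in the tree of the groups; later on, the root of its part that belongs
to the blocks. -/
@[simp] abbrev rIndex : Fin 11 := 4
/-- The last branching to the left in the tree of the groups. -/
@[simp] abbrev rIndexMark : Fin 11 := 5
/-- The end of the current block; later on, the position in the block of the first index. -/
@[simp] abbrev rTail : Fin 11 := 6
/-- The beginning of the current block. -/
@[simp] abbrev rHead : Fin 11 := 7
/-- The position in the first block, which is the measure of the length of the others. -/
@[simp] abbrev rRuler : Fin 11 := 8
/-- The beginning of the first block. -/
@[simp] abbrev rRulerHead : Fin 11 := 9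
/-- The root of the tree of the group. -/
@[simp] abbrev rGroupRoot : Fin 11 := 10

/-- Programs of the algorithm. -/
abbrev Code : Type := Prog 11 Label Ctrl

open Prog

/-- Advance in the first block, whose end must not have been reached. -/
def rulerStep (first : Bool) (k : Code) : Code :=
  if first then k else
    .test rRuler (.bit false) (.down rRuler (.bit false) k)
      (.test rRuler (.bit true) (.down rRuler (.bit true) k) .rej)

/-- Check that the end of the block has been reached in which `r` points. -/
def atEnd (r : Fin 11) (k : Code) : Code :=
  .test r (.bit false) .rej (.test r (.bit true) .rej k)

/-- Go down by one digit towards the leaf that comes next in a binary tree: to the right if there is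
an edge to the right, else to the left; a branching to the left is marked. -/
def walkStep (r mark : Fin 11) (k : Bool → Code) : Code :=
  .test r (.bit true) (.down r (.bit true) (k true))
    (.move mark r (.down r (.bit false) (k false)))

/-- Read a digit of a block. -/
def onBit (first fresh zero : Bool) (top : Option Bool) (v : Bool) : Code :=
  rulerStep first <| walkStep rGroup rGroupMark fun b =>
    .down rTrie (.pair b v) <| .down rTail (.bit v) <|
      if fresh then
        walkStep rIndex rIndexMark fun a =>
          .read (.block first fresh (zero || !b) (if a then top else some false))
      else .read (.block first fresh (zero || !b) top)

/-- Prepare for the reading of a block. -/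
def beginBlock (first fresh : Bool) (top : Option Bool) : Code :=
  .move rGroup rGroupRoot <| .move rTrie rGroupRoot <| .down rTrie .trie <| .new rHead <|
    .move rTail rHead <| .move rRuler rRulerHead <| .read (.block first fresh false top)

/-- Prepare for the reading of the first block of a group. -/
def beginGroup (first : Bool) : Code :=
  .new rGroupRoot <| .move rIndex rRoot <| walkStep rIndex rIndexMark fun a =>
    beginBlock first true (if a then none else some true)

/-- Check the length of a block and put it in its place. -/
def endBlock (first fresh : Bool) (k : Code) : Code :=
  (if first then (.move rRulerHead rHead ·) else atEnd rRuler) <|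
    (if fresh then (.link rIndex .down rGroupRoot ·) else id) <|
      .link rGroup .down rHead k

/-- Read the separator that ends a block: the next leaf is to the right of the last branching to
the left. -/
def onSep (first fresh zero : Bool) (top : Option Bool) : Code :=
  endBlock first fresh <|
    if zero then .down rGroupMark (.bit true) (beginBlock false false top)
    else if top = none then .rej
    else .down rIndexMark (.bit true) (beginGroup false)

/-- Read the symbol `#` that ends the last block.  The number of blocks is right if no `0` has been
met, or only the most significant digit is `0`. -/
def onHash (first fresh zero : Bool) (top : Option Bool) : Code :=
  endBlock first fresh <|
    if zero || top = some false then .rej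
    else .move rIndex rRoot <|
      (if top = none then id else (.down rIndex (.bit false) ·)) <|
        .move rGroup rIndex <| .read (.left false)

/-- Go from a leaf of the tree of the groups to the tree of the group. -/
def cross (past : Bool) (k : Bool → Code) : Code :=
  if past then k true else .test rGroup .down (.down rGroup .down (k true)) (k false)

/-- Go from a leaf of the tree of the groups to the trie of the group. -/
def crossTrie (past : Bool) (k : Bool → Code) : Code :=
  if past then k true else
    .test rGroup .down (.down rGroup .down (.down rGroup .trie (k true))) (k false)

/-- Go down along an existing edge and read. -/
def advance (f : Label) (c : Ctrl) : Code :=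
  .test rGroup f (.down rGroup f (.read c)) .rej

/-- Read a symbol of the first index. -/
def onLeft (past : Bool) : Option Symb → Code
  | some (.bit b) => cross past fun past' => advance (.bit b) (.left past')
  | some .hash => cross past fun past' =>
      if past' then
        .test rGroup .down (.down rGroup .down <| .move rTail rGroup <| .move rGroup rIndex <|
          .read (.right false)) .rej
      else .rej
  | _ => .rej

/-- Read a symbol of the second index. -/
def onRight (past : Bool) : Option Symb → Code
  | some (.bit b) => crossTrie past fun past' =>
      if past' then
        .test rTail (.bit false)
          (.down rTail (.bit false) (advance (.pair b false) (.right true)))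
          (.test rTail (.bit true)
            (.down rTail (.bit true) (advance (.pair b true) (.right true))) .rej)
      else advance (.bit b) (.right false)
  | some .hash => crossTrie past fun past' =>
      if past' then atEnd rTail (.read .final) else .rej
  | _ => .rej

/-- The real-time algorithm. -/
def algorithm : Algorithm Symb Label Ctrl 11 where
  start := beginGroup true
  next
    | .block first fresh zero top, some (.bit v) => onBit first fresh zero top v
    | .block first fresh zero top, some .sep => onSep first fresh zero top
    | .block first fresh zero top, some .hash => onHash first fresh zero top
    | .block .., none => .rej
    | .left past, x => onLeft past x
    | .right past, x => onRight past x
    | .final, none => .acc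
    | .final, some _ => .rej

theorem algorithm_next_none (s : Ctrl) :
    algorithm.next s none = .acc ∨ algorithm.next s none = .rej := by
  cases s
  · exact Or.inr rfl
  · exact Or.inr rfl
  · exact Or.inr rfl
  · exact Or.inl rfl

instance : Finite Symb :=
  Finite.of_surjective
    (fun x : Option (Option Bool) => match x with
      | none => Symb.sep
      | some none => Symb.hash
      | some (some b) => Symb.bit b)
    (by
      rintro (b | _ | _)
      · exact ⟨some (some b), rfl⟩
      · exact ⟨none, rfl⟩
      · exact ⟨some none, rfl⟩)

/-! ### The forest that belongs to the blocks read -/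

/-- `v` is the block of number `q ++ p` in the list `bs`. -/
def Visited (K : ℕ) (bs : List (List Bool)) (p q v : List Bool) : Prop :=
  ∃ i, bs[i]? = some v ∧ high K i = p ∧ low K i = q

/-- The edges, given by their lower ends, that belong to the blocks in `R`. -/
def Stored (R : List Bool → List Bool → List Bool → Prop) : Node → Prop
  | .index t => t ≠ [] ∧ ∃ p q v, R p q v ∧ t <:+ p
  | .group p t => ∃ q v, R p q v ∧ t <:+ q
  | .trie p s => ∃ q v, R p q v ∧ s <:+ q.zip v
  | .cell p q v => ∃ w, R p q w ∧ v <:+ w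

/-- The edges that belong to the current block of number `q ++ p`, when `tp`, `tq` and `cur` are the
parts of `p`, `q` and of the block that have been dealt with.  The edges to the right on
the way to the leaf exist from the beginning. -/
def Current (p q tp tq cur : List Bool) : Node → Prop
  | .index t => t ≠ [] ∧ (t <:+ tp ∨ t <:+ p ∧ t.head? = some true)
  | .group p' t => p' = p ∧ t ≠ [] ∧ (t <:+ tq ∨ t <:+ q ∧ t.head? = some true)
  | .trie p' s => p' = p ∧ s <:+ tq.zip cur
  | .cell p' q' v => p' = p ∧ q' = q ∧ v ≠ [] ∧ v <:+ cur

/-- The facts about the blocks that hold while the block after the blocks `bs` is read. -/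
structure Frame (K : ℕ) (bs : List (List Bool)) (fresh : Bool) : Prop where
  lt : bs.length < 2 ^ (2 * K + 1)
  len : ∀ b ∈ bs, b.length = K
  ne : fresh = true → ∀ i < bs.length, high K i ≠ high K bs.length
  eq : fresh = false → ∃ i < bs.length, high K i = high K bs.length

/-- The memory when the part `cur` of the block after the blocks `bs` has been read. -/
structure Inv (K : ℕ) (bs : List (List Bool)) (fresh zero : Bool) (top : Option Bool)
    (cur tp tq : List Bool) (m : Mem Node 11) : Prop where
  edges : ∀ x, x ∈ m.edges ↔ Stored (Visited K bs) x ∨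
    Current (high K bs.length) (low K bs.length) tp tq cur x
  alive : ∀ x ∈ m.alive, x ∈ m.edges ∨ x = .index [] ∨ x = .group (high K bs.length) [] ∨
    x = .cell (high K bs.length) (low K bs.length) []
  tp_suffix : tp <:+ high K bs.length
  tq_suffix : tq <:+ low K bs.length
  tp_length : tp.length = if fresh then cur.length + 1 else K + 1
  tq_length : tq.length = cur.length
  root : m.reg rRoot = .index []
  group : m.reg rGroup = .group (high K bs.length) tq
  trie : m.reg rTrie = .trie (high K bs.length) (tq.zip cur)
  tail : m.reg rTail = .cell (high K bs.length) (low K bs.length) cur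
  head : m.reg rHead = .cell (high K bs.length) (low K bs.length) []
  groupRoot : m.reg rGroupRoot = .group (high K bs.length) []
  index : fresh = true → m.reg rIndex = .index tp
  zero_eq : zero = (aboveZero tq).isSome
  groupMark : ∀ u, aboveZero tq = some u → m.reg rGroupMark = .group (high K bs.length) u
  top_eq : top = (aboveZero tp).map List.isEmpty
  indexMark : ∀ u, aboveZero tp = some u → m.reg rIndexMark = .index u

/-- The position in the first block is at distance `n` from its beginning. -/
structure Ruler (K : ℕ) (bs : List (List Bool)) (first : Bool) (n : ℕ) (m : Mem Node 11) :
    Prop where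
  first_eq : first = bs.isEmpty
  ruler : ∀ b, bs[0]? = some b → m.reg rRulerHead = .cell (high K 0) (low K 0) [] ∧
    ∃ y, m.reg rRuler = .cell (high K 0) (low K 0) y ∧ y <:+ b ∧ y.length = n

/-- The memory when the blocks `bs ++ [b]` have been stored. -/
structure Done (K : ℕ) (bs : List (List Bool)) (b : List Bool) (zero : Bool) (top : Option Bool)
    (m : Mem Node 11) : Prop where
  edges : ∀ x, x ∈ m.edges ↔ Stored (Visited K (bs ++ [b])) x
  alive : ∀ x ∈ m.alive, x ∈ m.edges ∨ x = .index []
  root : m.reg rRoot = .index []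
  groupRoot : m.reg rGroupRoot = .group (high K bs.length) []
  zero_eq : zero = (aboveZero (low K bs.length)).isSome
  groupMark : ∀ u, aboveZero (low K bs.length) = some u →
    m.reg rGroupMark = .group (high K bs.length) u
  top_eq : top = (aboveZero (high K bs.length)).map List.isEmpty
  indexMark : ∀ u, aboveZero (high K bs.length) = some u → m.reg rIndexMark = .index u
  rulerHead : m.reg rRulerHead = .cell (high K 0) (low K 0) []

theorem visited_append {K : ℕ} {bs : List (List Bool)} {b p q v : List Bool} :
    Visited K (bs ++ [b]) p q v ↔
      Visited K bs p q v ∨ high K bs.length = p ∧ low K bs.length = q ∧ v = b := by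
  constructor
  · rintro ⟨i, hi, hp, hq⟩
    rcases Nat.lt_trichotomy i bs.length with h | rfl | h
    · rw [List.getElem?_append_left h] at hi
      exact Or.inl ⟨i, hi, hp, hq⟩
    · simp only [List.getElem?_concat_length, Option.some.injEq] at hi
      exact Or.inr ⟨hp, hq, hi.symm⟩
    · rw [List.getElem?_eq_none (by simp; omega)] at hi
      cases hi
  · rintro (⟨i, hi, hp, hq⟩ | ⟨hp, hq, rfl⟩)
    · refine ⟨i, ?_, hp, hq⟩
      rw [List.getElem?_append_left, hi]
      by_contra h
      rw [List.getElem?_eq_none (by omega)] at hi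
      cases hi
    · exact ⟨bs.length, by simp, hp, hq⟩

theorem Visited.exists_lt {K : ℕ} {bs : List (List Bool)} {p q v : List Bool}
    (h : Visited K bs p q v) :
    ∃ i < bs.length, bs[i]? = some v ∧ high K i = p ∧ low K i = q := by
  obtain ⟨i, hi, hp, hq⟩ := h
  refine ⟨i, ?_, hi, hp, hq⟩
  by_contra h
  rw [List.getElem?_eq_none (by omega)] at hi
  cases hi

theorem exists_cons_suffix {α : Type*} {t l : List α} (h : t <:+ l) (hlt : t.length < l.length) :
    ∃ b, b :: t <:+ l := by
  obtain ⟨s, rfl⟩ := h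
  rcases List.eq_nil_or_concat s with rfl | ⟨s', b, rfl⟩
  · simp at hlt
  · exact ⟨b, s', by simp⟩

theorem cons_suffix_inj {α : Type*} {t l : List α} {a b : α} (h₁ : a :: t <:+ l)
    (h₂ : b :: t <:+ l) : a = b := by
  have := (List.suffix_of_suffix_length_le h₁ h₂ (by simp)).eq_of_length (by simp)
  simp only [List.cons.injEq, and_true] at this
  exact this

theorem not_cons_suffix_self {α : Type*} {t : List α} {a : α} : ¬ a :: t <:+ t := by
  intro h
  have := h.length_le
  simp at this

/-- On the way to the next leaf in the tree of a group, the walk turns to the right exactly where an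
edge to the right exists: the edges to the right on this way have been created in advance, and the
way to an earlier leaf never branches off to the right. -/
theorem Frame.group_true_mem_iff {K : ℕ} {bs : List (List Bool)} {fresh zero : Bool}
    {top : Option Bool} {cur tp tq : List Bool} {m : Mem Node 11} (hf : Frame K bs fresh)
    (h : Inv K bs fresh zero top cur tp tq m) {b : Bool} (hb : b :: tq <:+ low K bs.length) :
    .group (high K bs.length) (true :: tq) ∈ m.edges ↔ b = true := by
  rw [h.edges]
  constructor
  · rintro (⟨q, v, hv, hq⟩ | ⟨-, -, h1 | h1⟩)
    · obtain ⟨i, hi, -, hp, rfl⟩ := hv.exists_lt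
      cases b
      · exact absurd hb (not_suffix_low hi hf.lt hp hq)
      · rfl
    · exact absurd h1 not_cons_suffix_self
    · exact cons_suffix_inj hb h1.1
  · rintro rfl
    exact Or.inr ⟨rfl, by simp, Or.inr ⟨hb, rfl⟩⟩

end Shvachko

namespace Shvachko

open Forest

/-! ### Reading the digits of a block -/

variable {K : ℕ} {bs : List (List Bool)} {first fresh zero : Bool} {top : Option Bool}
  {cur tp tq : List Bool} {m : Mem Node 11} {post : Outcome Node 11 Ctrl → Prop}

theorem wp_down {r : Fin 11} {f : Label} {k : Code} {a w : Node} (hr : m.reg r = a)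
    (hw : a.child f = some w) (ha : w ∈ m.alive → w ∈ m.edges)
    (h : wp naming k ⟨Function.update m.reg r w, insert w m.edges, insert w m.alive⟩ post) :
    wp naming (.down r f k) m post :=
  ⟨w, hr ▸ hw, ha, h⟩

theorem wp_move {r s : Fin 11} {k : Code} {a : Node} (hs : m.reg s = a)
    (h : wp naming k (m.point r a) post) : wp naming (.move r s k) m post := by
  subst hs
  exact h

theorem wp_test {r : Fin 11} {f : Label} {yes no : Code} {a w : Node} (hr : m.reg r = a)
    (hw : a.child f = some w) (h₁ : w ∈ m.edges → wp naming yes m post)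
    (h₂ : w ∉ m.edges → wp naming no m post) : wp naming (.test r f yes no) m post := by
  subst hr
  refine ⟨fun ⟨w', hw', h⟩ => ?_, fun h => h₂ fun hw' => h ⟨w, hw, hw'⟩⟩
  cases hw.symm.trans hw'
  exact h₁ h

/-- A step of a walk to the leaf that is reached next: if this leaf is found in the direction `b`,
then an edge to the right has to exist exactly when `b` is `true`. -/
theorem wp_walkStep {r mark : Fin 11} {k : Bool → Code} {a : Node} {w : Bool → Node} (b : Bool)
    (hr : m.reg r = a) (hw : ∀ c, a.child (.bit c) = some (w c)) (hne : r ≠ mark)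
    (hb : w true ∈ m.edges ↔ b = true) (ha : w b ∈ m.alive → w b ∈ m.edges)
    (h : wp naming (k b)
      ⟨Function.update (Function.update m.reg mark (if b then m.reg mark else a)) r (w b),
        insert (w b) m.edges, insert (w b) m.alive⟩ post) :
    wp naming (walkStep r mark k) m post := by
  refine wp_test hr (hw true) (fun ht => ?_) (fun ht => ?_)
  · obtain rfl := hb.1 ht
    refine wp_down hr (hw true) ha ?_
    simpa using h
  · rw [hb, Bool.not_eq_true] at ht
    subst ht
    subst hr
    exact wp_down (a := m.reg r) (by simp [Mem.point, hne]) (hw false) ha h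

/-- The list of the first block does not grow while another block is read. -/
theorem mem_ruler_iff (hf : Frame K bs fresh) (h : Inv K bs fresh zero top cur tp tq m)
    {b y : List Bool} (hb : bs[0]? = some b) :
    .cell (high K 0) (low K 0) y ∈ m.edges ↔ y <:+ b := by
  have h0 : 0 < bs.length := by
    by_contra h0
    rw [List.getElem?_eq_none (by omega)] at hb
    cases hb
  rw [h.edges]
  constructor
  · rintro (⟨w, hw, hs⟩ | ⟨h1, h2, -⟩)
    · obtain ⟨i, hi, hw, h1, h2⟩ := hw.exists_lt
      obtain rfl := eq_of_high_eq_of_low_eq (hi.trans hf.lt) (h0.trans hf.lt) h1 h2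
      cases hw.symm.trans hb
      exact hs
    · have := eq_of_high_eq_of_low_eq (h0.trans hf.lt) hf.lt h1 h2
      omega
  · exact fun hs => Or.inl ⟨b, ⟨0, hb, rfl, rfl⟩, hs⟩

/-- The invariant does not depend on the position in the first block. -/
theorem Inv.congr (h : Inv K bs fresh zero top cur tp tq m) {m' : Mem Node 11}
    (he : m'.edges = m.edges) (ha : ∀ x ∈ m'.alive, x ∈ m.alive ∨ x ∈ m.edges)
    (hr : ∀ r, r ≠ rRuler → r ≠ rRulerHead → m'.reg r = m.reg r) :
    Inv K bs fresh zero top cur tp tq m' where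
  edges := he ▸ h.edges
  alive := by
    intro x hx
    rw [he]
    exact (ha x hx).elim (h.alive x) Or.inl
  tp_suffix := h.tp_suffix
  tq_suffix := h.tq_suffix
  tp_length := h.tp_length
  tq_length := h.tq_length
  root := (hr _ (by decide) (by decide)).trans h.root
  group := (hr _ (by decide) (by decide)).trans h.group
  trie := (hr _ (by decide) (by decide)).trans h.trie
  tail := (hr _ (by decide) (by decide)).trans h.tail
  head := (hr _ (by decide) (by decide)).trans h.head
  groupRoot := (hr _ (by decide) (by decide)).trans h.groupRoot
  index hf := (hr _ (by decide) (by decide)).trans (h.index hf)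
  zero_eq := h.zero_eq
  groupMark u hu := (hr _ (by decide) (by decide)).trans (h.groupMark u hu)
  top_eq := h.top_eq
  indexMark u hu := (hr _ (by decide) (by decide)).trans (h.indexMark u hu)

theorem wp_rulerStep (hf : Frame K bs fresh) (h : Inv K bs fresh zero top cur tp tq m) {n : ℕ}
    (hr : Ruler K bs first n m) {k : Code} (hrej : first = false → K ≤ n → post .rej)
    (hk : ∀ m', (first = false → n < K) → Inv K bs fresh zero top cur tp tq m' →
      Ruler K bs first (n + 1) m' → wp naming k m' post) :
    wp naming (rulerStep first k) m post := by
  unfold rulerStep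
  have hfirst := hr.first_eq
  rcases bs with _ | ⟨b, bs⟩
  · rw [if_pos (by simpa using hfirst)]
    exact hk m (by simp [hfirst]) h ⟨hfirst, by simp⟩
  · rw [if_neg (by simp [hfirst])]
    obtain ⟨h1, y, h2, h3, h4⟩ := hr.ruler b rfl
    have hlb := hf.len b (by simp)
    have step : ∀ c, c :: y <:+ b →
        wp naming k ⟨Function.update m.reg rRuler (.cell (high K 0) (low K 0) (c :: y)),
          insert (.cell (high K 0) (low K 0) (c :: y)) m.edges,
          insert (.cell (high K 0) (low K 0) (c :: y)) m.alive⟩ post := by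
      intro c hc
      have hm := (mem_ruler_iff hf h rfl).2 hc
      refine hk _ (fun _ => ?_) (h.congr (Set.insert_eq_of_mem hm) ?_ ?_) ⟨hfirst, ?_⟩
      · have := hc.length_le
        rw [List.length_cons] at this
        omega
      · rintro x (rfl | hx)
        · exact Or.inr hm
        · exact Or.inl hx
      · exact fun r hr _ => Function.update_of_ne hr ..
      · intro b' hb'
        cases hb'
        exact ⟨h1, c :: y, by simp, hc, by simp [h4]⟩
    refine wp_test h2 (w := .cell (high K 0) (low K 0) (false :: y)) rfl (fun hm => ?_) (fun hm => ?_)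
    · exact wp_down h2 rfl (fun _ => hm) (step _ ((mem_ruler_iff hf h rfl).1 hm))
    · refine wp_test h2 (w := .cell (high K 0) (low K 0) (true :: y)) rfl (fun hm' => ?_) (fun hm' => ?_)
      · exact wp_down h2 rfl (fun _ => hm') (step _ ((mem_ruler_iff hf h rfl).1 hm'))
      · refine hrej (by simp [hfirst]) ?_
        by_contra hlt
        obtain ⟨c, hc⟩ := exists_cons_suffix h3 (by omega)
        have := (mem_ruler_iff hf h rfl).2 hc
        cases c
        · exact hm this
        · exact hm' this

/-- The counterpart of `Frame.group_true_mem_iff` for the tree of the groups. -/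
theorem index_true_mem_iff (hf : Frame K bs fresh) {E : Set Node}
    (hE : ∀ t, .index t ∈ E ↔ Stored (Visited K bs) (.index t) ∨
      Current (high K bs.length) (low K bs.length) tp tq cur (.index t))
    {b : Bool} (hb : b :: tp <:+ high K bs.length) :
    .index (true :: tp) ∈ E ↔ b = true := by
  rw [hE]
  constructor
  · rintro (⟨-, p, q, v, hv, hq⟩ | ⟨-, h1 | h1⟩)
    · obtain ⟨i, hi, -, rfl, -⟩ := hv.exists_lt
      cases b
      · exact absurd hb (not_suffix_high hi hf.lt hq)
      · rfl
    · exact absurd h1 not_cons_suffix_self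
    · exact cons_suffix_inj hb h1.1
  · rintro rfl
    exact Or.inr ⟨by simp, Or.inr ⟨hb, rfl⟩⟩

theorem current_cons {p q : List Bool} {b v : Bool} (x : Node) :
    Current p q tp (b :: tq) (v :: cur) x ↔ x = .group p (b :: tq) ∨
      x = .trie p ((b, v) :: tq.zip cur) ∨ x = .cell p q (v :: cur) ∨ Current p q tp tq cur x := by
  rcases x with t | ⟨p', t⟩ | ⟨p', s⟩ | ⟨p', q', w⟩
  · simp [Current]
  · simp only [Current, List.suffix_cons_iff, Node.group.injEq, reduceCtorEq, false_or]
    constructor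
    · tauto
    · rintro (⟨rfl, rfl⟩ | h)
      · simp
      · tauto
  · simp only [Current, List.zip_cons_cons, List.suffix_cons_iff, Node.trie.injEq, reduceCtorEq,
      false_or]
    tauto
  · simp only [Current, List.suffix_cons_iff, Node.cell.injEq, reduceCtorEq, false_or]
    constructor
    · tauto
    · rintro (⟨rfl, rfl, rfl⟩ | h)
      · simp
      · tauto

theorem current_index_cons {p q : List Bool} {a : Bool} (x : Node) :
    Current p q (a :: tp) tq cur x ↔ x = .index (a :: tp) ∨ Current p q tp tq cur x := by
  rcases x with t | ⟨p', t⟩ | ⟨p', s⟩ | ⟨p', q', w⟩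
  · simp only [Current, List.suffix_cons_iff, Node.index.injEq]
    constructor
    · tauto
    · rintro (rfl | h)
      · simp
      · tauto
  · simp [Current]
  · simp [Current]
  · simp [Current]

theorem or_rotate₃ (a b c d e : Prop) : (a ∨ b ∨ c ∨ d ∨ e) ↔ (d ∨ c ∨ b ∨ a ∨ e) := by tauto

theorem or_rotate₄ (a b c d e f : Prop) :
    (a ∨ b ∨ c ∨ d ∨ e ∨ f) ↔ (e ∨ a ∨ d ∨ c ∨ b ∨ f) := by tauto

/-- A digit of a block is stored.  In the first block, whose length defines `K`, the algorithm cannot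
check the length; this is what `hlen` is for. -/
theorem wp_onBit (hf : Frame K bs fresh) (h : Inv K bs fresh zero top cur tp tq m)
    (hr : Ruler K bs first cur.length m) (v : Bool)
    (hlen : first = true → cur.length < K) (hrej : K ≤ cur.length → post .rej)
    (hpost : ∀ zero' top' tp' tq' m', cur.length < K →
      Inv K bs fresh zero' top' (v :: cur) tp' tq' m' →
      Ruler K bs first (cur.length + 1) m' → post (.read (.block first fresh zero' top') m')) :
    wp naming (onBit first fresh zero top v) m post := by
  refine wp_rulerStep hf h hr (fun _ => hrej) fun m hlen' h hr => ?_
  have hlt : cur.length < K := by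
    cases first
    · exact hlen' rfl
    · exact hlen rfl
  obtain ⟨b, hb⟩ := exists_cons_suffix h.tq_suffix (by rw [h.tq_length, length_low]; exact hlt)
  refine wp_walkStep b (w := fun c => .group (high K bs.length) (c :: tq)) h.group
    (fun c => rfl) (by decide) (hf.group_true_mem_iff h hb) (fun ha => by simpa using h.alive _ ha) ?_
  refine wp_down (w := .trie (high K bs.length) ((b, v) :: tq.zip cur))
    (a := .trie (high K bs.length) (tq.zip cur)) (by simp [h.trie]) rfl ?_ ?_
  · rintro (ha | ha)
    · cases ha
    · exact Or.inr (by simpa using h.alive _ ha)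
  refine wp_down (w := .cell (high K bs.length) (low K bs.length) (v :: cur))
    (a := .cell (high K bs.length) (low K bs.length) cur) (by simp [h.tail]) rfl ?_ ?_
  · rintro (ha | ha | ha)
    · cases ha
    · cases ha
    · exact Or.inr (Or.inr (by simpa using h.alive _ ha))
  by_cases hfr : fresh = true
  · obtain ⟨a, ha⟩ := exists_cons_suffix h.tp_suffix (by
      rw [h.tp_length, length_high, if_pos hfr]
      omega)
    rw [if_pos hfr]
    refine wp_walkStep a (a := .index tp) (w := fun c => .index (c :: tp))
      (by simp [h.index hfr])
      (fun c => rfl) (by decide) ?_ ?_ ?_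
    · simpa using index_true_mem_iff hf (fun t => h.edges (.index t)) ha
    · rintro (ha | ha | ha | ha)
      · cases ha
      · cases ha
      · cases ha
      · exact Or.inr (Or.inr (Or.inr (by simpa using h.alive _ ha)))
    refine hpost _ _ (a :: tp) (b :: tq) _ hlt ?_ ⟨hr.first_eq, ?_⟩
    · exact
        { edges := fun x => by
            rw [current_index_cons, current_cons]
            simp only [Set.mem_insert_iff, h.edges]
            exact or_rotate₄ ..
          alive := by
            rintro x (rfl | rfl | rfl | rfl | hx)
            · simp
            · simp
            · simp
            · simp
            · exact (h.alive x hx).imp_left fun hx => Or.inr (Or.inr (Or.inr (Or.inr hx)))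
          tp_suffix := ha
          tq_suffix := hb
          tp_length := by simp [h.tp_length, hfr]
          tq_length := by simp [h.tq_length]
          root := by simpa using h.root
          group := by simp
          trie := by simp
          tail := by simp
          head := by simpa using h.head
          groupRoot := by simpa using h.groupRoot
          index := fun _ => by simp
          zero_eq := by
            cases b
            · simp [aboveZero]
            · simp [aboveZero, h.zero_eq]
          groupMark := by
            intro u hu
            cases b
            · simp only [aboveZero, Option.some.injEq] at hu
              simp [hu]
            · simp [h.groupMark u hu]
          top_eq := by
            cases a
            · have := h.tp_length
              rw [if_pos hfr] at this
              have : tp ≠ [] := by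
                rintro rfl
                simp at this
              simp [aboveZero, this]
            · simp [aboveZero, h.top_eq]
          indexMark := by
            intro u hu
            cases a
            · simp only [aboveZero, Option.some.injEq] at hu
              simp [hu]
            · simp [h.indexMark u hu] }
    · simpa using hr.ruler
  · rw [if_neg hfr]
    refine hpost _ _ tp (b :: tq) _ hlt ?_ ⟨hr.first_eq, ?_⟩
    · exact
        { edges := fun x => by
            rw [current_cons]
            simp only [Set.mem_insert_iff, h.edges]
            exact or_rotate₃ ..
          alive := by
            rintro x (rfl | rfl | rfl | hx)
            · simp
            · simp
            · simp
            · exact (h.alive x hx).imp_left fun hx => Or.inr (Or.inr (Or.inr hx))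
          tp_suffix := h.tp_suffix
          tq_suffix := hb
          tp_length := by simp [h.tp_length, hfr]
          tq_length := by simp [h.tq_length]
          root := by simpa using h.root
          group := by simp
          trie := by simp
          tail := by simp
          head := by simpa using h.head
          groupRoot := by simpa using h.groupRoot
          index := fun h => absurd h hfr
          zero_eq := by
            cases b
            · simp [aboveZero]
            · simp [aboveZero, h.zero_eq]
          groupMark := by
            intro u hu
            cases b
            · simp only [aboveZero, Option.some.injEq] at hu
              simp [hu]
            · simp [h.groupMark u hu]
          top_eq := h.top_eq
          indexMark := by simpa using h.indexMark }
    · simpa using hr.ruler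

/-! ### Reading the end of a block -/

theorem wp_atEnd {r : Fin 11} {k : Code} {p q y b : List Bool} (hr : m.reg r = .cell p q y)
    (hy : y <:+ b) (hm : ∀ d, .cell p q (d :: y) ∈ m.edges ↔ d :: y <:+ b)
    (hrej : y ≠ b → post .rej) (hk : y = b → wp naming k m post) :
    wp naming (atEnd r k) m post := by
  refine wp_test hr rfl (w := .cell p q (false :: y)) (fun h => ?_) (fun h => ?_)
  · refine hrej ?_
    rintro rfl
    exact not_cons_suffix_self ((hm _).1 h)
  · refine wp_test hr rfl (w := .cell p q (true :: y)) (fun h' => ?_) (fun h' => ?_)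
    · refine hrej ?_
      rintro rfl
      exact not_cons_suffix_self ((hm _).1 h')
    · refine hk (hy.eq_of_length_le ?_)
      by_contra hlt
      obtain ⟨c, hc⟩ := exists_cons_suffix hy (by omega)
      cases c
      · exact h ((hm _).2 hc)
      · exact h' ((hm _).2 hc)

/-- The edges that belong to a block when all of it has been read: only its position in the tree
and the position of its group are not yet linked. -/
theorem stored_append (x : Node) :
    Stored (Visited K (bs ++ [cur])) x ↔ Stored (Visited K bs) x ∨
      Current (high K bs.length) (low K bs.length) (high K bs.length) (low K bs.length) cur x ∨
      x = .group (high K bs.length) [] ∨ x = .cell (high K bs.length) (low K bs.length) [] := by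
  rcases x with t | ⟨p', t⟩ | ⟨p', s⟩ | ⟨p', q', w⟩
  · simp only [Stored, Current, visited_append, reduceCtorEq, or_false]
    constructor
    · rintro ⟨h0, p, q, v, h | ⟨rfl, rfl, rfl⟩, ht⟩
      · exact Or.inl ⟨h0, p, q, v, h, ht⟩
      · exact Or.inr ⟨h0, Or.inl ht⟩
    · rintro (⟨h0, p, q, v, h, ht⟩ | ⟨h0, ht⟩)
      · exact ⟨h0, p, q, v, Or.inl h, ht⟩
      · exact ⟨h0, _, _, _, Or.inr ⟨rfl, rfl, rfl⟩, ht.elim id And.left⟩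
  · simp only [Stored, Current, visited_append, reduceCtorEq, or_false, Node.group.injEq]
    constructor
    · rintro ⟨q, v, h | ⟨rfl, rfl, rfl⟩, ht⟩
      · exact Or.inl ⟨q, v, h, ht⟩
      · by_cases h0 : t = []
        · exact Or.inr (Or.inr ⟨rfl, h0⟩)
        · exact Or.inr (Or.inl ⟨rfl, h0, Or.inl ht⟩)
    · rintro (⟨q, v, h, ht⟩ | ⟨rfl, h0, ht⟩ | ⟨rfl, rfl⟩)
      · exact ⟨q, v, Or.inl h, ht⟩
      · exact ⟨_, _, Or.inr ⟨rfl, rfl, rfl⟩, ht.elim id And.left⟩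
      · exact ⟨_, _, Or.inr ⟨rfl, rfl, rfl⟩, List.nil_suffix⟩
  · simp only [Stored, Current, visited_append, reduceCtorEq, or_false]
    constructor
    · rintro ⟨q, v, h | ⟨rfl, rfl, rfl⟩, ht⟩
      · exact Or.inl ⟨q, v, h, ht⟩
      · exact Or.inr ⟨rfl, ht⟩
    · rintro (⟨q, v, h, ht⟩ | ⟨rfl, ht⟩)
      · exact ⟨q, v, Or.inl h, ht⟩
      · exact ⟨_, _, Or.inr ⟨rfl, rfl, rfl⟩, ht⟩
  · simp only [Stored, Current, visited_append, reduceCtorEq, false_or, Node.cell.injEq]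
    constructor
    · rintro ⟨v, h | ⟨rfl, rfl, rfl⟩, ht⟩
      · exact Or.inl ⟨v, h, ht⟩
      · by_cases h0 : w = []
        · exact Or.inr (Or.inr ⟨rfl, rfl, h0⟩)
        · exact Or.inr (Or.inl ⟨rfl, rfl, h0, ht⟩)
    · rintro (⟨v, h, ht⟩ | ⟨rfl, rfl, h0, ht⟩ | ⟨rfl, rfl, rfl⟩)
      · exact ⟨v, Or.inl h, ht⟩
      · exact ⟨_, Or.inr ⟨rfl, rfl, rfl⟩, ht⟩
      · exact ⟨_, Or.inr ⟨rfl, rfl, rfl⟩, List.nil_suffix⟩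

theorem Frame.group_not_stored (hf : Frame K bs true) (t : List Bool) :
    ¬ Stored (Visited K bs) (.group (high K bs.length) t) := by
  rintro ⟨q, v, hv, -⟩
  obtain ⟨i, hi, -, hp, -⟩ := hv.exists_lt
  exact hf.ne rfl i hi hp

theorem Frame.cell_not_stored (hf : Frame K bs fresh) (v : List Bool) :
    ¬ Stored (Visited K bs) (.cell (high K bs.length) (low K bs.length) v) := by
  rintro ⟨w, hw, -⟩
  obtain ⟨i, hi, -, hp, hq⟩ := hw.exists_lt
  have := eq_of_high_eq_of_low_eq (hi.trans hf.lt) hf.lt hp hq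
  omega

/-- The end of a block is checked against the end of the first block, unless it is the first
one itself; then the group, if it is fresh, and the block are linked to their leaves. -/
theorem wp_endBlock (hf : Frame K bs fresh) (h : Inv K bs fresh zero top cur tp tq m)
    (hr : Ruler K bs first cur.length m) {k : Code} (hfirst : first = true → cur.length = K)
    (hrej : cur.length ≠ K → post .rej)
    (hk : ∀ m', cur.length = K → Done K bs cur zero top m' → wp naming k m' post) :
    wp naming (endBlock first fresh k) m post := by
  -- the end of the block is reached at the end of the first block
  suffices key : cur.length = K → ∀ m, Inv K bs fresh zero top cur tp tq m →
      m.reg rRulerHead = .cell (high K 0) (low K 0) [] →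
      wp naming ((if fresh then (.link rIndex .down rGroupRoot ·) else id) <|
        .link rGroup .down rHead k) m post by
    unfold endBlock
    have hfe := hr.first_eq
    rcases bs with _ | ⟨b, bs⟩
    · rw [List.isEmpty_nil] at hfe
      rw [if_pos hfe]
      refine key (hfirst hfe) (m.point rRulerHead (m.reg rHead)) (h.congr rfl ?_ ?_) ?_
      · exact fun x hx => Or.inl hx
      · exact fun r _ hr => Function.update_of_ne hr ..
      · simp [Mem.point, h.head]
    · rw [List.isEmpty_cons] at hfe
      rw [if_neg (by simp [hfe])]
      obtain ⟨h1, y, h2, h3, h4⟩ := hr.ruler b rfl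
      have hlb := hf.len b (by simp)
      refine wp_atEnd h2 h3 (fun d => mem_ruler_iff hf h rfl) (fun hy => ?_) (fun hy => ?_)
      · refine hrej fun hc => hy (h3.eq_of_length ?_)
        omega
      · refine key ?_ m h h1
        rw [← h4, hy, hlb]
  clear h hr
  intro hK m h hhead
  have htq : tq = low K bs.length :=
    h.tq_suffix.eq_of_length (by rw [h.tq_length, length_low, hK])
  have htp : tp = high K bs.length := h.tp_suffix.eq_of_length (by
    rw [h.tp_length, length_high, hK, ite_self])
  subst htq
  have hgroup : ∀ {b}, fresh = b → ((.group (high K bs.length) [] : Node) ∈ m.edges ↔ b = false) := by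
    rintro b rfl
    rw [h.edges]
    constructor
    · rintro (h1 | h1)
      · cases fresh
        · rfl
        · exact absurd h1 (hf.group_not_stored _)
      · exact absurd rfl h1.2.1
    · intro hfr
      obtain ⟨i, hi, hp⟩ := hf.eq hfr
      exact Or.inl ⟨low K i, bs[i], ⟨i, by simp [hi], hp, rfl⟩, List.nil_suffix⟩
  have hcell : (.cell (high K bs.length) (low K bs.length) [] : Node) ∉ m.edges := by
    rw [h.edges]
    rintro (h1 | h1)
    · exact hf.cell_not_stored _ h1
    · exact h1.2.2.1 rfl
  -- the last operation, which links the block when its group has been linked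
  have last : ∀ E : Set Node,
      (∀ x, x ∈ E ↔ x ∈ m.edges ∨ x = .group (high K bs.length) []) →
      wp naming (.link rGroup .down rHead k) ⟨m.reg, E, m.alive⟩ post := by
    intro E hE
    refine ⟨by simp only [h.group, h.head]; rfl, ?_, hk _ hK ?_⟩
    · simp only [h.head, hE]
      simp [hcell]
    · have hedges : ∀ x, x ∈ (Mem.addEdge ⟨m.reg, E, m.alive⟩ (m.reg rHead)).edges ↔
          Stored (Visited K (bs ++ [cur])) x := by
        intro x
        rw [stored_append, h.head]
        simp only [Mem.addEdge, Set.mem_insert_iff, hE, h.edges, htp]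
        constructor
        · rintro (h | (h | h) | h)
          · exact Or.inr (Or.inr (Or.inr h))
          · exact Or.inl h
          · exact Or.inr (Or.inl h)
          · exact Or.inr (Or.inr (Or.inl h))
        · rintro (h | h | h | h)
          · exact Or.inr (Or.inl (Or.inl h))
          · exact Or.inr (Or.inl (Or.inr h))
          · exact Or.inr (Or.inr h)
          · exact Or.inl h
      exact
        { edges := hedges
          alive := by
            intro x hx
            rcases h.alive x hx with h1 | h1 | rfl | rfl
            · exact Or.inl (Or.inr ((hE x).2 (Or.inl h1)))
            · exact Or.inr h1
            · exact Or.inl (Or.inr ((hE _).2 (Or.inr rfl)))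
            · exact Or.inl (Or.inl h.head.symm)
          root := h.root
          groupRoot := h.groupRoot
          zero_eq := h.zero_eq
          groupMark := h.groupMark
          top_eq := htp ▸ h.top_eq
          indexMark := htp ▸ h.indexMark
          rulerHead := hhead }
  cases hfr : fresh
  · refine last m.edges fun x => ?_
    constructor
    · exact Or.inl
    · rintro (hx | rfl)
      · exact hx
      · exact (hgroup hfr).2 rfl
  · refine ⟨by simp only [h.index hfr, h.groupRoot, htp]; rfl, ?_, last _ fun x => ?_⟩
    · rw [h.groupRoot, hgroup hfr]
      simp
    · simp [h.groupRoot, or_comm]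

/-- What has to hold when the algorithm prepares for the block after the blocks `bs`.  The edge to
the trie is counted as present, since it exists already if the group is not fresh. -/
structure Ready (K : ℕ) (bs : List (List Bool)) (tp : List Bool) (m : Mem Node 11) : Prop where
  edges : ∀ x, x ∈ insert (.trie (high K bs.length) []) m.edges ↔ Stored (Visited K bs) x ∨
    Current (high K bs.length) (low K bs.length) tp [] [] x
  root : m.reg rRoot = .index []
  rulerHead : bs ≠ [] → m.reg rRulerHead = .cell (high K 0) (low K 0) []

theorem wp_beginBlock (hf : Frame K bs fresh) (h : Ready K bs tp m)
    (halive : ∀ x ∈ m.alive, x ∈ m.edges ∨ x = .index [] ∨ x = .group (high K bs.length) [])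
    (htp : tp <:+ high K bs.length) (hlen : tp.length = if fresh then 1 else K + 1)
    (hroot : m.reg rGroupRoot = .group (high K bs.length) [])
    (hindex : fresh = true → m.reg rIndex = .index tp)
    (htop : top = (aboveZero tp).map List.isEmpty)
    (hmark : ∀ u, aboveZero tp = some u → m.reg rIndexMark = .index u)
    (hfirst : first = bs.isEmpty)
    (hpost : ∀ m', Inv K bs fresh false top [] tp [] m' → Ruler K bs first 0 m' →
      post (.read (.block first fresh false top) m')) :
    wp naming (beginBlock first fresh top) m post := by
  have hcell : (.cell (high K bs.length) (low K bs.length) [] : Node) ∉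
      insert (.trie (high K bs.length) []) m.edges := by
    rw [h.edges]
    rintro (h1 | h1)
    · exact hf.cell_not_stored _ h1
    · exact h1.2.2.1 rfl
  have hcell' : (.cell (high K bs.length) (low K bs.length) [] : Node) ∉
      insert (.trie (high K bs.length) []) m.alive := by
    rintro (h1 | h1)
    · cases h1
    · exact hcell (Or.inr (by simpa using halive _ h1))
  refine wp_down (a := .group (high K bs.length) []) (w := .trie (high K bs.length) [])
    (by simp [Mem.point, hroot]) rfl
    (fun ha => by simpa [Mem.point] using halive _ ha) ?_
  refine ⟨.cell (high K bs.length) (low K bs.length) [], hcell', hpost _ ?_ ?_⟩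
  · exact
      { edges := h.edges
        alive := by
          rintro x (rfl | rfl | hx)
          · simp
          · exact Or.inl (Or.inl rfl)
          · rcases halive x hx with h1 | h1 | h1
            · exact Or.inl (Or.inr h1)
            · exact Or.inr (Or.inl h1)
            · exact Or.inr (Or.inr (Or.inl h1))
        tp_suffix := htp
        tq_suffix := List.nil_suffix
        tp_length := hlen
        tq_length := rfl
        root := by simpa [Mem.point, Mem.create] using h.root
        group := by simpa [Mem.point, Mem.create] using hroot
        trie := by simp [Mem.point, Mem.create]
        tail := by simp [Mem.point, Mem.create]
        head := by simp [Mem.point, Mem.create]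
        groupRoot := by simpa [Mem.point, Mem.create] using hroot
        index := by simpa [Mem.point, Mem.create] using hindex
        zero_eq := rfl
        groupMark := fun u hu => by cases hu
        top_eq := htop
        indexMark := by simpa [Mem.point, Mem.create] using hmark }
  · refine ⟨hfirst, fun b hb => ?_⟩
    have hne : bs ≠ [] := by
      rintro rfl
      simp at hb
    have := h.rulerHead hne
    exact ⟨by simpa [Mem.point, Mem.create] using this, [],
      by simpa [Mem.point, Mem.create] using this, List.nil_suffix, rfl⟩

theorem wp_beginGroup (hf : Frame K bs true) (h : Ready K bs [] m)
    (halive : ∀ x ∈ m.alive, x ∈ m.edges ∨ x = .index [])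
    (hfirst : first = bs.isEmpty)
    (hpost : ∀ top tp m', Inv K bs true false top [] tp [] m' → Ruler K bs first 0 m' →
      post (.read (.block first true false top) m')) :
    wp naming (beginGroup first) m post := by
  have hE : ∀ t, .index t ∈ m.edges ↔ Stored (Visited K bs) (.index t) ∨
      Current (high K bs.length) (low K bs.length) [] [] [] (.index t) := by
    intro t
    rw [← h.edges]
    simp
  have hgroup : (.group (high K bs.length) [] : Node) ∉ m.alive := by
    intro h1
    have h2 : (.group (high K bs.length) [] : Node) ∈
        insert (.trie (high K bs.length) []) m.edges := Or.inr (by simpa using halive _ h1)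
    rw [h.edges] at h2
    rcases h2 with h2 | h2
    · exact hf.group_not_stored _ h2
    · exact h2.2.1 rfl
  refine ⟨.group (high K bs.length) [], hgroup, ?_⟩
  obtain ⟨a, ha⟩ := exists_cons_suffix (t := []) (l := high K bs.length) List.nil_suffix (by
    simp [length_high])
  refine wp_move rfl ?_
  refine wp_walkStep a (a := .index []) (w := fun c => .index [c])
    (by simp [Mem.point, Mem.create, h.root]) (fun c => rfl) (by decide) ?_ ?_ ?_
  · exact index_true_mem_iff hf hE ha
  · rintro (h1 | h1)
    · cases h1
    · simpa [Mem.point, Mem.create] using halive _ h1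
  refine wp_beginBlock (tp := [a]) hf ⟨?_, ?_, ?_⟩ ?_ ha rfl ?_ ?_ ?_ ?_ hfirst (hpost _ _)
  · intro x
    rw [current_index_cons]
    simp only [Mem.point, Mem.create, Set.mem_insert_iff]
    have := h.edges x
    rw [Set.mem_insert_iff] at this
    rw [or_left_comm, this, or_left_comm]
  · simpa [Mem.point, Mem.create] using h.root
  · simpa [Mem.point, Mem.create] using h.rulerHead
  · rintro x (rfl | rfl | hx)
    · exact Or.inl (Or.inl rfl)
    · exact Or.inr (Or.inr rfl)
    · rcases halive x hx with h1 | h1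
      · exact Or.inl (Or.inr h1)
      · exact Or.inr (Or.inl h1)
  · simp [Mem.point, Mem.create]
  · simp
  · cases a <;> rfl
  · intro u hu
    cases a
    · simp only [aboveZero, Option.some.injEq] at hu
      simp [hu]
    · cases hu

theorem suffix_of_aboveZero {l u : List Bool} (h : aboveZero l = some u) : false :: u <:+ l := by
  induction l with
  | nil => cases h
  | cons b l ih =>
    cases b
    · simp only [aboveZero, Option.some.injEq] at h
      rw [h]
    · exact (ih h).trans (List.suffix_cons _ _)

theorem head_eq_true_iff {t : List Bool} : t.head? = some true ↔ ∃ t', t = true :: t' := by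
  cases t <;> simp

theorem Frame.append_of_zero (hf : Frame K bs fresh) (hc : cur.length = K) {u : List Bool}
    (hu : aboveZero (low K bs.length) = some u) : Frame K (bs ++ [cur]) false where
  lt := by
    have hne : bs.length + 1 ≠ 2 ^ (2 * K + 1) := by
      intro h
      have : aboveZero (low K bs.length) = none := by
        rw [low, aboveZero_digits_eq_none, h, show 2 * K + 1 = K + (K + 1) by omega, Nat.pow_add,
          Nat.mul_mod_right]
      rw [this] at hu
      cases hu
    have := hf.lt
    rw [List.length_append, List.length_singleton]
    omega
  len := by
    intro b hb
    rcases List.mem_append.1 hb with hb | hb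
    · exact hf.len b hb
    · rwa [List.mem_singleton.1 hb]
  ne := by simp
  eq _ := ⟨bs.length, by simp, by simp [high_succ hu]⟩

theorem Frame.append_of_no_zero (hf : Frame K bs fresh) (hc : cur.length = K)
    (hu : aboveZero (low K bs.length) = none) (hlt : bs.length + 1 < 2 ^ (2 * K + 1)) :
    Frame K (bs ++ [cur]) true where
  lt := by simpa using hlt
  len := by
    intro b hb
    rcases List.mem_append.1 hb with hb | hb
    · exact hf.len b hb
    · rwa [List.mem_singleton.1 hb]
  ne := by
    intro _ i hi
    rw [List.length_append, List.length_singleton] at hi ⊢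
    exact high_succ_ne hlt hu hi
  eq := by simp

/-- The next block is in the same group.  Its number arises from the current one at the last `0` of
`q`, where the edge to the right is created. -/
theorem Done.ready_of_zero (h : Done K bs cur zero top m) {u : List Bool}
    (hu : aboveZero (low K bs.length) = some u) :
    Ready K (bs ++ [cur]) (high K bs.length)
      ⟨Function.update m.reg rGroupMark (.group (high K bs.length) (true :: u)),
        insert (.group (high K bs.length) (true :: u)) m.edges,
        insert (.group (high K bs.length) (true :: u)) m.alive⟩ where
  edges x := by
    have hp : high K (bs.length + 1) = high K bs.length := high_succ hu
    simp only [Set.mem_insert_iff, h.edges, List.length_append, List.length_singleton, hp]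
    have hv : ∀ {p q v}, high K bs.length = p → low K bs.length = q → v = cur →
        Visited K (bs ++ [cur]) p q v := fun h1 h2 h3 => visited_append.2 (Or.inr ⟨h1, h2, h3⟩)
    rcases x with t | ⟨p', t⟩ | ⟨p', s⟩ | ⟨p', q', w⟩
    · simp only [reduceCtorEq, false_or, Current]
      constructor
      · exact Or.inl
      · rintro (h1 | ⟨h1, h2⟩)
        · exact h1
        · exact ⟨h1, _, _, _, hv rfl rfl rfl, h2.elim id And.left⟩
    · simp only [reduceCtorEq, false_or, Current, Node.group.injEq, head_eq_true_iff]
      constructor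
      · rintro (⟨rfl, rfl⟩ | h1)
        · exact Or.inr ⟨rfl, by simp, Or.inr ⟨suffix_digits_succ hu, u, rfl⟩⟩
        · exact Or.inl h1
      · rintro (h1 | ⟨rfl, h1, h2 | ⟨h2, t', rfl⟩⟩)
        · exact Or.inr h1
        · exact absurd (List.suffix_nil.1 h2) h1
        · rcases suffix_of_suffix_digits_succ h2 with h3 | h3
          · cases hu.symm.trans h3
            exact Or.inl ⟨rfl, rfl⟩
          · exact Or.inr ⟨_, _, hv rfl rfl rfl, h3⟩
    · simp only [reduceCtorEq, false_or, Current, Node.trie.injEq, List.zip_nil_right,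
        List.suffix_nil]
      tauto
    · simp only [reduceCtorEq, false_or, Current]
      constructor
      · exact Or.inl
      · rintro (h1 | ⟨-, -, h1, h2⟩)
        · exact h1
        · exact absurd (List.suffix_nil.1 h2) h1
  root := by simpa using h.root
  rulerHead _ := by simpa using h.rulerHead

/-- The next block is the first one of the next group, whose leaf is reached by an edge to the right
from the last `0` of `p`. -/
theorem Done.ready_of_no_zero (h : Done K bs cur zero top m) {u : List Bool}
    (hu : aboveZero (low K bs.length) = none) (hu' : aboveZero (high K bs.length) = some u) :
    Ready K (bs ++ [cur]) []
      ⟨Function.update m.reg rIndexMark (.index (true :: u)),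
        insert (.index (true :: u)) m.edges, insert (.index (true :: u)) m.alive⟩ where
  edges x := by
    have hp : high K (bs.length + 1) = digits (K + 1) (bs.length / 2 ^ K + 1) := by
      rw [high, div_succ_of_aboveZero_eq_none hu]
    simp only [Set.mem_insert_iff, h.edges, List.length_append, List.length_singleton, hp]
    have hv : ∀ {p q v}, high K bs.length = p → low K bs.length = q → v = cur →
        Visited K (bs ++ [cur]) p q v := fun h1 h2 h3 => visited_append.2 (Or.inr ⟨h1, h2, h3⟩)
    rcases x with t | ⟨p', t⟩ | ⟨p', s⟩ | ⟨p', q', w⟩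
    · simp only [reduceCtorEq, false_or, Current, Node.index.injEq, head_eq_true_iff]
      constructor
      · rintro (rfl | h1)
        · exact Or.inr ⟨by simp, Or.inr ⟨suffix_digits_succ hu', u, rfl⟩⟩
        · exact Or.inl h1
      · rintro (h1 | ⟨h1, h2 | ⟨h2, t', rfl⟩⟩)
        · exact Or.inr h1
        · exact absurd (List.suffix_nil.1 h2) h1
        · rcases suffix_of_suffix_digits_succ h2 with h3 | h3
          · cases hu'.symm.trans h3
            exact Or.inl rfl
          · exact Or.inr ⟨by simp, _, _, _, hv rfl rfl rfl, h3⟩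
    · simp only [reduceCtorEq, false_or, Current, head_eq_true_iff]
      constructor
      · exact Or.inl
      · rintro (h1 | ⟨rfl, h1, h2 | ⟨h2, t', rfl⟩⟩)
        · exact h1
        · exact absurd (List.suffix_nil.1 h2) h1
        · exact absurd h2 (not_suffix_of_aboveZero_eq_none hu t')
    · simp only [reduceCtorEq, false_or, Current, Node.trie.injEq, List.zip_nil_right,
        List.suffix_nil]
      tauto
    · simp only [reduceCtorEq, false_or, Current]
      constructor
      · exact Or.inl
      · rintro (h1 | ⟨-, -, h1, h2⟩)
        · exact h1
        · exact absurd (List.suffix_nil.1 h2) h1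
  root := by simpa using h.root
  rulerHead _ := by simpa using h.rulerHead

theorem wp_onSep (hf : Frame K bs fresh) (h : Inv K bs fresh zero top cur tp tq m)
    (hr : Ruler K bs first cur.length m) (hfirst : first = true → cur.length = K)
    (hrej : cur.length ≠ K ∨ bs.length + 1 = 2 ^ (2 * K + 1) → post .rej)
    (hpost : ∀ fresh' top' tp' m', cur.length = K → Frame K (bs ++ [cur]) fresh' →
      Inv K (bs ++ [cur]) fresh' false top' [] tp' [] m' → Ruler K (bs ++ [cur]) false 0 m' →
      post (.read (.block false fresh' false top') m')) :
    wp naming (onSep first fresh zero top) m post := by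
  refine wp_endBlock hf h hr hfirst (fun hc => hrej (Or.inl hc)) fun m hc h => ?_
  have hne : false = (bs ++ [cur]).isEmpty := by simp
  cases hu : aboveZero (low K bs.length) with
  | some u =>
    have hp : high K (bs ++ [cur]).length = high K bs.length := by simp [high_succ hu]
    rw [if_pos (by rw [h.zero_eq, hu]; rfl)]
    refine wp_down (h.groupMark u hu) rfl (fun ha => by simpa using h.alive _ ha) ?_
    refine wp_beginBlock (tp := high K bs.length) (hf.append_of_zero hc hu) (h.ready_of_zero hu)
      ?_ (by rw [hp]) (length_high _ _) (by simpa [hp, high_succ hu] using h.groupRoot) (by simp)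
      h.top_eq (by simpa using h.indexMark) hne
      fun m' => hpost _ _ _ m' hc (hf.append_of_zero hc hu)
    rintro x (rfl | hx)
    · exact Or.inl (Or.inl rfl)
    · exact (h.alive x hx).imp Or.inr Or.inl
  | none =>
    rw [if_neg (by rw [h.zero_eq, hu]; simp)]
    cases hu' : aboveZero (high K bs.length) with
    | none =>
      rw [if_pos (by rw [h.top_eq, hu']; rfl)]
      exact hrej (Or.inr ((aboveZero_high_eq_none hf.lt hu).1 hu'))
    | some u =>
      rw [if_neg (by rw [h.top_eq, hu']; simp)]
      have hlt : bs.length + 1 < 2 ^ (2 * K + 1) := by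
        have hlt := hf.lt
        have : ¬ bs.length + 1 = 2 ^ (2 * K + 1) := by
          rw [← aboveZero_high_eq_none hf.lt hu, hu']
          simp
        omega
      have hf' := hf.append_of_no_zero hc hu hlt
      refine wp_down (h.indexMark u hu') rfl (fun ha => by simpa using h.alive _ ha) ?_
      refine wp_beginGroup hf' (h.ready_of_no_zero hu hu') ?_ hne
        fun top tp m' => hpost _ _ _ m' hc hf'
      rintro x (rfl | hx)
      · exact Or.inl (Or.inl rfl)
      · exact (h.alive x hx).imp_left Or.inr

theorem wp_onHash (hf : Frame K bs fresh) (h : Inv K bs fresh zero top cur tp tq m)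
    (hr : Ruler K bs first cur.length m) (hfirst : first = true → cur.length = K)
    (hrej : cur.length ≠ K ∨ bs.length + 1 ≠ 2 ^ (2 * K) ∧ bs.length + 1 ≠ 2 ^ (2 * K + 1) →
      post .rej)
    (hpost : ∀ s m', cur.length = K →
      (bs.length + 1 = 2 ^ (2 * K + 1) ∧ s = [] ∨ bs.length + 1 = 2 ^ (2 * K) ∧ s = [false]) →
      (∀ x, x ∈ m'.edges ↔ Stored (Visited K (bs ++ [cur])) x) → m'.reg rIndex = .index s →
      m'.reg rGroup = .index s → post (.read (.left false) m')) :
    wp naming (onHash first fresh zero top) m post := by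
  refine wp_endBlock hf h hr hfirst (fun hc => hrej (Or.inl hc)) fun m hc h => ?_
  have hdvd : bs.length + 1 = 2 ^ (2 * K) ∨ bs.length + 1 = 2 ^ (2 * K + 1) →
      aboveZero (low K bs.length) = none := by
    rw [low, aboveZero_digits_eq_none]
    rintro (h | h) <;> rw [h]
    · rw [two_mul, Nat.pow_add, Nat.mul_mod_right]
    · rw [show 2 * K + 1 = K + (K + 1) by omega, Nat.pow_add, Nat.mul_mod_right]
  have htop := h.top_eq
  cases hu : aboveZero (low K bs.length) with
  | some u =>
    rw [if_pos (by rw [h.zero_eq, hu]; rfl)]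
    refine hrej (Or.inr ?_)
    rw [← not_or]
    intro h
    cases hu.symm.trans (hdvd h)
  | none =>
    have hz : zero = false := by rw [h.zero_eq, hu]; rfl
    have h1 := aboveZero_high_eq_none hf.lt hu
    have h2 := aboveZero_high_eq_nil hf.lt hu
    rcases hu' : aboveZero (high K bs.length) with _ | _ | ⟨b, u⟩
    · rw [hu'] at htop h1
      subst htop hz
      refine wp_move h.root (wp_move (a := .index []) (by simp [Mem.point]) ?_)
      exact hpost [] _ hc (Or.inl ⟨h1.1 rfl, rfl⟩) h.edges (by simp [Mem.point])
        (by simp [Mem.point])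
    · rw [hu'] at htop h2
      subst htop hz
      have hmem : (.index [false] : Node) ∈ m.edges := by
        rw [h.edges]
        exact ⟨by simp, _, _, _, visited_append.2 (Or.inr ⟨rfl, rfl, rfl⟩),
          suffix_of_aboveZero hu'⟩
      refine wp_move h.root (wp_down (a := .index []) (w := .index [false]) (by simp [Mem.point])
        rfl (fun _ => hmem) (wp_move (a := .index [false]) (by simp) ?_))
      refine hpost [false] _ hc (Or.inr ⟨h2.1 rfl, rfl⟩) ?_ (by simp [Mem.point])
        (by simp [Mem.point])
      intro x
      rw [← h.edges]
      simp only [Mem.point, Set.insert_eq_of_mem hmem]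
    · rw [hu'] at htop h1 h2
      subst htop hz
      refine hrej (Or.inr ⟨?_, ?_⟩)
      · exact fun h => by simpa using h2.2 h
      · exact fun h => by simpa using h1.2 h

end Shvachko

namespace Shvachko

open Forest

/-! ### Reading the two indices -/

/-- A table of blocks `v` of length `K` under the numbers `q ++ p` of length `2K + 1`. -/
structure Table (K : ℕ) (R : List Bool → List Bool → List Bool → Prop) : Prop where
  length_high : ∀ {p q v}, R p q v → p.length = K + 1
  length_low : ∀ {p q v}, R p q v → q.length = K
  length_block : ∀ {p q v}, R p q v → v.length = K
  unique : ∀ {p q v w}, R p q v → R p q w → v = w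

/-- The block `v` has the number `z`. -/
def Entry (R : List Bool → List Bool → List Bool → Prop) (z v : List Bool) : Prop :=
  ∃ p q, z = q ++ p ∧ R p q v

/-- The word `u` completes the part `Y` of the second index such that its block is `v`. -/
def GoodRight (R : List Bool → List Bool → List Bool → Prop) (v Y : List Bool) (u : List Symb) :
    Prop :=
  ∃ y, u = word y ++ [.hash] ∧ Entry R (y.reverse ++ Y) v

/-- The word `u` completes the part `X` of the first index and adds a second index such that the two
have the same block.  Both begin with the digits `s`. -/
def GoodLeft (R : List Bool → List Bool → List Bool → Prop) (s X : List Bool) (u : List Symb) :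
    Prop :=
  ∃ x v u', u = word x ++ .hash :: u' ∧ Entry R (x.reverse ++ X) v ∧ GoodRight R v s u'

variable {K : ℕ} {R : List Bool → List Bool → List Bool → Prop} {m : Mem Node 11}
  {post : Outcome Node 11 Ctrl → Prop}

theorem Table.entry_append (hR : Table K R) {p q v : List Bool} (hp : p.length = K + 1) :
    Entry R (q ++ p) v ↔ R p q v := by
  constructor
  · rintro ⟨p', q', h, hr⟩
    obtain ⟨rfl, rfl⟩ := List.append_inj' h (by rw [hp, hR.length_high hr])
    exact hr
  · exact fun h => ⟨p, q, rfl, h⟩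

theorem Table.length_entry (hR : Table K R) {z v : List Bool} (h : Entry R z v) :
    z.length = K + (K + 1) := by
  obtain ⟨p, q, rfl, hr⟩ := h
  rw [List.length_append, hR.length_high hr, hR.length_low hr]

theorem goodRight_bit {v Y : List Bool} {b : Bool} {u : List Symb} :
    GoodRight R v Y (.bit b :: u) ↔ GoodRight R v (b :: Y) u := by
  constructor
  · rintro ⟨_ | ⟨c, y⟩, h, hy⟩
    · simp [word] at h
    · simp only [word, List.map_cons, List.cons_append, List.cons.injEq, Symb.bit.injEq] at h
      obtain ⟨rfl, rfl⟩ := h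
      exact ⟨y, rfl, by simpa using hy⟩
  · rintro ⟨y, rfl, hy⟩
    exact ⟨b :: y, by simp [word], by simpa using hy⟩

theorem goodRight_hash {v Y : List Bool} {u : List Symb} :
    GoodRight R v Y (.hash :: u) ↔ u = [] ∧ Entry R Y v := by
  constructor
  · rintro ⟨_ | ⟨c, y⟩, h, hy⟩
    · simp only [word, List.map_nil, List.nil_append, List.cons.injEq, true_and] at h
      exact ⟨h, hy⟩
    · simp [word] at h
  · rintro ⟨rfl, hy⟩
    exact ⟨[], rfl, hy⟩

theorem not_goodRight_sep {v Y : List Bool} {u : List Symb} :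
    ¬ GoodRight R v Y (.sep :: u) := by
  rintro ⟨_ | ⟨c, y⟩, h, -⟩ <;> simp [word] at h

theorem not_goodRight_nil {v Y : List Bool} : ¬ GoodRight R v Y [] := by
  rintro ⟨y, h, -⟩
  simp at h

theorem goodLeft_bit {s X : List Bool} {b : Bool} {u : List Symb} :
    GoodLeft R s X (.bit b :: u) ↔ GoodLeft R s (b :: X) u := by
  constructor
  · rintro ⟨_ | ⟨c, x⟩, v, u', h, hx⟩
    · simp [word] at h
    · simp only [word, List.map_cons, List.cons_append, List.cons.injEq, Symb.bit.injEq] at h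
      obtain ⟨rfl, rfl⟩ := h
      exact ⟨x, v, u', rfl, by simpa using hx⟩
  · rintro ⟨x, v, u', rfl, hx⟩
    exact ⟨b :: x, v, u', by simp [word], by simpa using hx⟩

theorem goodLeft_hash {s X : List Bool} {u : List Symb} :
    GoodLeft R s X (.hash :: u) ↔ ∃ v, Entry R X v ∧ GoodRight R v s u := by
  constructor
  · rintro ⟨_ | ⟨c, x⟩, v, u', h, hx⟩
    · simp only [word, List.map_nil, List.nil_append, List.cons.injEq, true_and] at h
      obtain rfl := h
      exact ⟨v, hx⟩
    · simp [word] at h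
  · rintro ⟨v, hx⟩
    exact ⟨[], v, u, rfl, hx⟩

theorem not_goodLeft_sep {s X : List Bool} {u : List Symb} :
    ¬ GoodLeft R s X (.sep :: u) := by
  rintro ⟨_ | ⟨c, y⟩, v, u', h, -⟩ <;> simp [word] at h

theorem not_goodLeft_nil {s X : List Bool} : ¬ GoodLeft R s X [] := by
  rintro ⟨x, v, u', h, -⟩
  simp at h

theorem wp_advance {f : Label} {c : Ctrl} {a w : Node} (hr : m.reg rGroup = a)
    (hw : a.child f = some w) (hrej : w ∉ m.edges → post .rej)
    (hpost : w ∈ m.edges →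
      post (.read c ⟨Function.update m.reg rGroup w, m.edges, insert w m.alive⟩)) :
    wp naming (advance f c) m post := by
  refine wp_test hr hw (fun h => wp_down hr hw (fun _ => h) ?_) hrej
  rw [Set.insert_eq_of_mem h]
  exact hpost h

/-- The position that belongs to the part `X` of an index: in the tree of the groups, or
after the leaf `p` in what is given by `node`. -/
def At (K : ℕ) (R : List Bool → List Bool → List Bool → Prop)
    (node : List Bool → List Bool → Node) (past : Bool) (X : List Bool) (x : Node) : Prop :=
  if past then ∃ p t, X = t ++ p ∧ p.length = K + 1 ∧ x = node p t
  else x = .index X ∧ ∃ p q v, R p q v ∧ X <:+ p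

theorem Table.at_cross (hR : Table K R) {node : List Bool → List Bool → Node} {X : List Bool}
    {x : Node} (h : At K R node false X x) :
    Stored R (.group X []) ↔ X.length = K + 1 := by
  obtain ⟨-, p, q, v, hr, hs⟩ := h
  constructor
  · rintro ⟨q', v', hr', -⟩
    exact hR.length_high hr'
  · intro hl
    rw [hs.eq_of_length (by rw [hl, hR.length_high hr])]
    exact ⟨q, v, hr, List.nil_suffix⟩

theorem Table.at_length_le (hR : Table K R) {node : List Bool → List Bool → Node} {X : List Bool}
    {x : Node} (h : At K R node false X x) : X.length ≤ K + 1 := by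
  obtain ⟨-, p, q, v, hr, hs⟩ := h
  rw [← hR.length_high hr]
  exact hs.length_le

/-- A leaf of the tree of the groups is recognized by its edge `down`. -/
theorem wp_cross (hR : Table K R) (hE : ∀ x, x ∈ m.edges ↔ Stored R x) {past : Bool}
    {X : List Bool} (h : At K R .group past X (m.reg rGroup)) {k : Bool → Code}
    (hk : ∀ past' g A, At K R .group past' X g → (past' = false → X.length < K + 1) →
      wp naming (k past') ⟨Function.update m.reg rGroup g, m.edges, A⟩ post) :
    wp naming (cross past k) m post := by
  cases past
  · refine wp_test h.1 rfl (w := .group X []) (fun hm => ?_) (fun hm => ?_)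
    · refine wp_down h.1 rfl (fun _ => hm) ?_
      rw [Set.insert_eq_of_mem hm]
      rw [hE, hR.at_cross h] at hm
      exact hk _ _ _ ⟨X, [], rfl, hm, rfl⟩ (by simp)
    · rw [hE, hR.at_cross h] at hm
      have := hk false (m.reg rGroup) m.alive h fun _ =>
        lt_of_le_of_ne (hR.at_length_le h) hm
      rwa [Function.update_eq_self] at this
  · have := hk true (m.reg rGroup) m.alive h (by simp)
    rwa [Function.update_eq_self] at this

/-- The position that belongs to the part `Y` of the second index, when the part `c` of the block of
the first index has been compared. -/
def AtTrie (K : ℕ) (R : List Bool → List Bool → List Bool → Prop) (past : Bool) (c Y : List Bool)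
    (x : Node) : Prop :=
  if past then ∃ p t, Y = t ++ p ∧ p.length = K + 1 ∧ t.length = c.length ∧
    x = .trie p (t.zip c) ∧ Stored R x
  else c = [] ∧ At K R .group false Y x

theorem wp_crossTrie (hR : Table K R) (hE : ∀ x, x ∈ m.edges ↔ Stored R x) {past : Bool}
    {c Y : List Bool} (h : AtTrie K R past c Y (m.reg rGroup)) {k : Bool → Code}
    (hk : ∀ past' g A, AtTrie K R past' c Y g → (past' = false → Y.length < K + 1) →
      wp naming (k past') ⟨Function.update m.reg rGroup g, m.edges, A⟩ post) :
    wp naming (crossTrie past k) m post := by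
  cases past
  · obtain ⟨rfl, h⟩ := h
    refine wp_test h.1 rfl (w := .group Y []) (fun hm => ?_) (fun hm => ?_)
    · have ht : Stored R (.trie Y []) := by
        obtain ⟨q, v, hr, -⟩ := (hE _).1 hm
        exact ⟨q, v, hr, List.nil_suffix⟩
      have ht' := (hE _).2 ht
      refine wp_down h.1 rfl (fun _ => hm) ?_
      refine wp_down (a := .group Y []) (w := .trie Y []) (by simp) rfl
        (fun _ => Set.mem_insert_of_mem _ ht') ?_
      rw [Set.insert_eq_of_mem hm, Set.insert_eq_of_mem ht']
      rw [hE, hR.at_cross h] at hm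
      simpa using hk true (.trie Y []) (insert (.trie Y []) (insert (.group Y []) m.alive))
        ⟨Y, [], rfl, hm, rfl, rfl, ht⟩ (by simp)
    · rw [hE, hR.at_cross h] at hm
      have := hk false (m.reg rGroup) m.alive ⟨rfl, h⟩ fun _ =>
        lt_of_le_of_ne (hR.at_length_le h) hm
      rwa [Function.update_eq_self] at this
  · have := hk true (m.reg rGroup) m.alive h (by simp)
    rwa [Function.update_eq_self] at this

/-- Among the entries whose numbers end in `X`, those with the digit `b` before it give rise to the
edge from `index X` in the direction `b`. -/
theorem Table.suffix_of_entry (hR : Table K R) {z X v : List Bool} (hX : X.length ≤ K + 1)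
    (h : Entry R (z ++ X) v) : ∃ p q, R p q v ∧ X <:+ p := by
  obtain ⟨p, q, he, hr⟩ := h
  refine ⟨p, q, hr, List.suffix_of_suffix_length_le (l₃ := z ++ X) (List.suffix_append _ _) ?_ ?_⟩
  · exact he ▸ List.suffix_append _ _
  · rwa [hR.length_high hr]

theorem decides_final {m : Mem Node 11} {u : List Symb} {P : Prop} (hP : P ↔ u = []) :
    algorithm.Decides naming .final m u P := by
  refine Algorithm.Decides.of_wp ?_
  cases u with
  | nil => exact hP.2 rfl
  | cons a u => exact fun h => by simpa using hP.1 h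

/-- Pairs of digits are stored in the trie along the number and the block. -/
theorem zip_suffix_zip {z t y c : List Bool} (h : (z ++ t).length = (y ++ c).length)
    (ht : t.length = c.length) : t.zip c <:+ (z ++ t).zip (y ++ c) := by
  rw [List.zip_append (by simp at h; omega)]
  exact List.suffix_append _ _

theorem Table.cell_mem_iff (hR : Table K R) (hE : ∀ x, x ∈ m.edges ↔ Stored R x)
    {p q w c : List Bool} (hw : R p q w) : .cell p q c ∈ m.edges ↔ c <:+ w := by
  rw [hE]
  constructor
  · rintro ⟨w', hw', h⟩
    rwa [hR.unique hw hw']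
  · exact fun h => ⟨w, hw, h⟩

/-- The path through the trie that belongs to a number and to the block `w` has its full length
exactly if `w` is the block of this number. -/
theorem Table.stored_trie_iff (hR : Table K R) {p t w : List Bool} (ht : t.length = K)
    (hw : w.length = K) : Stored R (.trie p (t.zip w)) ↔ R p t w := by
  constructor
  · rintro ⟨q, v, hr, hs⟩
    have hq := hR.length_low hr
    have hv := hR.length_block hr
    have he := hs.eq_of_length (by simp [ht, hw, hq, hv])
    have h1 := congrArg (List.map Prod.fst) he
    have h2 := congrArg (List.map Prod.snd) he
    rw [List.map_fst_zip (by omega), List.map_fst_zip (by omega)] at h1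
    rw [List.map_snd_zip (by omega), List.map_snd_zip (by omega)] at h2
    rwa [h1, h2]
  · exact fun h => ⟨t, w, h, List.suffix_refl _⟩

/-- The second index is followed in the trie together with the block `w` of the first index, as soon as
its group has been reached.  The path exists to its end exactly if `w` is the block of the second
index as well. -/
theorem decides_right (hR : Table K R) {px qx w : List Bool} (hw : R px qx w) (u : List Symb) :
    ∀ (m : Mem Node 11) (past : Bool) (Y c : List Bool), (∀ x, x ∈ m.edges ↔ Stored R x) →
      m.reg rTail = .cell px qx c → c <:+ w → AtTrie K R past c Y (m.reg rGroup) →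
      algorithm.Decides naming (.right past) m u (GoodRight R w Y u) := by
  induction u with
  | nil => exact fun m past Y c _ _ _ _ => Algorithm.Decides.of_wp not_goodRight_nil
  | cons a u ih =>
    intro m past Y c hE htail hc h
    refine Algorithm.Decides.of_wp ?_
    have hwl := hR.length_block hw
    rcases a with b | _ | _
    · simp only [goodRight_bit, List.head?_cons, List.tail_cons]
      simp only [algorithm, onRight]
      refine wp_crossTrie hR hE h fun past' g A h hlt => ?_
      cases past'
      · obtain ⟨rfl, rfl, p, q, v, hr, hs⟩ := h
        have hlt := hlt rfl
        refine wp_advance (a := .index Y) (by simp) rfl (fun hm hg => hm ?_) (fun hm => ?_)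
        · obtain ⟨z, -, hz⟩ := hg
          obtain ⟨p, q, hr, hs⟩ := hR.suffix_of_entry (by simpa using hlt) hz
          exact (hE _).2 ⟨by simp, p, q, w, hr, hs⟩
        · obtain ⟨-, p, q, v, hr, hs⟩ := (hE _).1 hm
          refine ih _ _ _ [] hE (by simpa using htail) hc ⟨rfl, by simp, p, q, v, hr, hs⟩
      · obtain ⟨p, t, rfl, hp, ht, rfl, hst⟩ := h
        have hstep : ∀ d : Bool, .cell px qx (d :: c) ∈ m.edges →
            wp naming (.down rTail (.bit d) (advance (.pair b d) (.right true)))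
              ⟨Function.update m.reg rGroup (.trie p (t.zip c)), m.edges, A⟩
              (algorithm.Verdict naming u (GoodRight R w (b :: (t ++ p)) u)) := by
          intro d hd
          have hdc := (hR.cell_mem_iff hE hw).1 hd
          refine wp_down (a := .cell px qx c) (by simpa using htail) rfl (fun _ => hd) ?_
          simp only [Set.insert_eq_of_mem hd]
          refine wp_advance (a := .trie p (t.zip c)) (by simp) rfl (fun hm hg => hm ?_)
            (fun hm => ?_)
          · obtain ⟨z, -, hz⟩ := hg
            rw [show z.reverse ++ b :: (t ++ p) = (z.reverse ++ b :: t) ++ p by simp,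
              hR.entry_append hp] at hz
            obtain ⟨y, rfl⟩ := hdc
            exact (hE _).2 ⟨_, _, hz, zip_suffix_zip (z := z.reverse) (t := b :: t) (y := y) (c := d :: c)
              (by rw [hR.length_low hz, hwl]) (by simp [ht])⟩
          · exact ih _ _ _ (d :: c) hE (by simp) hdc
              ⟨p, b :: t, by simp, hp, by simp [ht], by simp, by simpa using (hE _).1 hm⟩
        refine wp_test (a := .cell px qx c) (by simpa using htail) rfl (hstep false)
          fun h0 => wp_test (a := .cell px qx c) (by simpa using htail) rfl (hstep true)
          fun h1 hg => ?_
        -- the block of the first index is exhausted, and the second index becomes too long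
        have hlen : c.length = K := by
          by_contra hne
          obtain ⟨d, hd⟩ := exists_cons_suffix hc
            (lt_of_le_of_ne hc.length_le (by rwa [hwl]))
          cases d
          · exact h0 ((hR.cell_mem_iff hE hw).2 hd)
          · exact h1 ((hR.cell_mem_iff hE hw).2 hd)
        obtain ⟨z, -, hz⟩ := hg
        have := hR.length_entry hz
        simp at this
        omega
    · exact not_goodRight_sep
    · simp only [goodRight_hash, List.head?_cons, List.tail_cons]
      simp only [algorithm, onRight]
      refine wp_crossTrie hR hE h fun past' g A h hlt => ?_
      cases past'
      · rintro ⟨-, hg⟩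
        have := hR.length_entry hg
        have := hlt rfl
        omega
      · obtain ⟨p, t, rfl, hp, ht, rfl, hst⟩ := h
        refine wp_atEnd (p := px) (q := qx) (y := c) (b := w) (by simpa using htail) hc
          (fun d => hR.cell_mem_iff hE hw) ?_ ?_
        · rintro hne ⟨-, hg⟩
          have := hR.length_entry hg
          exact hne (hc.eq_of_length (by simp at this; omega))
        · rintro rfl
          refine decides_final (and_iff_left ?_)
          rw [hR.entry_append hp]
          exact (hR.stored_trie_iff (by omega) hwl).1 hst

/-- The first index is followed to its leaf, where its block is found. -/
theorem decides_left (hR : Table K R) {s : List Bool} (hs : ∃ p q v, R p q v ∧ s <:+ p)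
    (u : List Symb) :
    ∀ (m : Mem Node 11) (past : Bool) (X : List Bool), (∀ x, x ∈ m.edges ↔ Stored R x) →
      m.reg rIndex = .index s → At K R .group past X (m.reg rGroup) →
      algorithm.Decides naming (.left past) m u (GoodLeft R s X u) := by
  induction u with
  | nil => exact fun m past X _ _ _ => Algorithm.Decides.of_wp not_goodLeft_nil
  | cons a u ih =>
    intro m past X hE hindex h
    refine Algorithm.Decides.of_wp ?_
    rcases a with b | _ | _
    · simp only [goodLeft_bit, List.head?_cons, List.tail_cons]
      simp only [algorithm, onLeft]
      refine wp_cross hR hE h fun past' g A h hlt => ?_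
      cases past'
      · obtain ⟨rfl, -⟩ := h
        have hlt := hlt rfl
        refine wp_advance (a := .index X) (by simp) rfl (fun hm hg => hm ?_) (fun hm => ?_)
        · obtain ⟨z, v, -, -, hz, -⟩ := hg
          obtain ⟨p, q, hr, hs⟩ := hR.suffix_of_entry (by simpa using hlt) hz
          exact (hE _).2 ⟨by simp, p, q, v, hr, hs⟩
        · obtain ⟨-, p, q, v, hr, hs⟩ := (hE _).1 hm
          exact ih _ _ _ hE (by simpa using hindex) ⟨by simp, p, q, v, hr, hs⟩
      · obtain ⟨p, t, rfl, hp, rfl⟩ := h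
        refine wp_advance (a := .group p t) (by simp) rfl (fun hm hg => hm ?_) (fun hm => ?_)
        · obtain ⟨z, v, -, -, hz, -⟩ := hg
          rw [show z.reverse ++ b :: (t ++ p) = (z.reverse ++ b :: t) ++ p by simp,
            hR.entry_append hp] at hz
          exact (hE _).2 ⟨_, _, hz, List.suffix_append _ _⟩
        · exact ih _ _ _ hE (by simpa using hindex) ⟨p, b :: t, by simp, hp, by simp⟩
    · exact not_goodLeft_sep
    · simp only [goodLeft_hash, List.head?_cons, List.tail_cons]
      simp only [algorithm, onLeft]
      refine wp_cross hR hE h fun past' g A h hlt => ?_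
      cases past'
      · rintro ⟨v, hg, -⟩
        have := hR.length_entry hg
        have := hlt rfl
        omega
      · obtain ⟨p, t, rfl, hp, rfl⟩ := h
        refine wp_test (a := .group p t) (w := .cell p t []) (by simp) rfl (fun hm => ?_)
          (fun hm => ?_)
        · obtain ⟨w, hw, -⟩ := (hE _).1 hm
          refine wp_down (a := .group p t) (w := .cell p t []) (by simp) rfl (fun _ => hm) ?_
          simp only [Set.insert_eq_of_mem hm]
          refine wp_move (a := .cell p t []) (by simp) ?_
          refine wp_move (a := .index s) (by simpa [Mem.point] using hindex) ?_
          have := decides_right hR hw u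
            ⟨Function.update (Function.update (Function.update (Function.update m.reg rGroup
              (.group p t)) rGroup (.cell p t [])) rTail (.cell p t [])) rGroup (.index s),
              m.edges, insert (.cell p t []) A⟩ false s [] hE (by simp) List.nil_suffix
              ⟨rfl, by simp, hs⟩
          have hP : (∃ v, Entry R (t ++ p) v ∧ GoodRight R v s u) ↔ GoodRight R w s u := by
            simp only [hR.entry_append hp]
            exact ⟨fun ⟨v, hv, hg⟩ => hR.unique hv hw ▸ hg, fun hg => ⟨w, hw, hg⟩⟩
          rw [← hP] at this
          exact this
        · rintro ⟨v, hg, -⟩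
          rw [hR.entry_append hp] at hg
          exact hm ((hE _).2 ⟨v, hg, List.nil_suffix⟩)

end Shvachko

namespace Shvachko

open Forest

/-! ### The part of a word that consists of the blocks -/

variable {K : ℕ} {bs : List (List Bool)} {cur : List Bool} {u : List Symb}

/-- The word `u` consists of two indices, in a number of digits that matches the number of blocks,
with the same block.  The numbers of `2K` digits have a leading `0` in the forest. -/
def GoodTable (K : ℕ) (bs : List (List Bool)) (u : List Symb) : Prop :=
  ∃ s, (bs.length = 2 ^ (2 * K + 1) ∧ s = [] ∨ bs.length = 2 ^ (2 * K) ∧ s = [false]) ∧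
    GoodLeft (Visited K bs) s s u

/-- The word `u` completes the blocks `bs` and the part `cur` of the next block to a word
of the language with blocks of length `K`.  The digits of `bs` and `cur` are in reverse order. -/
def GoodBlocks (K : ℕ) (bs : List (List Bool)) (cur : List Bool) (u : List Symb) : Prop :=
  ∃ (c : List Bool) (ls : List (List Bool)) (rest : List Symb),
    u = word c ++ (ls.flatMap (fun l => .sep :: word l) ++ .hash :: rest) ∧
    c.length + cur.length = K ∧ (∀ l ∈ ls, l.length = K) ∧
    GoodTable K (bs ++ (c.reverse ++ cur) :: ls.map List.reverse) rest

theorem goodBlocks_bit {b : Bool} :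
    GoodBlocks K bs cur (.bit b :: u) ↔ GoodBlocks K bs (b :: cur) u := by
  constructor
  · rintro ⟨_ | ⟨d, c⟩, ls, rest, h, hl, hls, hg⟩
    · cases ls <;> simp [word] at h
    · simp only [word, List.map_cons, List.cons_append, List.cons.injEq, Symb.bit.injEq] at h
      obtain ⟨rfl, rfl⟩ := h
      exact ⟨c, ls, rest, rfl, by simp at hl ⊢; omega, hls, by simpa using hg⟩
  · rintro ⟨c, ls, rest, rfl, hl, hls, hg⟩
    exact ⟨b :: c, ls, rest, by simp [word], by simp at hl ⊢; omega, hls, by simpa using hg⟩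

theorem goodBlocks_sep :
    GoodBlocks K bs cur (.sep :: u) ↔ cur.length = K ∧ GoodBlocks K (bs ++ [cur]) [] u := by
  constructor
  · rintro ⟨_ | ⟨d, c⟩, _ | ⟨l, ls⟩, rest, h, hl, hls, hg⟩
    · simp [word] at h
    · simp only [word, List.map_nil, List.nil_append, List.flatMap_cons, List.cons_append,
        List.cons.injEq, true_and, List.append_assoc] at h
      exact ⟨by simpa using hl, l, ls, rest, h, by simpa using hls l (by simp),
        fun l hl => hls l (by simp [hl]), by simpa using hg⟩
    · simp [word] at h
    · simp [word] at h
  · rintro ⟨hl, c, ls, rest, rfl, hc, hls, hg⟩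
    refine ⟨[], c :: ls, rest, by simp [word], by simpa using hl, ?_, by simpa using hg⟩
    simpa using ⟨hc, hls⟩

theorem goodBlocks_hash :
    GoodBlocks K bs cur (.hash :: u) ↔ cur.length = K ∧ GoodTable K (bs ++ [cur]) u := by
  constructor
  · rintro ⟨_ | ⟨d, c⟩, _ | ⟨l, ls⟩, rest, h, hl, hls, hg⟩
    · simp only [word, List.map_nil, List.nil_append, List.flatMap_nil, List.cons.injEq,
        true_and] at h
      obtain rfl := h
      exact ⟨by simpa using hl, by simpa using hg⟩
    · simp [word] at h
    · simp [word] at h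
    · simp [word] at h
  · rintro ⟨hl, hg⟩
    exact ⟨[], [], u, by simp [word], by simpa using hl, by simp, by simpa using hg⟩

theorem not_goodBlocks_nil : ¬ GoodBlocks K bs cur [] := by
  rintro ⟨c, ls, rest, h, -⟩
  simp at h

theorem GoodTable.length_le (h : GoodTable K bs u) : bs.length ≤ 2 ^ (2 * K + 1) := by
  obtain ⟨s, ⟨h, -⟩ | ⟨h, -⟩, -⟩ := h <;> rw [h]
  exact Nat.pow_le_pow_right (by norm_num) (by omega)

theorem GoodBlocks.length_lt (h : GoodBlocks K bs cur u) : bs.length < 2 ^ (2 * K + 1) := by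
  obtain ⟨c, ls, rest, -, -, -, hg⟩ := h
  have := hg.length_le
  simp at this
  omega

theorem table_visited (hlen : ∀ b ∈ bs, b.length = K) (hle : bs.length ≤ 2 ^ (2 * K + 1)) :
    Table K (Visited K bs) where
  length_high := by
    rintro p q v ⟨i, -, rfl, -⟩
    exact length_high K i
  length_low := by
    rintro p q v ⟨i, -, -, rfl⟩
    exact length_low K i
  length_block := by
    rintro p q v ⟨i, hi, -⟩
    exact hlen v (List.mem_of_getElem? hi)
  unique := by
    intro p q v w hv hw
    obtain ⟨i, hi, hiv, rfl, rfl⟩ := hv.exists_lt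
    obtain ⟨j, hj, hjw, hp, hq⟩ := hw.exists_lt
    obtain rfl := eq_of_high_eq_of_low_eq (by omega) (by omega) hp hq
    exact Option.some.inj (hiv.symm.trans hjw)

theorem exists_visited (hne : bs ≠ []) {s : List Bool} (hs : s = [] ∨ s = [false]) :
    ∃ p q v, Visited K bs p q v ∧ s <:+ p := by
  obtain ⟨b, bs, rfl⟩ := List.exists_cons_of_ne_nil hne
  refine ⟨_, _, b, ⟨0, rfl, rfl, rfl⟩, ?_⟩
  rcases hs with rfl | rfl
  · exact List.nil_suffix
  · rw [high, digits_add, Nat.zero_div, Nat.zero_div]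
    exact List.suffix_append _ _

/-- The invariants imply that the words of the language with blocks of length `K` are recognized.
Here `K` is the length of the first block, which is not known to the algorithm before
the block ends: this is expressed by the hypothesis on `u`. -/
theorem decides_block (u : List Symb) :
    ∀ (m : Mem Node 11) (bs : List (List Bool)) (cur tp tq : List Bool) (first fresh zero : Bool)
      (top : Option Bool), Frame K bs fresh → Inv K bs fresh zero top cur tp tq m →
      Ruler K bs first cur.length m →
      (bs = [] → ∃ c r, u = word c ++ r ∧ c.length + cur.length = K ∧
        ∀ b r', r ≠ .bit b :: r') →
      algorithm.Decides naming (.block first fresh zero top) m u (GoodBlocks K bs cur u) := by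
  induction u with
  | nil =>
    exact fun m bs cur tp tq first fresh zero top _ _ _ _ =>
      Algorithm.Decides.of_wp not_goodBlocks_nil
  | cons a u ih =>
    intro m bs cur tp tq first fresh zero top hf h hr hpro
    refine Algorithm.Decides.of_wp ?_
    have hbs : first = true → bs = [] := fun hfirst => by
      simpa [hfirst] using hr.first_eq
    rcases a with v | _ | _
    · simp only [algorithm, goodBlocks_bit, List.head?_cons, List.tail_cons]
      refine wp_onBit hf h hr v (fun hfirst => ?_) ?_ ?_
      · obtain ⟨_ | ⟨d, c⟩, r, hu, hl, hne⟩ := hpro (hbs hfirst)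
        · exact absurd hu.symm (hne v u)
        · simp at hl
          omega
      · rintro hle ⟨c, ls, rest, -, hl, -⟩
        simp at hl
        omega
      · refine fun zero' top' tp' tq' m' hlt h' hr' => ih _ _ _ _ _ _ _ _ _ hf h' hr' ?_
        intro hnil
        obtain ⟨_ | ⟨d, c⟩, r, hu, hl, hne⟩ := hpro hnil
        · exact absurd hu.symm (hne v u)
        · simp only [word, List.map_cons, List.cons_append, List.cons.injEq] at hu
          exact ⟨c, r, hu.2, by simp at hl ⊢; omega, hne⟩
    · simp only [algorithm, goodBlocks_sep, List.head?_cons, List.tail_cons]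
      refine wp_onSep hf h hr (fun hfirst => ?_) ?_ ?_
      · obtain ⟨_ | ⟨d, c⟩, r, hu, hl, hne⟩ := hpro (hbs hfirst)
        · simpa using hl
        · simp [word] at hu
      · rintro (hne | hl) ⟨hl', hg⟩
        · exact hne hl'
        · have := hg.length_lt
          simp at this
          omega
      · intro fresh' top' tp' m' hl hf' h' hr'
        have := ih _ _ _ _ _ _ _ _ _ hf' h' hr' (by simp)
        rw [← and_iff_right hl (b := GoodBlocks K (bs ++ [cur]) [] u)] at this
        exact this
    · simp only [algorithm, goodBlocks_hash, List.head?_cons, List.tail_cons]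
      refine wp_onHash hf h hr (fun hfirst => ?_) ?_ ?_
      · obtain ⟨_ | ⟨d, c⟩, r, hu, hl, hne⟩ := hpro (hbs hfirst)
        · simpa using hl
        · simp [word] at hu
      · rintro hrej ⟨hl, s, hs, -⟩
        simp only [List.length_append, List.length_singleton] at hs
        omega
      · intro s m' hl hs hE hindex hgroup
        have hlen : ∀ b ∈ bs ++ [cur], b.length = K := by
          simpa [or_imp, forall_and] using ⟨hf.len, hl⟩
        have hR : Table K (Visited K (bs ++ [cur])) :=
          table_visited hlen (by simpa using hf.lt)
        have hv : ∃ p q v, Visited K (bs ++ [cur]) p q v ∧ s <:+ p :=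
          exists_visited (by simp) (hs.imp And.right And.right)
        have := decides_left hR hv u m' false s hE hindex ⟨hgroup, hv⟩
        have hP : (cur.length = K ∧ GoodTable K (bs ++ [cur]) u) ↔
            GoodLeft (Visited K (bs ++ [cur])) s s u := by
          refine ⟨?_, fun hg => ⟨hl, s, by simpa using hs, hg⟩⟩
          rintro ⟨-, s', hs', hg⟩
          have hpow : 2 ^ (2 * K + 1) ≠ 2 ^ (2 * K) := by
            rw [Nat.pow_succ]
            have : 0 < 2 ^ (2 * K) := by positivity
            omega
          simp only [List.length_append, List.length_singleton] at hs'
          obtain rfl : s' = s := by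
            rcases hs with ⟨h1, rfl⟩ | ⟨h1, rfl⟩ <;> rcases hs' with ⟨h2, rfl⟩ | ⟨h2, rfl⟩
            · rfl
            · exact absurd (h1.symm.trans h2) hpow
            · exact absurd (h2.symm.trans h1) hpow
            · rfl
          exact hg
        rw [← hP] at this
        exact this

end Shvachko

/-! ### The words of the language -/

namespace Shvachko

open Forest

theorem length_bitStrings (n : ℕ) : (bitStrings n).length = 2 ^ n := by
  induction n with
  | zero => rfl
  | succ n ih =>
    simp only [bitStrings, List.length_append, List.length_map, ih]
    omega

theorem mem_bitStrings {n : ℕ} {t : List Bool} : t ∈ bitStrings n ↔ t.length = n := by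
  induction n generalizing t with
  | zero => simp [bitStrings]
  | succ n ih =>
    simp only [bitStrings, List.mem_append, List.mem_map, ih]
    rcases t with _ | ⟨_ | _, t⟩ <;> simp

theorem digits_sub_two_pow {n i : ℕ} (h : 2 ^ n ≤ i) : digits n (i - 2 ^ n) = digits n i := by
  induction n generalizing i with
  | zero => rfl
  | succ n ih =>
    rw [Nat.pow_succ] at h ⊢
    rw [digits, digits, show (i - 2 ^ n * 2) % 2 = i % 2 by omega,
      show (i - 2 ^ n * 2) / 2 = i / 2 - 2 ^ n by omega, ih (by omega)]

/-- The string of number `i` in the lexicographic order is the binary representation of `i`. -/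
theorem getElem?_bitStrings {n i : ℕ} (hi : i < 2 ^ n) :
    (bitStrings n)[i]? = some (digits n i).reverse := by
  induction n generalizing i with
  | zero =>
    rw [Nat.pow_zero, Nat.lt_one_iff] at hi
    subst hi
    rfl
  | succ n ih =>
    rw [bitStrings, digits_add]
    have hpos : 0 < 2 ^ n := by positivity
    rw [Nat.pow_succ] at hi
    by_cases h : i < 2 ^ n
    · rw [List.getElem?_append_left (by simpa [length_bitStrings] using h), List.getElem?_map, ih h,
        Nat.div_eq_of_lt h]
      simp [digits]
    · have h1 : i / 2 ^ n = 1 := by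
        refine Nat.div_eq_of_lt_le ?_ ?_ <;> omega
      rw [List.getElem?_append_right (by simpa [length_bitStrings] using h), List.getElem?_map,
        List.length_map, length_bitStrings, ih (by omega), digits_sub_two_pow (by omega), h1]
      simp [digits]

/-- A family of blocks is a list of blocks. -/
theorem exists_map_bitStrings {n : ℕ} {bs : List (List Bool)} (h : bs.length = 2 ^ n) :
    ∃ b : List Bool → List Bool, (bitStrings n).map b = bs := by
  have : ∀ t : List Bool, ∃ i, t.length = n → i < 2 ^ n ∧ digits n i = t.reverse := by
    intro t
    obtain ⟨i, hi, hd⟩ := exists_digits_eq t.reverse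
    rw [List.length_reverse] at hi hd
    exact ⟨i, fun ht => ht ▸ ⟨hi, hd⟩⟩
  choose f hf using this
  refine ⟨fun t => bs.getD (f t) [], List.ext_getElem? fun i => ?_⟩
  by_cases hi : i < 2 ^ n
  · rw [List.getElem?_map, getElem?_bitStrings hi, Option.map_some]
    obtain ⟨h1, h2⟩ := hf (digits n i).reverse (by simp [length_digits])
    rw [List.reverse_reverse] at h2
    rw [digits_injective h1 hi h2, List.getElem?_eq_getElem (by omega),
      List.getD_eq_getElem _ _ (by omega)]
  · rw [List.getElem?_eq_none (by simpa [length_bitStrings] using hi),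
      List.getElem?_eq_none (by omega)]

/-- The word that consists of the blocks `bs` and the numbers `i` and `j` in `n` digits. -/
def codeword (n : ℕ) (bs : List (List Bool)) (i j : ℕ) : List Symb :=
  [.sep].intercalate (bs.map word) ++ .hash :: (word (digits n i).reverse ++
    .hash :: (word (digits n j).reverse ++ [.hash]))

/-- The words of the language in terms of lists of blocks and of numbers of blocks. -/
theorem mem_L_iff {w : List Symb} : w ∈ L ↔ ∃ (n : ℕ) (bs : List (List Bool)) (i j : ℕ)
    (v : List Bool), bs.length = 2 ^ n ∧ (∀ l ∈ bs, l.length = n / 2) ∧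
      bs[i]? = some v ∧ bs[j]? = some v ∧ w = codeword n bs i j := by
  have hget : ∀ (n : ℕ) (b : List Bool → List Bool) (i : ℕ), i < 2 ^ n →
      ((bitStrings n).map b)[i]? = some (b (digits n i).reverse) := by
    intro n b i hi
    rw [List.getElem?_map, getElem?_bitStrings hi, Option.map_some]
  constructor
  · rintro ⟨n, b, x, y, hb, hx, hy, hxy, rfl⟩
    obtain ⟨i, hi, hix⟩ := exists_digits_eq x.reverse
    obtain ⟨j, hj, hjy⟩ := exists_digits_eq y.reverse
    rw [List.length_reverse, hx] at hi hix
    rw [List.length_reverse, hy] at hj hjy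
    refine ⟨n, (bitStrings n).map b, i, j, b x, by rw [List.length_map, length_bitStrings], ?_, ?_,
      ?_, ?_⟩
    · intro l hl
      obtain ⟨t, ht, rfl⟩ := List.mem_map.1 hl
      exact hb t (mem_bitStrings.1 ht)
    · rw [hget _ _ _ hi, hix, List.reverse_reverse]
    · rw [hget _ _ _ hj, hjy, List.reverse_reverse, hxy]
    · simp [codeword, encode, hix, hjy, Function.comp_def]
  · rintro ⟨n, bs, i, j, v, hn, hbs, hi, hj, rfl⟩
    obtain ⟨b, rfl⟩ := exists_map_bitStrings hn
    have hlt : ∀ i : ℕ, ((bitStrings n).map b)[i]? = some v → i < 2 ^ n := by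
      intro i hi
      have := (List.getElem?_eq_some_iff.1 hi).1
      rwa [hn] at this
    have hi' := hlt i hi
    have hj' := hlt j hj
    rw [hget _ _ _ hi', Option.some.injEq] at hi
    rw [hget _ _ _ hj', Option.some.injEq] at hj
    refine ⟨n, b, (digits n i).reverse, (digits n j).reverse, ?_, by simp [length_digits],
      by simp [length_digits], hi.trans hj.symm, by simp [codeword, encode, Function.comp_def]⟩
    exact fun t ht => hbs _ (List.mem_map_of_mem (mem_bitStrings.2 ht))

/-- Numbers of `n` digits are filled up with zeros to `2K + 1` digits. -/
theorem entry_visited_iff {K n : ℕ} {bs : List (List Bool)} {x s v : List Bool}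
    (hbs : bs.length = 2 ^ n) (hs : ∃ e, n + e = 2 * K + 1 ∧ s = List.replicate e false) :
    Entry (Visited K bs) (x.reverse ++ s) v ↔ ∃ i, bs[i]? = some v ∧ x = (digits n i).reverse := by
  obtain ⟨e, he, rfl⟩ := hs
  have key : ∀ i < bs.length, low K i ++ high K i = digits n i ++ List.replicate e false := by
    intro i hi
    rw [low_append_high, ← he, digits_eq_replicate (hbs ▸ hi)]
  constructor
  · rintro ⟨p, q, h, hv⟩
    obtain ⟨i, hi, hiv, rfl, rfl⟩ := hv.exists_lt
    rw [key i hi, List.append_left_inj] at h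
    exact ⟨i, hiv, by rw [← h, List.reverse_reverse]⟩
  · rintro ⟨i, hi, rfl⟩
    refine ⟨high K i, low K i, ?_, i, hi, rfl, rfl⟩
    rw [key i (List.getElem?_eq_some_iff.1 hi).1, List.reverse_reverse]

theorem goodTable_iff {K : ℕ} {bs : List (List Bool)} {u : List Symb} :
    GoodTable K bs u ↔ ∃ (n i j : ℕ) (v : List Bool), n / 2 = K ∧ bs.length = 2 ^ n ∧
      bs[i]? = some v ∧ bs[j]? = some v ∧ u = word (digits n i).reverse ++
        .hash :: (word (digits n j).reverse ++ [.hash]) := by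
  have key : ∀ {n : ℕ} {s : List Bool}, bs.length = 2 ^ n →
      (∃ e, n + e = 2 * K + 1 ∧ s = List.replicate e false) →
      (GoodLeft (Visited K bs) s s u ↔ ∃ i j v, bs[i]? = some v ∧ bs[j]? = some v ∧
        u = word (digits n i).reverse ++ .hash :: (word (digits n j).reverse ++ [.hash])) := by
    intro n s hn hs
    simp only [GoodLeft, GoodRight, entry_visited_iff hn hs]
    constructor
    · rintro ⟨x, v, _, rfl, ⟨i, hi, rfl⟩, y, rfl, j, hj, rfl⟩
      exact ⟨i, j, v, hi, hj, rfl⟩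
    · rintro ⟨i, j, v, hi, hj, rfl⟩
      exact ⟨_, v, _, rfl, ⟨i, hi, rfl⟩, _, rfl, j, hj, rfl⟩
  constructor
  · rintro ⟨s, ⟨hn, rfl⟩ | ⟨hn, rfl⟩, h⟩
    · obtain ⟨i, j, v, h⟩ := (key hn ⟨0, rfl, rfl⟩).1 h
      exact ⟨_, i, j, v, by omega, hn, h⟩
    · obtain ⟨i, j, v, h⟩ := (key hn ⟨1, rfl, rfl⟩).1 h
      exact ⟨_, i, j, v, by omega, hn, h⟩
  · rintro ⟨n, i, j, v, rfl, hn, h⟩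
    rcases Nat.even_or_odd' n with ⟨k, rfl | rfl⟩
    · have hk : 2 * k / 2 = k := by omega
      rw [hk] at key ⊢
      exact ⟨[false], Or.inr ⟨hn, rfl⟩, (key hn ⟨1, rfl, rfl⟩).2 ⟨i, j, v, h⟩⟩
    · have hk : (2 * k + 1) / 2 = k := by omega
      rw [hk] at key ⊢
      exact ⟨[], Or.inl ⟨hn, rfl⟩, (key hn ⟨0, rfl, rfl⟩).2 ⟨i, j, v, h⟩⟩

theorem intercalate_sep (c : List Bool) (ls : List (List Bool)) :
    [Symb.sep].intercalate ((c :: ls).map word) = word c ++ ls.flatMap fun l => .sep :: word l := by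
  induction ls generalizing c with
  | nil => simp
  | cons l ls ih =>
    rw [List.map_cons, List.map_cons, List.intercalate_cons_cons, ← List.map_cons, ih]
    simp

theorem goodBlocks_nil_iff {K : ℕ} {w : List Symb} :
    GoodBlocks K [] [] w ↔ ∃ (n : ℕ) (bs : List (List Bool)) (i j : ℕ) (v : List Bool),
      n / 2 = K ∧ bs.length = 2 ^ n ∧ (∀ l ∈ bs, l.length = K) ∧
      bs[i]? = some v ∧ bs[j]? = some v ∧ w = codeword n bs i j := by
  constructor
  · rintro ⟨c, ls, rest, rfl, hc, hls, hg⟩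
    obtain ⟨n, i, j, v, hK, hn, hi, hj, rfl⟩ := goodTable_iff.1 hg
    have hmap : [] ++ (c.reverse ++ []) :: ls.map List.reverse = (c :: ls).map List.reverse := by
      simp
    rw [hmap] at hn hi hj
    rw [List.getElem?_map, Option.map_eq_some_iff] at hi hj
    obtain ⟨vi, hi, rfl⟩ := hi
    obtain ⟨vj, hj, hij⟩ := hj
    obtain rfl := List.reverse_injective hij
    refine ⟨n, c :: ls, i, j, vj, hK, by simpa using hn, ?_, hi, hj, ?_⟩
    · simpa using ⟨hc, hls⟩
    · rw [codeword, intercalate_sep, List.append_assoc]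
  · rintro ⟨n, bs, i, j, v, hK, hn, hbs, hi, hj, rfl⟩
    obtain ⟨c, ls, rfl⟩ := List.exists_cons_of_ne_nil (l := bs) (by
      rintro rfl
      simp at hi)
    refine ⟨c, ls, _, by rw [codeword, intercalate_sep, List.append_assoc],
      by simpa using hbs c (by simp), fun l hl => hbs l (by simp [hl]), goodTable_iff.2
      ⟨n, i, j, v.reverse, hK, by simpa using hn, ?_, ?_, rfl⟩⟩
    · simpa [← List.getElem?_map] using congrArg (Option.map List.reverse) hi
    · simpa [← List.getElem?_map] using congrArg (Option.map List.reverse) hj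

theorem word_append_inj {c c' : List Bool} {r r' : List Symb} (h : word c ++ r = word c' ++ r')
    (hr : ∀ b t, r ≠ .bit b :: t) (hr' : ∀ b t, r' ≠ .bit b :: t) : c = c' := by
  induction c generalizing c' with
  | nil =>
    cases c' with
    | nil => rfl
    | cons b c' => exact absurd h (hr _ _)
  | cons b c ih =>
    cases c' with
    | nil => exact absurd h.symm (hr' _ _)
    | cons b' c' =>
      simp only [word, List.map_cons, List.cons_append, List.cons.injEq, Symb.bit.injEq] at h
      rw [h.1, ih h.2]

theorem exists_word_append (w : List Symb) :
    ∃ c r, w = word c ++ r ∧ ∀ b t, r ≠ .bit b :: t := by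
  induction w with
  | nil => exact ⟨[], [], rfl, by simp⟩
  | cons a w ih =>
    rcases a with b | _ | _
    · obtain ⟨c, r, rfl, hr⟩ := ih
      exact ⟨b :: c, r, rfl, hr⟩
    · exact ⟨[], _, rfl, by simp⟩
    · exact ⟨[], _, rfl, by simp⟩

/-- The length of the first block of a word determines the length of all blocks. -/
theorem goodBlocks_iff_mem_L {c : List Bool} {r : List Symb} (hr : ∀ b t, r ≠ .bit b :: t) :
    GoodBlocks c.length [] [] (word c ++ r) ↔ word c ++ r ∈ L := by
  rw [mem_L_iff]
  constructor
  · intro h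
    obtain ⟨n, bs, i, j, v, hK, hn, hbs, h⟩ := goodBlocks_nil_iff.1 h
    exact ⟨n, bs, i, j, v, hn, hK ▸ hbs, h⟩
  · rintro ⟨n, bs, i, j, v, hn, hbs, h⟩
    have hg : GoodBlocks (n / 2) [] [] (word c ++ r) :=
      goodBlocks_nil_iff.2 ⟨n, bs, i, j, v, rfl, hn, hbs, h⟩
    obtain ⟨c', ls, rest, hw, hc, -⟩ := id hg
    obtain rfl := word_append_inj hw hr (by cases ls <;> simp)
    rw [List.length_nil, Nat.add_zero] at hc
    rwa [hc]

theorem accepts_iff (w : List Symb) :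
    (∃ t, (algorithm.machine.run w t).Accepting) ↔ w ∈ L := by
  obtain ⟨c, r, rfl, hr⟩ := exists_word_append w
  rw [← goodBlocks_iff_mem_L hr]
  refine Algorithm.accepts_iff_of_wp_start (ν := naming) algorithm (o := Node.index []) ?_
  have hv : ∀ p q v, ¬ Visited c.length [] p q v := fun p q v ⟨i, hi, _⟩ => by simp at hi
  have hf : Frame c.length [] true := ⟨by simp, by simp, by simp, by simp⟩
  refine wp_beginGroup hf ⟨fun x => ?_, rfl, by simp⟩ (by simp) rfl fun top tp m' h' hr' => ?_
  · -- among the digits of the number `0` there is no branching to the right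
    have h0 : ∀ d t, ¬ (t <:+ digits d 0 ∧ t.head? = some true) := by
      rintro d t ⟨ht, h1⟩
      have := ht.subset (List.mem_of_head? h1)
      rw [← Nat.zero_add d, digits_eq_replicate (by simp)] at this
      simp [digits] at this
    have hhigh := h0 (c.length + 1)
    have hlow := h0 c.length
    rcases x with t | ⟨p, t⟩ | ⟨p, t⟩ | ⟨p, q, t⟩ <;>
      simp [Stored, Current, hv, high, low, hhigh, hlow]
  · exact decides_block _ _ _ _ _ _ _ _ _ _ hf h' hr' fun _ => ⟨c, r, rfl, rfl, hr⟩

end Shvachko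

theorem theorem1 :
    ∃ M : KUM Shvachko.Symb, M.AcceptsLanguage Shvachko.L ∧ M.RealTime :=
  ⟨Shvachko.algorithm.machine, Shvachko.accepts_iff,
    Shvachko.algorithm.realTime Shvachko.algorithm_next_none⟩
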